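/- **Proposition 5.6 (Transversality).** Let $\kappa_0\ge 1$ be an integer. For $E>(\kappa_0+\frac14)\pi$ put $r=r(E):=(\kappa_0+\frac14)\pi/E\in(0,1)$, and for $\mathfrak m\in\mathbb N$ let $h_{\mathfrak m}(z):=\big((\cosh z/\cosh 1)^{\mathfrak m}+1\big)^{-1}$. There is $\bar E=\bar E(\kappa_0)>(\kappa_0+\frac14)\pi$ such that the following holds for all $\bar E\le E_1<E_2<\infty$. Let $S,\mathfrak m_1\in\mathbb N_0$ and, for $\mathfrak m\ge\mathfrak m_1$, $E\in[E_1,E_2]$, let $y_{p,\mathfrak m}(E)\in(0,r(E))$, $p=1,\dots,\kappa_0$, be points with $y_{p,\mathfrak m}(E)\to p\pi/E$ as $\mathfrak m\to\infty$, uniformly in $E\in[E_1,E_2]$. Let $g_{\mathfrak m}(E;\cdot)$ be even real polynomials, of degree bounded uniformly in $\mathfrak m\ge\mathfrak m_1$ and $E$, with coefficients analytic in $E\in[E_1,E_2]$, such that the potential $$Q_{\mathfrak m}(E;y):=-E^2\Big(h_{\mathfrak m}\big(\tfrac yr\big)+g_{\mathfrak m}\big(E;\tfrac yr\big)\Big)$$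 satisfies $\partial_y^{2n-1}Q_{\mathfrak m}(E;\pm y_{p,\mathfrak m}(E))=0$ for $n=1,\dots,S$, $p=1,\dots,\kappa_0$, and such that for every $n\in\mathbb N_0$ there is a constant $C_n$, independent of $\mathfrak m\ge\mathfrak m_1$ and $E\in[E_1,E_2]$, with $$\sup_{|y|\le 1}\big|\partial_z^n g_{\mathfrak m}\big(E;\tfrac yr\big)\big|\le C_n\sum_{p=1}^{\kappa_0}\sum_{k=1}^{S}\big|h_{\mathfrak m}^{(2k-1)}\big(\tfrac{y_{p,\mathfrak m}(E)}{r}\big)\big| .$$ Then there is $\bar{\mathfrak m}$ such that for every $\mathfrak m\ge\bar{\mathfrak m}$ the following holds. For every $E\in[E_1,E_2]$, the operator $-\partial_y^2+Q_{\mathfrak m}(E;y)$ on even functions on $[-1,1]$ with Dirichlet boundary conditions has at least $\kappa_0$ negative eigenvalues; write the $\kappa_0$ lowest ones, in increasing order, as $-\lambda_{1,\mathfrak m}(E)^2<\dots<-\lambda_{\kappa_0,\mathfrak m}(E)^2<0$ with $\lambda_{j,\mathfrak m}(E)>0$. The frequency vector $\vec\omega_{\mathfrak m}(E):=(\lambda_{1,\mathfrak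 m}(E),\dots,\lambda_{\kappa_0,\mathfrak m}(E))$ is analytic on $[E_1,E_2]$, and there are $m_0\in\mathbb N$ and $\rho_0>0$ such that $$\max_{0\le n\le m_0}\big|\partial_E^n\vec\omega_{\mathfrak m}(E)\cdot\ell\big|\ \ge\ \rho_0\langle\ell\rangle\qquad\text{for all }E\in[E_1,E_2],\ \ell\in\mathbb Z^{\kappa_0}\setminus\{0\},$$ where $\langle\ell\rangle:=\max\{1,|\ell|\}$ with $|\ell|$ the Euclidean length. -/

import Mathlib

open scoped Polynomial

noncomputable section

namespace ShearFlow

/-- The half-width `r` of the well, given by the constraint `E * r = (κ + 1/4) * π`. -/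
def width (κ : ℕ) (E : ℝ) : ℝ := (κ + 1 / 4) * Real.pi / E

/-- The smoothed characteristic function of `(-1, 1)`:
`h_m(z) = ((cosh z / cosh 1) ^ m + 1)⁻¹`. -/
def smoothWell (m : ℕ) (z : ℝ) : ℝ := ((Real.cosh z / Real.cosh 1) ^ m + 1)⁻¹

/-- The potential `Q(y) = -E² (h_m(y / r) + g(y / r))` with polynomial corrector `g`,
where `r` is tied to `E` by the constraint. -/
def potential (κ m : ℕ) (g : ℝ[X]) (E y : ℝ) : ℝ :=
  -E ^ 2 * (smoothWell m (y / width κ E) + g.eval (y / width κ E))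

/-- The admissible polynomial correctors `g m E` (for `m ≥ m₁`, `E ∈ [E₁, E₂]`) attached to nodes
`node m E p ∈ (0, r)` that converge to `(p + 1) π / E` as `m → ∞` (`p = 0, …, κ - 1`). -/
structure IsCorrector (κ S : ℕ) (E₁ E₂ : ℝ) (m₁ : ℕ)
    (node : ℕ → ℝ → Fin κ → ℝ) (g : ℕ → ℝ → ℝ[X]) : Prop where
  /-- The nodes lie inside the well. -/
  node_mem : ∀ m, m₁ ≤ m → ∀ E ∈ Set.Icc E₁ E₂, ∀ p, node m E p ∈ Set.Ioo 0 (width κ E)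
  /-- The nodes converge to the positive zeros of `sin (E y)` in the well. -/
  node_tendsto : ∀ p : Fin κ, TendstoUniformlyOn (fun m E => node m E p)
    (fun E => ((p : ℕ) + 1) * Real.pi / E) Filter.atTop (Set.Icc E₁ E₂)
  /-- The corrector is an even polynomial. -/
  even : ∀ m, m₁ ≤ m → ∀ E ∈ Set.Icc E₁ E₂, ∀ z, (g m E).eval (-z) = (g m E).eval z
  /-- Its degree is bounded independently of `m` and `E`. -/
  degree : ∃ d : ℕ, ∀ m, m₁ ≤ m → ∀ E ∈ Set.Icc E₁ E₂, (g m E).natDegree ≤ d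
  /-- The odd derivatives of the potential of order `1, 3, …, 2 S - 1` vanish at the nodes. -/
  flat : ∀ m, m₁ ≤ m → ∀ E ∈ Set.Icc E₁ E₂, ∀ p, ∀ n ∈ Finset.Icc 1 S,
    iteratedDeriv (2 * n - 1) (potential κ m (g m E) E) (node m E p) = 0 ∧
    iteratedDeriv (2 * n - 1) (potential κ m (g m E) E) (-node m E p) = 0
  /-- Each derivative of the corrector is controlled on the channel by the odd derivatives of
  `h_m` at the rescaled nodes, with a constant that depends neither on `m` nor on `E`. -/
  bound : ∀ n : ℕ, ∃ C : ℝ, ∀ m, m₁ ≤ m → ∀ E ∈ Set.Icc E₁ E₂, ∀ y ∈ Set.Icc (-1 : ℝ) 1,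
    |(Polynomial.derivative^[n] (g m E)).eval (y / width κ E)| ≤
      C * ∑ p : Fin κ, ∑ k ∈ Finset.Icc 1 S,
        |iteratedDeriv (2 * k - 1) (smoothWell m) (node m E p / width κ E)|
  /-- The corrector, hence the potential, depends analytically on `E`. -/
  analytic : ∀ m, m₁ ≤ m → ∀ k, AnalyticOn ℝ (fun E => (g m E).coeff k) (Set.Icc E₁ E₂)

/-- `μ` is an eigenvalue of the Schrödinger operator `-∂_y² + Q(y)` on even functions on `[-1, 1]`
with Dirichlet boundary conditions. -/
def IsEigenvalue (Q : ℝ → ℝ) (μ : ℝ) : Prop :=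
  ∃ φ : ℝ → ℝ, ContDiff ℝ 2 φ ∧ (∀ y, φ (-y) = φ y) ∧ φ (-1) = 0 ∧ φ 1 = 0 ∧
    (∃ y ∈ Set.Icc (-1 : ℝ) 1, φ y ≠ 0) ∧
    ∀ y ∈ Set.Icc (-1 : ℝ) 1, -iteratedDeriv 2 φ y + Q y * φ y = μ * φ y

/-- `μ` is the eigenvalue with exactly `j` eigenvalues below it, that is, the `(j + 1)`-st one in
increasing order. -/
def IsNthEigenvalue (Q : ℝ → ℝ) (j : ℕ) (μ : ℝ) : Prop :=
  IsEigenvalue Q μ ∧ {ν | IsEigenvalue Q ν ∧ ν < μ}.encard = j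

/-- The `(j + 1)`-st eigenvalue in increasing order (at most one `μ` satisfies
`IsNthEigenvalue Q j μ`; the value is `0` if there is none). -/
def eigenvalue (Q : ℝ → ℝ) (j : ℕ) : ℝ := sInf {μ | IsNthEigenvalue Q j μ}

/-- The frequency vector `E ↦ (λ_1(E), …, λ_κ(E))`, where `-λ_j(E)²` is the `j`-th eigenvalue for
the potential with parameters `m`, `E` and corrector `g E`. -/
def frequency (κ m : ℕ) (g : ℝ → ℝ[X]) (E : ℝ) : Fin κ → ℝ :=
  fun j => Real.sqrt (-eigenvalue (potential κ m (g E) E) j)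

/-- `⟨ℓ⟩ = max {1, |ℓ|}` with the Euclidean length `|ℓ|`. -/
def bracket {κ : ℕ} (l : Fin κ → ℤ) : ℝ := max 1 (Real.sqrt (∑ j, (l j : ℝ) ^ 2))

end ShearFlow

end

noncomputable section

namespace ShearFlow

open Set Filter Topology MeasureTheory
open scoped unitInterval

/-! Write the spectral parameter as `-E² sin² β` with `β` between `0` and `π/2`. Eigenvalues are the
zeros of `D(β)`, the value at `1` of the even solution with `φ(0) = 1`; let `P(β)` be its slope at
`1`. The solution is the inverse of one minus a Volterra operator applied to the constant `1`, so it
depends analytically on the potential.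

The derivatives of `h_m` at the nodes tend to `0` with `m`, so the correctors tend to `0` uniformly,
and the potential tends in `L¹` to the square well of depth `E²` and half-width `r`. By Grönwall,
`D` and `P` converge uniformly to the explicit trigonometric functions `limValue` and `limSlope`
(`eventually_abs_endValue_sub_limValue_le`). Since `a = E r` is a constant, the phase `θ = a cos β -
n π` does not involve `E`. The window `n`, from `θ = π/2` to `θ = β`, is therefore independent of
`E`. In it `P` has a sign and `D` changes sign, while `D` has a sign between windows. These signs
persist for large `m` (`eventually_signPattern`). The Wronskian identity makes `D / P` strictly
monotone in a window, so each window contains exactly one eigenvalue. These are the lowest `κ` ones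
(`isNthEigenvalue_of_window`), and the implicit function theorem makes them analytic in `E`.

Nondegeneracy is proved for the square well and then transferred. Its frequencies are `E sin
b_n(E)`, and the secular equation reads `sin(θ - b) = e^{-2 (E - a) sin b} sin(θ + b)`. Hence, as
`E` tends to infinity, `sin b_n(E)` tends to the sine of the upper end `H_n` of the window, with
exponentially small error at rate `2 sin H_n`. The rates are distinct, so no nontrivial linear
relation holds for all large `E`; by analyticity none holds on a subinterval
(`wellAngle_linearIndependent`). A compactness argument on the unit sphere carries this to large `m`
(`eventually_nondegenerate`). Finally, a nondegenerate analytic curve has, at each `E` and in each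
direction, some nonzero derivative, and compactness gives uniform constants
(`exists_transversality`). -/

/-! ### The even solution of `φ'' = V φ` on `[0, 1]` -/

/-- Constant extension of a function on `[0, 1]` to the real line. -/
def extendI (f : C(I, ℝ)) : ℝ → ℝ := IccExtend zero_le_one f

lemma continuous_extendI (f : C(I, ℝ)) : Continuous (extendI f) := f.continuous.Icc_extend'

lemma extendI_of_mem (f : C(I, ℝ)) {y : ℝ} (hy : y ∈ Icc (0 : ℝ) 1) : extendI f y = f ⟨y, hy⟩ :=
  IccExtend_of_mem _ _ hy

lemma extendI_add (f g : C(I, ℝ)) (y : ℝ) : extendI (f + g) y = extendI f y + extendI g y := rfl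

lemma extendI_smul (c : ℝ) (f : C(I, ℝ)) (y : ℝ) : extendI (c • f) y = c * extendI f y := rfl

lemma extendI_mul (f g : C(I, ℝ)) (y : ℝ) : extendI (f * g) y = extendI f y * extendI g y := rfl

lemma abs_extendI_le (f : C(I, ℝ)) (y : ℝ) : |extendI f y| ≤ ‖f‖ := f.norm_coe_le_norm _

/-- The operator of integration from `0` on `C([0, 1])`. -/
def primitive : C(I, ℝ) →L[ℝ] C(I, ℝ) :=
  LinearMap.mkContinuous
    { toFun := fun f => ⟨fun y => ∫ t in (0 : ℝ)..y, extendI f t,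
        (intervalIntegral.continuous_primitive
          (fun a b => (continuous_extendI f).intervalIntegrable a b) 0).comp
            continuous_subtype_val⟩
      map_add' := fun f g => by
        ext y
        simp only [extendI_add, ContinuousMap.coe_mk, ContinuousMap.add_apply]
        exact intervalIntegral.integral_add ((continuous_extendI f).intervalIntegrable _ _)
          ((continuous_extendI g).intervalIntegrable _ _)
      map_smul' := fun c f => by
        ext y
        simp only [extendI_smul, ContinuousMap.coe_mk, ContinuousMap.smul_apply, RingHom.id_apply,
          smul_eq_mul]
        exact intervalIntegral.integral_const_mul _ _ } 1 (by
    intro f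
    rw [one_mul, ContinuousMap.norm_le _ (norm_nonneg f)]
    intro y
    have := intervalIntegral.norm_integral_le_of_norm_le_const (a := (0 : ℝ)) (b := y)
      (f := extendI f) (C := ‖f‖) (fun t _ => abs_extendI_le f t)
    refine this.trans ?_
    rw [sub_zero, abs_of_nonneg y.2.1]
    exact mul_le_of_le_one_right (norm_nonneg f) y.2.2)

lemma primitive_apply (f : C(I, ℝ)) (y : I) :
    primitive f y = ∫ t in (0 : ℝ)..y, extendI f t := rfl

/-- The operator `φ ↦ ∫₀ ∫₀ V φ`, depending linearly on the potential `V`. -/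
def volterra : C(I, ℝ) →L[ℝ] C(I, ℝ) →L[ℝ] C(I, ℝ) :=
  (ContinuousLinearMap.compL ℝ C(I, ℝ) C(I, ℝ) C(I, ℝ) (primitive ∘L primitive)) ∘L
    ContinuousLinearMap.mul ℝ C(I, ℝ)

lemma volterra_apply (V f : C(I, ℝ)) : volterra V f = primitive (primitive (V * f)) := rfl

lemma abs_primitive_le {f : C(I, ℝ)} {c : ℝ} {n : ℕ}
    (h : ∀ y : I, |f y| ≤ c * (y : ℝ) ^ n / n.factorial) (y : I) :
    |primitive f y| ≤ c * (y : ℝ) ^ (n + 1) / (n + 1).factorial := by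
  have hy := y.2
  rw [primitive_apply]
  have h1 : |∫ t in (0 : ℝ)..y, extendI f t| ≤ ∫ t in (0 : ℝ)..y, c * t ^ n / n.factorial := by
    rw [← Real.norm_eq_abs]
    refine intervalIntegral.norm_integral_le_of_norm_le hy.1 (Eventually.of_forall fun t ht => ?_)
      (Continuous.intervalIntegrable (by fun_prop) _ _)
    have ht' : t ∈ Icc (0 : ℝ) 1 := ⟨ht.1.le, ht.2.trans hy.2⟩
    rw [extendI_of_mem f ht']
    exact h ⟨t, ht'⟩
  refine h1.trans (le_of_eq ?_)
  rw [intervalIntegral.integral_div, intervalIntegral.integral_const_mul, integral_pow,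
    Nat.factorial_succ]
  push_cast
  have : (n.factorial : ℝ) ≠ 0 := by positivity
  have : (n + 1 : ℝ) ≠ 0 := by positivity
  field_simp
  simp

/-- Each application integrates twice. Keeping the gain of only one of the two integrations already
produces the factorial, which is all that invertibility needs. -/
lemma abs_volterra_pow_le (V f : C(I, ℝ)) (n : ℕ) (y : I) :
    |((volterra V) ^ n) f y| ≤ (‖V‖ ^ n * ‖f‖) * (y : ℝ) ^ n / n.factorial := by
  induction n generalizing y with
  | zero => simpa using f.norm_coe_le_norm y
  | succ n ih =>
    have h1 : ∀ y : I, |(V * ((volterra V) ^ n) f) y| ≤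
        (‖V‖ ^ (n + 1) * ‖f‖) * (y : ℝ) ^ n / n.factorial := by
      intro y
      rw [ContinuousMap.mul_apply, abs_mul, pow_succ']
      calc _ ≤ ‖V‖ * ((‖V‖ ^ n * ‖f‖) * (y : ℝ) ^ n / n.factorial) := by
            gcongr
            · exact V.norm_coe_le_norm y
            · exact ih y
        _ = _ := by ring
    have h2 := abs_primitive_le (abs_primitive_le h1) y
    rw [pow_succ']
    change |primitive (primitive (V * ((volterra V) ^ n) f)) y| ≤ _
    refine h2.trans ?_
    have hy := y.2
    have h3 : ((n + 1).factorial : ℝ) ≤ (n + 1 + 1).factorial := by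
      exact_mod_cast Nat.factorial_le (Nat.le_succ _)
    have h4 : (y : ℝ) ^ (n + 1 + 1) ≤ (y : ℝ) ^ (n + 1) :=
      pow_le_pow_of_le_one hy.1 hy.2 (Nat.le_succ _)
    have h5 : 0 ≤ (y : ℝ) ^ (n + 1) := pow_nonneg hy.1 _
    gcongr

/-- The Volterra operator `T` is quasinilpotent: some power has norm below `1`, so `1 - T ^ n` is
invertible, and `1 - T` is a factor of it that commutes with its cofactor. No smallness of `V`
enters. -/
lemma isUnit_one_sub_volterra (V : C(I, ℝ)) : IsUnit (1 - volterra V) := by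
  obtain ⟨n, hn⟩ : ∃ n : ℕ, ‖V‖ ^ n / (n.factorial : ℝ) < 1 :=
    ((FloorSemiring.tendsto_pow_div_factorial_atTop ‖V‖).eventually (gt_mem_nhds one_pos)).exists
  have hle : ‖(volterra V) ^ n‖ < 1 := by
    refine lt_of_le_of_lt (ContinuousLinearMap.opNorm_le_bound _ (by positivity) fun f => ?_) hn
    rw [ContinuousMap.norm_le _ (by positivity)]
    intro y
    refine (abs_volterra_pow_le V f n y).trans ?_
    have h4 : (y : ℝ) ^ n ≤ 1 := pow_le_one₀ y.2.1 y.2.2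
    calc _ ≤ (‖V‖ ^ n * ‖f‖) * 1 / n.factorial := by gcongr
      _ = _ := by ring
  have h1 : IsUnit (1 - (volterra V) ^ n) := 
    isUnit_one_sub_of_norm_lt_one (R := C(I, ℝ) →L[ℝ] C(I, ℝ)) hle
  rw [← mul_neg_geom_sum] at h1
  have hc : Commute (1 - volterra V) (∑ i ∈ Finset.range n, volterra V ^ i) :=
    (mul_neg_geom_sum (volterra V) n).trans (geom_sum_mul_neg (volterra V) n).symm
  exact (hc.isUnit_mul_iff.1 h1).1

/-- The solution of `φ'' = V φ`, `φ(0) = 1`, `φ'(0) = 0` on `[0, 1]`. -/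
def evenSol (V : C(I, ℝ)) : C(I, ℝ) := (Ring.inverse (1 - volterra V)) 1

/-- Uniqueness for the initial value problem with zero slope at `0`, in integral form. -/
lemma eq_smul_evenSol {V f : C(I, ℝ)} {c : ℝ} (h : f = c • 1 + volterra V f) :
    f = c • evenSol V := by
  have h1 : (1 - volterra V) f = c • (1 : C(I, ℝ)) := sub_eq_of_eq_add h
  have h2 : (Ring.inverse (1 - volterra V) * (1 - volterra V)) f = c • evenSol V := by
    change Ring.inverse (1 - volterra V) ((1 - volterra V) f) = _
    rw [h1, map_smul]
    rfl
  rwa [Ring.inverse_mul_cancel _ (isUnit_one_sub_volterra V)] at h2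

lemma evenSol_eq (V : C(I, ℝ)) : evenSol V = 1 + volterra V (evenSol V) := by
  have h : (1 - volterra V) (evenSol V) = 1 := by
    change ((1 - volterra V) * Ring.inverse (1 - volterra V)) 1 = 1
    rw [Ring.mul_inverse_cancel _ (isUnit_one_sub_volterra V)]
    rfl
  exact eq_add_of_sub_eq h

/-- The potential enters `1 - volterra V` affinely, and inversion in a Banach algebra is analytic at
units. -/
lemma analyticAt_evenSol (V : C(I, ℝ)) : AnalyticAt ℝ evenSol V := by
  have h1 : AnalyticAt ℝ (fun V : C(I, ℝ) => 1 - volterra V) V :=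
    by
    have h0 : AnalyticAt ℝ (fun V : C(I, ℝ) => volterra V) V :=
      ContinuousLinearMap.analyticAt (𝕜 := ℝ) (E := C(I, ℝ))
        (F := C(I, ℝ) →L[ℝ] C(I, ℝ)) volterra V
    exact analyticAt_const.sub h0
  have h2 : AnalyticAt ℝ Ring.inverse (1 - volterra V) := by
    have := analyticAt_inverse (𝕜 := ℝ) (A := C(I, ℝ) →L[ℝ] C(I, ℝ))
      (isUnit_one_sub_volterra V).unit
    simpa using this
  have h3 : AnalyticAt ℝ (fun V : C(I, ℝ) => Ring.inverse (1 - volterra V)) V :=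
    AnalyticAt.comp (g := Ring.inverse) h2 h1
  exact AnalyticAt.comp (g := ContinuousLinearMap.apply ℝ C(I, ℝ) (1 : C(I, ℝ)))
    (ContinuousLinearMap.analyticAt _ _) h3

/-- The derivative of `evenSol V`. -/
def evenSolDeriv (V : C(I, ℝ)) (y : ℝ) : ℝ := ∫ t in (0 : ℝ)..y, extendI (V * evenSol V) t

/-- The solution `evenSol V` as a twice differentiable function on the real line. -/
def evenSolFun (V : C(I, ℝ)) (y : ℝ) : ℝ := 1 + ∫ t in (0 : ℝ)..y, evenSolDeriv V t

/-- The integrand is extended continuously beyond `[0, 1]`, so the derivative is two-sided at the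
endpoints as well. -/
lemma hasDerivAt_evenSolDeriv (V : C(I, ℝ)) (y : ℝ) :
    HasDerivAt (evenSolDeriv V) (extendI V y * extendI (evenSol V) y) y :=
  intervalIntegral.integral_hasDerivAt_right
    ((continuous_extendI _).intervalIntegrable _ _)
    ((continuous_extendI _).stronglyMeasurableAtFilter _ _) (continuous_extendI _).continuousAt

lemma continuous_evenSolDeriv (V : C(I, ℝ)) : Continuous (evenSolDeriv V) :=
  continuous_iff_continuousAt.2 fun y => (hasDerivAt_evenSolDeriv V y).continuousAt

lemma hasDerivAt_evenSolFun (V : C(I, ℝ)) (y : ℝ) :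
    HasDerivAt (evenSolFun V) (evenSolDeriv V y) y :=
  (intervalIntegral.integral_hasDerivAt_right
    ((continuous_evenSolDeriv V).intervalIntegrable _ _)
    ((continuous_evenSolDeriv V).stronglyMeasurableAtFilter _ _)
    (continuous_evenSolDeriv V).continuousAt).const_add 1

lemma continuous_evenSolFun (V : C(I, ℝ)) : Continuous (evenSolFun V) :=
  continuous_iff_continuousAt.2 fun y => (hasDerivAt_evenSolFun V y).continuousAt

lemma evenSolFun_coe (V : C(I, ℝ)) (y : I) : evenSolFun V y = evenSol V y := by
  have h := congrArg (fun f : C(I, ℝ) => f y) (evenSol_eq V)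
  simp only [ContinuousMap.add_apply, ContinuousMap.one_apply] at h
  rw [h, volterra_apply, primitive_apply]
  unfold evenSolFun
  congr 1
  refine intervalIntegral.integral_congr fun t ht => ?_
  rw [uIcc_of_le y.2.1] at ht
  have ht' : t ∈ Icc (0 : ℝ) 1 := ⟨ht.1, ht.2.trans y.2.2⟩
  show _ = extendI (primitive (V * evenSol V)) t
  rw [extendI_of_mem _ ht']
  rfl

lemma evenSolFun_of_mem (V : C(I, ℝ)) {y : ℝ} (hy : y ∈ Icc (0 : ℝ) 1) :
    evenSolFun V y = extendI (evenSol V) y := by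
  rw [extendI_of_mem _ hy]
  exact evenSolFun_coe V ⟨y, hy⟩

lemma evenSolFun_zero (V : C(I, ℝ)) : evenSolFun V 0 = 1 := by simp [evenSolFun]

lemma evenSolDeriv_zero (V : C(I, ℝ)) : evenSolDeriv V 0 = 0 := by simp [evenSolDeriv]

lemma hasDerivAt_evenSolDeriv_of_mem (V : C(I, ℝ)) {y : ℝ} (hy : y ∈ Icc (0 : ℝ) 1) :
    HasDerivAt (evenSolDeriv V) (extendI V y * evenSolFun V y) y := by
  rw [evenSolFun_of_mem V hy]
  exact hasDerivAt_evenSolDeriv V y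

/-- Boundary value at `1` of the even solution. -/
def endValue (V : C(I, ℝ)) : ℝ := evenSol V 1

/-- Boundary slope at `1` of the even solution. -/
def endSlope (V : C(I, ℝ)) : ℝ := primitive (V * evenSol V) 1

lemma evenSolFun_one (V : C(I, ℝ)) : evenSolFun V 1 = endValue V := evenSolFun_coe V 1

lemma evenSolDeriv_one (V : C(I, ℝ)) : evenSolDeriv V 1 = endSlope V := rfl

lemma analyticAt_endValue (V : C(I, ℝ)) : AnalyticAt ℝ endValue V :=
  AnalyticAt.comp (g := ContinuousMap.evalCLM (M := ℝ) ℝ (1 : I))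
    (ContinuousLinearMap.analyticAt _ _) (analyticAt_evenSol V)

lemma analyticAt_endSlope (V : C(I, ℝ)) : AnalyticAt ℝ endSlope V :=
  AnalyticAt.comp (g := ContinuousMap.evalCLM (M := ℝ) ℝ (1 : I) ∘L primitive)
    (ContinuousLinearMap.analyticAt _ _) (analyticAt_id.mul (analyticAt_evenSol V))

/-- The Wronskian identity for two potentials. -/
lemma wronskian_eq (V W : C(I, ℝ)) :
    endSlope V * endValue W - endValue V * endSlope W =
      primitive ((V - W) * evenSol V * evenSol W) 1 := by
  have h := intervalIntegral.integral_eq_sub_of_hasDerivAt (a := 0) (b := 1)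
    (f := fun y => evenSolDeriv V y * evenSolFun W y - evenSolFun V y * evenSolDeriv W y)
    (f' := extendI ((V - W) * evenSol V * evenSol W)) (by
      intro y hy
      rw [uIcc_of_le zero_le_one] at hy
      convert! ((hasDerivAt_evenSolDeriv_of_mem V hy).mul (hasDerivAt_evenSolFun W y)).sub
        ((hasDerivAt_evenSolFun V y).mul (hasDerivAt_evenSolDeriv_of_mem W hy)) using 1
      rw [evenSolFun_of_mem V hy, evenSolFun_of_mem W hy, extendI_of_mem _ hy, extendI_of_mem _ hy,
        extendI_of_mem _ hy, extendI_of_mem _ hy, extendI_of_mem _ hy]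
      simp only [ContinuousMap.mul_apply, ContinuousMap.sub_apply]
      ring) ((continuous_extendI _).intervalIntegrable _ _)
  rw [evenSolFun_one, evenSolFun_one, evenSolDeriv_one, evenSolDeriv_one, evenSolDeriv_zero,
    evenSolDeriv_zero] at h
  rw [primitive_apply]
  simpa using h.symm

lemma primitive_evenSol_sq_pos (V : C(I, ℝ)) : 0 < primitive (evenSol V * evenSol V) 1 := by
  rw [primitive_apply]
  refine intervalIntegral.integral_pos (by simp) (continuous_extendI _).continuousOn
    (fun y _ => ?_) ⟨0, by simp, ?_⟩
  · rw [extendI_mul]; exact mul_self_nonneg _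
  · rw [extendI_mul, ← evenSolFun_of_mem V (by simp), evenSolFun_zero]; simp

/-- The derivative in the spectral parameter: `φ_μ'(1) D'(μ) - φ_μ(1) P'(μ) = ∫ φ_μ²`. -/
lemma endSlope_mul_deriv_sub (V : C(I, ℝ)) (μ : ℝ) {d p : ℝ}
    (hd : HasDerivAt (fun ν : ℝ => endValue (V - ν • 1)) d μ)
    (hp : HasDerivAt (fun ν : ℝ => endSlope (V - ν • 1)) p μ) :
    endSlope (V - μ • 1) * d - endValue (V - μ • 1) * p =
      primitive (evenSol (V - μ • 1) * evenSol (V - μ • 1)) 1 := by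
  have h1 := (hd.const_mul (endSlope (V - μ • 1))).sub (hp.const_mul (endValue (V - μ • 1)))
  have hcont : Continuous fun ν : ℝ =>
      primitive (evenSol (V - μ • 1) * evenSol (V - ν • 1)) 1 := by
    have he : Continuous evenSol :=
      continuous_iff_continuousAt.2 fun V => (analyticAt_evenSol V).continuousAt
    have : Continuous fun ν : ℝ => primitive (evenSol (V - μ • 1) * evenSol (V - ν • 1)) := by
      refine primitive.continuous.comp (continuous_const.mul (he.comp ?_))
      fun_prop
    exact (ContinuousMap.evalCLM ℝ (1 : I)).continuous.comp this
  -- The Wronskian identity for `V - μ` and `V - ν` has right side `(ν - μ)` times a continuous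
  -- function of `ν`; its derivative at `μ` is the value of that function there.
  have h2 : HasDerivAt (fun ν : ℝ => (ν - μ) *
      primitive (evenSol (V - μ • 1) * evenSol (V - ν • 1)) 1)
      (primitive (evenSol (V - μ • 1) * evenSol (V - μ • 1)) 1) μ := by
    rw [hasDerivAt_iff_tendsto_slope]
    refine (hcont.tendsto μ).mono_left nhdsWithin_le_nhds |>.congr' ?_
    filter_upwards [self_mem_nhdsWithin] with ν hν
    have : ν - μ ≠ 0 := sub_ne_zero.2 hν
    rw [slope_def_field]
    field_simp
    ring
  refine h1.unique (h2.congr_of_eventuallyEq (Eventually.of_forall fun ν => ?_))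
  simp only [Pi.sub_apply]
  rw [wronskian_eq]
  have : (V - μ • 1 - (V - ν • 1)) * evenSol (V - μ • 1) * evenSol (V - ν • 1) =
      (ν - μ) • (evenSol (V - μ • 1) * evenSol (V - ν • 1)) := by
    ext y
    simp
    ring
  rw [this, map_smul]
  rfl

/-- Sturm comparison with the cosine: the even solution has no zero on `[0, 1]` if `V ≥ -1`. -/
lemma endValue_pos {V : C(I, ℝ)} (hV : ∀ y, -1 ≤ V y) : 0 < endValue V := by
  suffices h : ∀ y ∈ Icc (0 : ℝ) 1, 0 < evenSolFun V y by
    rw [← evenSolFun_one]; exact h 1 (by simp)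
  by_contra! hne
  obtain ⟨y₁, hy₁, hy₁'⟩ := hne
  have hcl : IsCompact (Icc (0 : ℝ) 1 ∩ {y | evenSolFun V y ≤ 0}) :=
    isCompact_Icc.inter_right (isClosed_le (continuous_evenSolFun V) continuous_const)
  obtain ⟨y₀, ⟨hy₀, hle⟩, hleast⟩ := hcl.exists_isLeast ⟨y₁, hy₁, hy₁'⟩
  have hpos : ∀ y ∈ Ico 0 y₀, 0 < evenSolFun V y := by
    intro y hy
    by_contra! hcon
    exact absurd (hleast ⟨⟨hy.1, hy.2.le.trans hy₀.2⟩, hcon⟩) (not_le.2 hy.2)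
  have hsub : ∀ y ∈ Icc 0 y₀, y ∈ Icc (0 : ℝ) 1 := fun y hy => ⟨hy.1, hy.2.trans hy₀.2⟩
  have hcos : ∀ y ∈ Icc 0 y₀, 0 < Real.cos y := fun y hy =>
    Real.cos_pos_of_le_one (by rw [abs_of_nonneg hy.1]; exact (hsub y hy).2)
  -- The Wronskian with the cosine vanishes at `0` and has derivative `(V + 1) φ cos`, nonnegative
  -- up to the first zero `y₀` of `φ`.
  have hW : ∀ y ∈ Icc 0 y₀, 0 ≤ evenSolDeriv V y * Real.cos y + evenSolFun V y * Real.sin y := by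
    have hder : ∀ y ∈ Icc (0 : ℝ) 1, HasDerivAt
        (fun y => evenSolDeriv V y * Real.cos y + evenSolFun V y * Real.sin y)
        ((extendI V y + 1) * evenSolFun V y * Real.cos y) y := by
      intro y hy
      convert! ((hasDerivAt_evenSolDeriv_of_mem V hy).mul (Real.hasDerivAt_cos y)).add
        ((hasDerivAt_evenSolFun V y).mul (Real.hasDerivAt_sin y)) using 1
      ring
    have hmono : MonotoneOn
        (fun y => evenSolDeriv V y * Real.cos y + evenSolFun V y * Real.sin y) (Icc 0 y₀) := by
      refine monotoneOn_of_deriv_nonneg (convex_Icc _ _)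
        (fun y hy => (hder y (hsub y hy)).continuousAt.continuousWithinAt)
        (fun y hy => (hder y (hsub y (interior_subset hy))).differentiableAt.differentiableWithinAt)
        fun y hy => ?_
      rw [(hder y (hsub y (interior_subset hy))).deriv]
      rw [interior_Icc] at hy
      have h1 := hcos y ⟨hy.1.le, hy.2.le⟩
      have h2 := hpos y ⟨hy.1.le, hy.2⟩
      have h3 : -1 ≤ extendI V y := hV _
      exact mul_nonneg (mul_nonneg (by linarith) h2.le) h1.le
    intro y hy
    have := hmono ⟨le_rfl, hy₀.1⟩ hy hy.1
    simpa [evenSolDeriv_zero] using this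
  -- The derivative of `φ / cos` is this Wronskian over `cos²`, so `φ(y₀) ≥ cos y₀ > 0`, against the
  -- choice of `y₀`.
  have hR : MonotoneOn (fun y => evenSolFun V y / Real.cos y) (Icc 0 y₀) := by
    have hder : ∀ y ∈ Icc 0 y₀, HasDerivAt (fun y => evenSolFun V y / Real.cos y)
        ((evenSolDeriv V y * Real.cos y + evenSolFun V y * Real.sin y) / Real.cos y ^ 2) y := by
      intro y hy
      convert! (hasDerivAt_evenSolFun V y).div (Real.hasDerivAt_cos y) (hcos y hy).ne' using 1
      ring
    refine monotoneOn_of_deriv_nonneg (convex_Icc _ _)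
      (fun y hy => (hder y hy).continuousAt.continuousWithinAt)
      (fun y hy => (hder y (interior_subset hy)).differentiableAt.differentiableWithinAt)
      fun y hy => ?_
    rw [(hder y (interior_subset hy)).deriv]
    exact div_nonneg (hW y (interior_subset hy)) (sq_nonneg _)
  have h := hR ⟨le_rfl, hy₀.1⟩ ⟨hy₀.1, le_rfl⟩ hy₀.1
  simp only [evenSolFun_zero, Real.cos_zero, div_one] at h
  rw [le_div_iff₀ (hcos y₀ ⟨hy₀.1, le_rfl⟩)] at h
  have := hcos y₀ ⟨hy₀.1, le_rfl⟩
  simp only [mem_ofPred_eq] at hle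
  linarith

/-- Grönwall's inequality in integral form. -/
lemma le_mul_exp_of_le_integral {s : ℝ → ℝ} (hs : Continuous s) {A K : ℝ} (hK : 0 ≤ K)
    (h : ∀ y ∈ Icc (0 : ℝ) 1, s y ≤ A + K * ∫ t in (0 : ℝ)..y, s t) : s 1 ≤ A * Real.exp K := by
  set G : ℝ → ℝ := fun y => A + K * ∫ t in (0 : ℝ)..y, s t with hG
  have hGd : ∀ y, HasDerivAt G (K * s y) y := fun y =>
    ((intervalIntegral.integral_hasDerivAt_right (hs.intervalIntegrable _ _)
      (hs.stronglyMeasurableAtFilter _ _) hs.continuousAt).const_mul K).const_add A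
  have hHd : ∀ y, HasDerivAt (fun y => G y * Real.exp (-(K * y)))
      (K * (s y - G y) * Real.exp (-(K * y))) y := by
    intro y
    convert! (hGd y).mul (((hasDerivAt_id y).const_mul K).neg.exp) using 1
    simp only [id, mul_one, Pi.neg_apply]
    ring
  have hanti : AntitoneOn (fun y => G y * Real.exp (-(K * y))) (Icc 0 1) := by
    refine antitoneOn_of_deriv_nonpos (convex_Icc _ _)
      (fun y _ => (hHd y).continuousAt.continuousWithinAt)
      (fun y _ => (hHd y).differentiableAt.differentiableWithinAt) fun y hy => ?_
    rw [(hHd y).deriv]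
    refine mul_nonpos_of_nonpos_of_nonneg (mul_nonpos_of_nonneg_of_nonpos hK ?_)
      (Real.exp_pos _).le
    exact sub_nonpos.2 (h y (interior_subset hy))
  have h1 := hanti (left_mem_Icc.2 zero_le_one) (right_mem_Icc.2 zero_le_one) zero_le_one
  simp only [mul_one, mul_zero, neg_zero, Real.exp_zero] at h1
  have hG0 : G 0 = A := by simp [hG]
  rw [hG0, Real.exp_neg, ← div_eq_mul_inv, div_le_iff₀ (Real.exp_pos _)] at h1
  exact (h 1 (by simp)).trans h1

/-- The boundary data depend continuously on the potential in the `L¹` norm; the second potential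
may be discontinuous. -/
lemma abs_endValue_sub_le {V : C(I, ℝ)} {u p W : ℝ → ℝ} {s : Set ℝ} (hs : s.Countable)
    (hu : Continuous u) (hp : Continuous p)
    (hud : ∀ y ∈ Ioo (0 : ℝ) 1 \ s, HasDerivAt u (p y) y)
    (hpd : ∀ y ∈ Ioo (0 : ℝ) 1 \ s, HasDerivAt p (W y * u y) y)
    (hu0 : u 0 = 1) (hp0 : p 0 = 0) (hW : IntervalIntegrable W volume 0 1)
    {B M : ℝ} (hB : ∀ y ∈ Icc (0 : ℝ) 1, |u y| ≤ B) (hM : ‖V‖ ≤ M) :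
    |endValue V - u 1| + |endSlope V - p 1| ≤
      B * (∫ y in (0 : ℝ)..1, |extendI V y - W y|) * Real.exp (M + 1) := by
  have hM0 : 0 ≤ M := (norm_nonneg _).trans hM
  set e : ℝ → ℝ := fun y => evenSolFun V y - u y with he
  set q : ℝ → ℝ := fun y => evenSolDeriv V y - p y with hq
  have hec : Continuous e := (continuous_evenSolFun V).sub hu
  have hqc : Continuous q := (continuous_evenSolDeriv V).sub hp
  have hMe : Continuous fun t => M * |e t| := continuous_const.mul hec.abs
  have hint : IntervalIntegrable (fun y => extendI V y - W y) volume 0 1 :=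
    ((continuous_extendI V).intervalIntegrable _ _).sub hW
  have hsubint : ∀ y ∈ Icc (0 : ℝ) 1, uIcc 0 y ⊆ uIcc (0 : ℝ) 1 := by
    intro y hy
    rw [uIcc_of_le hy.1, uIcc_of_le zero_le_one]
    exact Icc_subset_Icc_right hy.2
  -- The errors satisfy `e' = q` and `q' = V e + (V - W) u` off the countable set. Hence `|e| + |q|`
  -- grows at rate at most `M + 1`, with source `B |V - W|`.
  have hmain := le_mul_exp_of_le_integral (s := fun y => |e y| + |q y|)
    (A := B * ∫ y in (0 : ℝ)..1, |extendI V y - W y|) (K := M + 1)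
    (hec.abs.add hqc.abs) (by linarith) (by
      intro y hy
      have h1 : |e y| ≤ ∫ t in (0 : ℝ)..y, |q t| := by
        have h := integral_eq_of_hasDerivAt_off_countable_of_le e q hy.1 hs hec.continuousOn
          (fun x hx => (hasDerivAt_evenSolFun V x).sub
            (hud x ⟨⟨hx.1.1, hx.1.2.trans_le hy.2⟩, hx.2⟩)) (hqc.intervalIntegrable _ _)
        have he0 : e 0 = 0 := by simp [he, evenSolFun_zero, hu0]
        rw [he0, sub_zero] at h
        rw [← h]
        exact intervalIntegral.abs_integral_le_integral_abs hy.1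
      have h2 : |q y| ≤ ∫ t in (0 : ℝ)..y, (M * |e t| + B * |extendI V t - W t|) := by
        have hsb : IntervalIntegrable (fun y => extendI V y - W y) volume 0 y :=
          hint.mono_set (hsubint y hy)
        have h := integral_eq_of_hasDerivAt_off_countable_of_le q
          (fun t => extendI V t * e t + (extendI V t - W t) * u t) hy.1 hs hqc.continuousOn
          (fun x hx => by
            have hx1 : x ∈ Ioo (0 : ℝ) 1 := ⟨hx.1.1, hx.1.2.trans_le hy.2⟩
            convert! (hasDerivAt_evenSolDeriv_of_mem V (Ioo_subset_Icc_self hx1)).sub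
              (hpd x ⟨hx1, hx.2⟩) using 1
            simp only [he]
            ring)
          ((((continuous_extendI V).mul hec).intervalIntegrable _ _).add
            (hsb.mul_continuousOn hu.continuousOn))
        have hq0 : q 0 = 0 := by simp [hq, evenSolDeriv_zero, hp0]
        rw [hq0, sub_zero] at h
        rw [← h, ← Real.norm_eq_abs]
        refine intervalIntegral.norm_integral_le_of_norm_le hy.1
          (Eventually.of_forall fun t ht => ?_)
          (((continuous_const.mul hec.abs).intervalIntegrable _ _).add (hsb.abs.const_mul B))
        rw [Real.norm_eq_abs]
        refine (abs_add_le _ _).trans ?_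
        rw [abs_mul, abs_mul, mul_comm B]
        gcongr
        · exact (abs_extendI_le V t).trans hM
        · exact hB t ⟨ht.1.le, ht.2.trans hy.2⟩
      have h3 : (∫ t in (0 : ℝ)..y, (M * |e t| + B * |extendI V t - W t|)) ≤
          (∫ t in (0 : ℝ)..y, M * |e t|) + B * ∫ t in (0 : ℝ)..1, |extendI V t - W t| := by
        rw [intervalIntegral.integral_add (hMe.intervalIntegrable _ _)
          ((hint.mono_set (hsubint y hy)).abs.const_mul B), intervalIntegral.integral_const_mul B]
        have hB0 : 0 ≤ B := (abs_nonneg _).trans (hB 0 (by simp))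
        gcongr
        refine intervalIntegral.integral_mono_interval le_rfl hy.1 hy.2
          (Eventually.of_forall fun t => abs_nonneg _) hint.abs
      have h4 : (∫ t in (0 : ℝ)..y, |q t|) + (∫ t in (0 : ℝ)..y, M * |e t|) ≤
          (M + 1) * ∫ t in (0 : ℝ)..y, (|e t| + |q t|) := by
        rw [← intervalIntegral.integral_add (hqc.abs.intervalIntegrable _ _)
          (hMe.intervalIntegrable _ _),
          ← intervalIntegral.integral_const_mul]
        refine intervalIntegral.integral_mono_on hy.1
          ((hqc.abs.add hMe).intervalIntegrable _ _)
          ((continuous_const.mul (hec.abs.add hqc.abs)).intervalIntegrable _ _) fun t _ => ?_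
        have := mul_nonneg hM0 (abs_nonneg (q t))
        have := abs_nonneg (e t)
        linarith
      linarith)
  simpa only [he, hq, evenSolFun_one, evenSolDeriv_one] using hmain

/-- Evenness forces `φ'(0) = 0`, so an eigenfunction is `φ(0)` times the normalised even solution.
It is not identically zero, hence `φ(0) ≠ 0` and the Dirichlet condition passes to the even
solution. -/
lemma IsEigenvalue.endValue_eq_zero {Q : ℝ → ℝ} {V : C(I, ℝ)} (hV : ∀ y : I, V y = Q y) {μ : ℝ}
    (h : IsEigenvalue Q μ) : endValue (V - μ • 1) = 0 := by
  obtain ⟨φ, hφ, heven, -, h1, ⟨y₀, hy₀, hne⟩, heq⟩ := h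
  have hφ' : ContDiff ℝ 1 (deriv φ) := ((contDiff_succ_iff_deriv (n := 1)).1 hφ).2.2
  have hd : ∀ y, HasDerivAt φ (deriv φ y) y :=
    fun y => ((hφ.differentiable (by norm_num)) y).hasDerivAt
  have hd' : ∀ y, HasDerivAt (deriv φ) (iteratedDeriv 2 φ y) y := by
    intro y
    rw [iteratedDeriv_succ, iteratedDeriv_one]
    exact ((hφ'.differentiable (by norm_num)) y).hasDerivAt
  have hd0 : deriv φ 0 = 0 := by
    have : deriv φ (-0) = -deriv φ 0 := by
      have h2 := deriv_comp_neg φ 0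
      rw [funext heven] at h2
      rw [h2, neg_neg]
    rw [neg_zero] at this
    linarith
  let f : C(I, ℝ) := ⟨fun y => φ y, hφ.continuous.comp continuous_subtype_val⟩
  have hf : f = φ 0 • (1 : C(I, ℝ)) + volterra (V - μ • 1) f := by
    have hp : ∀ y : I, primitive ((V - μ • 1) * f) y = deriv φ y := by
      intro y
      have h2 := intervalIntegral.integral_eq_sub_of_hasDerivAt (a := 0) (b := y)
        (f := deriv φ) (f' := extendI ((V - μ • 1) * f)) (fun t ht => by
          rw [uIcc_of_le y.2.1] at ht
          have ht' : t ∈ Icc (0 : ℝ) 1 := ⟨ht.1, ht.2.trans y.2.2⟩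
          convert! hd' t using 1
          rw [extendI_of_mem _ ht']
          have h3 := heq t ⟨by linarith [ht'.1], ht'.2⟩
          simp only [ContinuousMap.mul_apply, ContinuousMap.sub_apply, ContinuousMap.smul_apply,
            ContinuousMap.one_apply, smul_eq_mul, mul_one, hV]
          change (Q t - μ) * φ t = _
          linarith) ((continuous_extendI _).intervalIntegrable _ _)
      rw [primitive_apply, h2, hd0, sub_zero]
    ext y
    have h2 := intervalIntegral.integral_eq_sub_of_hasDerivAt (a := 0) (b := y)
      (f := φ) (f' := extendI (primitive ((V - μ • 1) * f))) (fun t ht => by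
        rw [uIcc_of_le y.2.1] at ht
        have ht' : t ∈ Icc (0 : ℝ) 1 := ⟨ht.1, ht.2.trans y.2.2⟩
        rw [extendI_of_mem _ ht', hp]
        exact hd t) ((continuous_extendI _).intervalIntegrable _ _)
    rw [ContinuousMap.add_apply, volterra_apply, primitive_apply, h2]
    simp [f]
  have hf' := eq_smul_evenSol hf
  have hf1 : φ 0 * endValue (V - μ • 1) = 0 := by
    have := congrArg (fun g : C(I, ℝ) => g 1) hf'
    simp only [ContinuousMap.smul_apply, smul_eq_mul] at this
    unfold endValue
    rw [← this]
    exact h1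
  rcases mul_eq_zero.1 hf1 with h0 | h0
  · exfalso
    apply hne
    have hz : ∀ y ∈ Icc (0 : ℝ) 1, φ y = 0 := by
      intro y hy
      have := congrArg (fun g : C(I, ℝ) => g ⟨y, hy⟩) hf'
      simpa [h0, f] using this
    rcases le_total 0 y₀ with hs | hs
    · exact hz y₀ ⟨hs, hy₀.2⟩
    · rw [← heven]
      exact hz (-y₀) ⟨by linarith, by linarith [hy₀.1]⟩
  · exact h0

/-- An eigenfunction has to be `C²` on the whole line. The second derivative, extended through
`|y|`, is continuous and even; integrating it twice from `0` gives an even `C²` function that agrees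
with the even solution on `[0, 1]`. -/
lemma isEigenvalue_of_endValue_eq_zero {Q : ℝ → ℝ} {V : C(I, ℝ)} (hV : ∀ y : I, V y = Q y)
    (hQ : ∀ y, Q (-y) = Q y) {μ : ℝ} (h : endValue (V - μ • 1) = 0) : IsEigenvalue Q μ := by
  set U := V - μ • (1 : C(I, ℝ)) with hU
  set w : ℝ → ℝ := fun y => extendI (U * evenSol U) |y| with hw
  have hwc : Continuous w := (continuous_extendI _).comp continuous_abs
  set p : ℝ → ℝ := fun y => ∫ t in (0 : ℝ)..y, w t with hp
  have hpd : ∀ y, HasDerivAt p (w y) y := fun y =>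
    intervalIntegral.integral_hasDerivAt_right (hwc.intervalIntegrable _ _)
      (hwc.stronglyMeasurableAtFilter _ _) hwc.continuousAt
  have hpc : Continuous p := continuous_iff_continuousAt.2 fun y => (hpd y).continuousAt
  set φ : ℝ → ℝ := fun y => 1 + ∫ t in (0 : ℝ)..y, p t with hφ
  have hφd : ∀ y, HasDerivAt φ (p y) y := fun y =>
    (intervalIntegral.integral_hasDerivAt_right (hpc.intervalIntegrable _ _)
      (hpc.stronglyMeasurableAtFilter _ _) hpc.continuousAt).const_add 1
  have hdp : deriv p = w := funext fun y => (hpd y).deriv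
  have hdφ : deriv φ = p := funext fun y => (hφd y).deriv
  have h2 : iteratedDeriv 2 φ = w := by
    rw [iteratedDeriv_succ, iteratedDeriv_one, hdφ, hdp]
  have hwe : ∀ y, w (-y) = w y := fun y => by simp [hw]
  have hpo : ∀ y, p (-y) = -p y := by
    intro y
    simp only [hp]
    have := intervalIntegral.integral_comp_neg (a := 0) (b := y) (f := w)
    simp only [hwe, neg_zero] at this
    rw [this, intervalIntegral.integral_symm]
  have hφe : ∀ y, φ (-y) = φ y := by
    intro y
    simp only [hφ]
    have := intervalIntegral.integral_comp_neg (a := 0) (b := y) (f := p)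
    simp only [hpo, neg_zero, intervalIntegral.integral_neg] at this
    rw [intervalIntegral.integral_symm, ← this, neg_neg]
  have hpI : ∀ y ∈ Icc (0 : ℝ) 1, p y = evenSolDeriv U y := by
    intro y hy
    refine intervalIntegral.integral_congr fun t ht => ?_
    rw [uIcc_of_le hy.1] at ht
    simp only [hw, abs_of_nonneg ht.1]
  have hφI : ∀ y ∈ Icc (0 : ℝ) 1, φ y = evenSolFun U y := by
    intro y hy
    simp only [hφ, evenSolFun]
    congr 1
    refine intervalIntegral.integral_congr fun t ht => ?_
    rw [uIcc_of_le hy.1] at ht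
    exact hpI t ⟨ht.1, ht.2.trans hy.2⟩
  have h1 : φ 1 = 0 := by rw [hφI 1 (by simp), evenSolFun_one, h]
  have heq : ∀ y ∈ Icc (0 : ℝ) 1, -w y + Q y * φ y = μ * φ y := by
    intro y hy
    rw [hφI y hy, evenSolFun_of_mem _ hy]
    simp only [hw, abs_of_nonneg hy.1, extendI_of_mem _ hy, hU, ContinuousMap.mul_apply,
      ContinuousMap.sub_apply, ContinuousMap.smul_apply, ContinuousMap.one_apply, hV]
    simp only [smul_eq_mul]
    ring
  refine ⟨φ, ?_, hφe, by rw [hφe, h1], h1, ⟨0, by simp, by simp [hφ]⟩, ?_⟩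
  · have hp1 : ContDiff ℝ 1 p := contDiff_one_iff_deriv.2
      ⟨fun y => (hpd y).differentiableAt, by rw [hdp]; exact hwc⟩
    exact (contDiff_succ_iff_deriv (n := 1)).2
      ⟨fun y => (hφd y).differentiableAt, by simp, by rw [hdφ]; exact hp1⟩
  · intro y hy
    rw [h2]
    rcases le_total 0 y with hs | hs
    · exact heq y ⟨hs, hy.2⟩
    · have := heq (-y) ⟨by linarith, by linarith [hy.1]⟩
      rwa [hwe, hφe, hQ] at this

/-! ### The smoothed well and the potential -/

lemma smoothWell_denom_pos (m : ℕ) (z : ℝ) : 0 < (Real.cosh z / Real.cosh 1) ^ m :=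
  pow_pos (div_pos (Real.cosh_pos z) (Real.cosh_pos 1)) m

lemma smoothWell_nonneg (m : ℕ) (z : ℝ) : 0 ≤ smoothWell m z :=
  inv_nonneg.2 (by linarith [smoothWell_denom_pos m z])

lemma smoothWell_le_one (m : ℕ) (z : ℝ) : smoothWell m z ≤ 1 :=
  inv_le_one_of_one_le₀ (by linarith [smoothWell_denom_pos m z])

lemma continuous_smoothWell (m : ℕ) : Continuous (smoothWell m) := by
  unfold smoothWell
  refine Continuous.inv₀ ?_ fun z => by linarith [smoothWell_denom_pos m z]
  exact ((Real.continuous_cosh.div_const _).pow m).add continuous_const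

lemma smoothWell_neg (m : ℕ) (z : ℝ) : smoothWell m (-z) = smoothWell m z := by
  simp [smoothWell]

lemma continuous_potential (κ m : ℕ) (g : Polynomial ℝ) (E : ℝ) :
    Continuous (potential κ m g E) := by
  unfold potential
  have := (continuous_smoothWell m).comp (continuous_id.div_const (width κ E))
  have := g.continuous.comp (continuous_id.div_const (width κ E))
  fun_prop

lemma potential_neg (κ m : ℕ) {g : Polynomial ℝ} (hg : ∀ z, g.eval (-z) = g.eval z) (E y : ℝ) :
    potential κ m g E (-y) = potential κ m g E y := by
  simp [potential, neg_div, smoothWell_neg, hg]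

/-- The potential as a continuous function on `[0, 1]`. -/
def potentialI (κ m : ℕ) (g : Polynomial ℝ) (E : ℝ) : C(I, ℝ) :=
  ⟨fun y => potential κ m g E y, (continuous_potential κ m g E).comp continuous_subtype_val⟩

lemma potentialI_apply (κ m : ℕ) (g : Polynomial ℝ) (E : ℝ) (y : I) :
    potentialI κ m g E y = potential κ m g E y := rfl

lemma width_pos (κ : ℕ) {E : ℝ} (hE : 0 < E) : 0 < width κ E := by
  unfold width; positivity

/-- The identity function on `[0, 1]` as an element of `C([0, 1])`. -/
def coordI : C(I, ℝ) := ⟨fun y => (y : ℝ), continuous_subtype_val⟩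

lemma exp_apply_I (f : C(I, ℝ)) (y : I) : NormedSpace.exp f y = Real.exp (f y) := by
  have := NormedSpace.map_exp (ContinuousMap.evalAlgHom ℝ ℝ y)
    (ContinuousMap.evalCLM ℝ y).continuous f
  rw [Real.exp_eq_exp_ℝ]
  exact this

lemma inverse_apply_I {f : C(I, ℝ)} (hf : ∀ y, f y ≠ 0) (y : I) :
    Ring.inverse f y = (f y)⁻¹ := by
  have h1 : IsUnit f := ContinuousMap.isUnit_iff_forall_ne_zero f |>.2 hf
  have h2 := congrArg (fun g : C(I, ℝ) => g y) (Ring.mul_inverse_cancel f h1)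
  simp only [ContinuousMap.mul_apply, ContinuousMap.one_apply] at h2
  exact eq_inv_of_mul_eq_one_right h2

/-- The potential depends analytically on `E` as an element of `C([0, 1])`. -/
lemma exists_analyticAt_potentialI (κ m : ℕ) {g : ℝ → Polynomial ℝ} {s : Set ℝ} {d : ℕ}
    (hd : ∀ E ∈ s, (g E).natDegree ≤ d)
    (hg : ∀ k, AnalyticOn ℝ (fun E => (g E).coeff k) s) {x : ℝ} (hx : x ∈ s) :
    ∃ U : ℝ → C(I, ℝ), AnalyticAt ℝ U x ∧ ∀ E ∈ s, U E = potentialI κ m (g E) E := by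
  -- Near `x` each coefficient is the restriction of a function analytic at `x`; this is what makes
  -- an endpoint of the interval harmless.
  choose c hc1 hc2 hc3 using fun k => (hg k x hx).exists_analyticAt
  set a : ℝ := (κ + 1 / 4) * Real.pi with ha
  -- Because `y / r = (E / a) y`, the rescaled variable is linear in `E`. The hyperbolic cosine is
  -- then built from the exponential of the Banach algebra, which is analytic.
  set z : ℝ → C(I, ℝ) := fun E => (E / a) • coordI with hz
  have hza : AnalyticAt ℝ z x :=
    (analyticAt_id.div_const).smul analyticAt_const
  set X : ℝ → C(I, ℝ) := fun E =>
    ((2 * Real.cosh 1)⁻¹ • (NormedSpace.exp (z E) + NormedSpace.exp (-z E))) ^ m + 1 with hX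
  have hXapp : ∀ E (y : I), X E y = (Real.cosh (E / a * y) / Real.cosh 1) ^ m + 1 := by
    intro E y
    have hc := (Real.cosh_pos 1).ne'
    simp only [hX, hz, ContinuousMap.add_apply, ContinuousMap.pow_apply, ContinuousMap.smul_apply,
      exp_apply_I, ContinuousMap.neg_apply, ContinuousMap.one_apply, smul_eq_mul,
      Real.cosh_eq (E / a * y), coordI, ContinuousMap.coe_mk]
    congr 2
    field_simp
  have hXne : ∀ E (y : I), X E y ≠ 0 := by
    intro E y
    rw [hXapp]
    linarith [smoothWell_denom_pos m (E / a * y)]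
  have hexp : ∀ f : C(I, ℝ), AnalyticAt ℝ (NormedSpace.exp : C(I, ℝ) → C(I, ℝ)) f :=
    fun f => NormedSpace.exp_analytic f
  have hXa : AnalyticAt ℝ X x := by
    have h1 : AnalyticAt ℝ (fun E => NormedSpace.exp (z E)) x :=
      AnalyticAt.comp (g := (NormedSpace.exp : C(I, ℝ) → C(I, ℝ))) (hexp _) hza
    have h2 : AnalyticAt ℝ (fun E => NormedSpace.exp (-z E)) x :=
      AnalyticAt.comp (g := (NormedSpace.exp : C(I, ℝ) → C(I, ℝ))) (hexp _) hza.neg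
    exact (((analyticAt_const (v := (2 * Real.cosh 1)⁻¹)).smul (h1.add h2)).pow m).add analyticAt_const
  have hIa : AnalyticAt ℝ (fun E => Ring.inverse (X E)) x := by
    have hu : IsUnit (X x) := (ContinuousMap.isUnit_iff_forall_ne_zero _).2 (hXne x)
    have h2 : AnalyticAt ℝ Ring.inverse (X x) := by
      have := analyticAt_inverse (𝕜 := ℝ) (A := C(I, ℝ)) hu.unit
      simpa using this
    exact AnalyticAt.comp (g := Ring.inverse) h2 hXa
  refine ⟨fun E => (-E ^ 2) • (Ring.inverse (X E) +
    ∑ k ∈ Finset.range (d + 1), c k E • z E ^ k), ?_, ?_⟩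
  · refine AnalyticAt.smul (analyticAt_id.pow 2).neg (hIa.add ?_)
    exact Finset.analyticAt_fun_sum _ fun k _ => (hc3 k).smul (hza.pow k)
  · intro E hE
    ext y
    have hyE : (y : ℝ) / width κ E = E / a * y := by
      rw [width, ← ha, div_div_eq_mul_div]; ring
    rw [potentialI_apply, potential, smoothWell, hyE]
    simp only [ContinuousMap.smul_apply, ContinuousMap.add_apply, smul_eq_mul,
      inverse_apply_I (hXne E), hXapp]
    congr 2
    rw [Polynomial.eval_eq_sum_range' (Nat.lt_succ_of_le (hd E hE))]
    simp only [ContinuousMap.coe_sum, Finset.sum_apply, ContinuousMap.smul_apply,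
      ContinuousMap.pow_apply, smul_eq_mul, hz, coordI, ContinuousMap.coe_mk]
    refine Finset.sum_congr rfl fun k _ => ?_
    rw [← hc2 k (mem_insert_of_mem _ hE)]

/-! ### Smallness of the correctors -/

lemma norm_complex_cosh_le (w : ℂ) : ‖Complex.cosh w‖ ≤ Real.cosh w.re := by
  rw [Complex.cosh, Real.cosh_eq, norm_div]
  have h := norm_add_le (Complex.exp w) (Complex.exp (-w))
  rw [Complex.norm_exp, Complex.norm_exp, Complex.neg_re] at h
  simpa using div_le_div_of_nonneg_right h (by norm_num : (0 : ℝ) ≤ 2)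

/-- Lets Cauchy estimates for a holomorphic extension bound derivatives along the real line. -/
lemma re_iteratedDeriv_eq {F : ℂ → ℂ} {f : ℝ → ℝ} {S : Set ℂ} (hS : IsOpen S)
    (hF : DifferentiableOn ℂ F S) (hFf : ∀ x : ℝ, (x : ℂ) ∈ S → (F x).re = f x) (n : ℕ) :
    ∀ x : ℝ, (x : ℂ) ∈ S → (iteratedDeriv n F x).re = iteratedDeriv n f x := by
  induction n with
  | zero => simpa using hFf
  | succ n ih =>
    intro x hx
    have han : AnalyticOnNhd ℂ (iteratedDeriv n F) S := by
      have h := (hF.analyticOnNhd hS).iterated_deriv n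
      rwa [← iteratedDeriv_eq_iterate] at h
    have h1 : HasDerivAt (iteratedDeriv n F) (iteratedDeriv (n + 1) F x) x := by
      rw [iteratedDeriv_succ]
      exact (han x hx).differentiableAt.hasDerivAt
    rw [iteratedDeriv_succ (f := f)]
    refine (HasDerivAt.deriv (h1.real_of_complex.congr_of_eventuallyEq ?_)).symm
    have : ∀ᶠ y : ℝ in 𝓝 x, (y : ℂ) ∈ S :=
      Complex.continuous_ofReal.continuousAt.eventually (hS.mem_nhds hx)
    filter_upwards [this] with y hy using (ih y hy).symm

/-- From `|cosh w| ≤ cosh (Re w)`, on the disc of radius `(1 - q) / 2` about `z` the `m`-th power in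
`h_m` is at most `ρ ^ m` with `ρ < 1`, so `h_m - 1` is of size `ρ ^ m` there. Cauchy's estimate
applies to `h_m - 1`, which has the same derivatives of positive order as `h_m`. -/
lemma eventually_abs_iteratedDeriv_smoothWell_le {q : ℝ} (hq0 : 0 ≤ q) (hq : q < 1) (n : ℕ) {ε : ℝ}
    (hε : 0 < ε) : ∀ᶠ m in atTop, ∀ z ∈ Icc (0 : ℝ) q,
      |iteratedDeriv (n + 1) (smoothWell m) z| ≤ ε := by
  set R : ℝ := (1 - q) / 2 with hR
  have hR0 : 0 < R := by rw [hR]; linarith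
  set ρ : ℝ := Real.cosh (q + R) / Real.cosh 1 with hρ
  have hρ0 : 0 ≤ ρ := div_nonneg (Real.cosh_pos _).le (Real.cosh_pos _).le
  have hρ1 : ρ < 1 := by
    rw [hρ, div_lt_one (Real.cosh_pos _), Real.cosh_lt_cosh, abs_of_nonneg (by linarith), abs_one]
    rw [hR]; linarith
  have hlim : Tendsto (fun m : ℕ => ρ ^ m) atTop (𝓝 0) := tendsto_pow_atTop_nhds_zero_of_lt_one hρ0 hρ1
  have hfac : (0 : ℝ) < (n + 1).factorial := by positivity
  filter_upwards [hlim.eventually (ge_mem_nhds (show (0 : ℝ) < 1 / 2 by norm_num)),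
    hlim.eventually (ge_mem_nhds (show (0 : ℝ) < ε * R ^ (n + 1) / (n + 1).factorial / 2 by
      positivity))] with m hm1 hm2
  intro z hz
  set X : ℂ → ℂ := fun w => (Complex.cosh w / (Real.cosh 1 : ℂ)) ^ m with hX
  have hXb : ∀ w ∈ Metric.closedBall (z : ℂ) R, ‖X w‖ ≤ ρ ^ m := by
    intro w hw
    rw [hX, norm_pow, norm_div, Complex.norm_real, Real.norm_of_nonneg (Real.cosh_pos 1).le]
    have h1 : |w.re - z| ≤ R := by
      have := (Complex.abs_re_le_norm (w - z)).trans (mem_closedBall_iff_norm.1 hw)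
      simpa using this
    rw [abs_le] at h1
    have h2 : Real.cosh w.re ≤ Real.cosh (q + R) := by
      rw [Real.cosh_le_cosh, abs_of_nonneg (by linarith : 0 ≤ q + R), abs_le]
      constructor <;> linarith [hz.1, hz.2]
    have := (norm_complex_cosh_le w).trans h2
    have hc := Real.cosh_pos 1
    rw [hρ]
    gcongr
  have hXn : ∀ w ∈ Metric.closedBall (z : ℂ) R, 1 / 2 ≤ ‖X w + 1‖ := by
    intro w hw
    have h1 := norm_sub_norm_le (1 : ℂ) (-X w)
    rw [norm_one, norm_neg, sub_neg_eq_add, add_comm] at h1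
    linarith [hXb w hw]
  set F : ℂ → ℂ := fun w => (X w + 1)⁻¹ - 1 with hF
  have hFd : DifferentiableOn ℂ F (Metric.closedBall (z : ℂ) R) := by
    refine DifferentiableOn.sub_const (DifferentiableOn.inv ?_ ?_) 1
    · have : Differentiable ℂ X := by
        refine Differentiable.pow (Differentiable.div_const Complex.differentiable_cosh _) m
      exact (this.add_const 1).differentiableOn
    · intro w hw h0
      have := hXn w hw
      rw [h0, norm_zero] at this
      norm_num at this
  have hFb : ∀ w ∈ Metric.sphere (z : ℂ) R, ‖F w‖ ≤ 2 * ρ ^ m := by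
    intro w hw
    have hw' := Metric.sphere_subset_closedBall hw
    have h1 := hXn w hw'
    have hne : X w + 1 ≠ 0 := by
      intro h0
      rw [h0, norm_zero] at h1
      norm_num at h1
    have h2 : F w = -X w / (X w + 1) := by
      simp only [hF]
      field_simp
      ring
    rw [h2, norm_div, norm_neg, div_le_iff₀ (by linarith)]
    have := hXb w hw'
    have h3 : 0 ≤ ρ ^ m := pow_nonneg hρ0 m
    nlinarith
  have hreal : (iteratedDeriv (n + 1) F z).re =
      iteratedDeriv (n + 1) (fun x => smoothWell m x - 1) z := by
    refine re_iteratedDeriv_eq Metric.isOpen_ball (hFd.mono Metric.ball_subset_closedBall)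
      (fun x _ => ?_) (n + 1) z (Metric.mem_ball_self hR0)
    have : F x = ((smoothWell m x - 1 : ℝ) : ℂ) := by
      simp only [hF, hX, smoothWell]
      push_cast
      rfl
    rw [this, Complex.ofReal_re]
  have hder : deriv (fun x => smoothWell m x - 1) = deriv (smoothWell m) := by
    ext x; exact deriv_sub_const _
  rw [iteratedDeriv_succ' (f := fun x => smoothWell m x - 1), hder, ← iteratedDeriv_succ'] at hreal
  rw [← hreal]
  refine (Complex.abs_re_le_norm _).trans ?_
  have hcl : DiffContOnCl ℂ F (Metric.ball (z : ℂ) R) := by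
    refine DifferentiableOn.diffContOnCl ?_
    rwa [closure_ball _ hR0.ne']
  refine (Complex.norm_iteratedDeriv_le_of_forall_mem_sphere_norm_le (n + 1) hR0 hcl hFb).trans ?_
  rw [div_le_iff₀ (by positivity)]
  calc ((n + 1).factorial : ℝ) * (2 * ρ ^ m)
      ≤ (n + 1).factorial * (2 * (ε * R ^ (n + 1) / (n + 1).factorial / 2)) := by gcongr
    _ = ε * R ^ (n + 1) := by field_simp

section

variable {κ S m₁ : ℕ} {E₁ E₂ : ℝ} {node : ℕ → ℝ → Fin κ → ℝ} {g : ℕ → ℝ → Polynomial ℝ}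

/-- The rescaled nodes tend to `(p + 1) / (κ + 1/4)`, at most `κ / (κ + 1/4)`. The summand `1/4`
leaves room, and half of it is spent on the uniform convergence, which gives `q = (κ + 1/8) / (κ +
1/4)`. -/
lemma node_ratio_le (hg : IsCorrector κ S E₁ E₂ m₁ node g) (hE₁ : 0 < E₁) (hκ : 1 ≤ κ) :
    ∃ q : ℝ, 0 ≤ q ∧ q < 1 ∧ ∀ᶠ m in atTop, ∀ E ∈ Icc E₁ E₂, ∀ p,
      node m E p / width κ E ∈ Icc 0 q := by
  have ha : (0 : ℝ) < (κ + 1 / 4) * Real.pi := by positivity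
  have hk : (0 : ℝ) < κ + 1 / 4 := by positivity
  have hκ' : (1 : ℝ) ≤ κ := by exact_mod_cast hκ
  refine ⟨(κ + 1 / 8) / (κ + 1 / 4), by positivity, by rw [div_lt_one hk]; linarith, ?_⟩
  rcases lt_or_ge E₂ E₁ with h21 | h21
  · refine Eventually.of_forall fun m E hE => absurd (hE.1.trans hE.2) (not_le.2 h21)
  have hE₂ : 0 < E₂ := hE₁.trans_le h21
  have hev : ∀ᶠ m in atTop, ∀ p : Fin κ, ∀ E ∈ Icc E₁ E₂,
      dist (((p : ℕ) + 1) * Real.pi / E) (node m E p) < 1 / 8 * Real.pi / E₂ := by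
    rw [eventually_all]
    intro p
    exact Metric.tendstoUniformlyOn_iff.1 (hg.node_tendsto p) _ (by positivity)
  filter_upwards [hev, eventually_ge_atTop m₁] with m hm hm1 E hE p
  have hE0 : 0 < E := hE₁.trans_le hE.1
  have hw := width_pos κ hE0
  refine ⟨div_nonneg (hg.node_mem m hm1 E hE p).1.le hw.le, ?_⟩
  rw [div_le_iff₀ hw]
  have h1 := hm p E hE
  rw [Real.dist_eq, abs_lt] at h1
  have h2 : 1 / 8 * Real.pi / E₂ ≤ 1 / 8 * Real.pi / E :=
    div_le_div_of_nonneg_left (by positivity) hE0 hE.2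
  have h3 : ((p : ℕ) + 1 : ℝ) * Real.pi / E ≤ κ * Real.pi / E := by
    have : ((p : ℕ) + 1 : ℝ) ≤ κ := by exact_mod_cast p.2
    gcongr
  have h4 : (κ + 1 / 8) / (κ + 1 / 4) * width κ E = κ * Real.pi / E + 1 / 8 * Real.pi / E := by
    unfold width
    field_simp
  rw [h4]
  linarith

/-- Only the bound on the corrector itself (derivative order zero) is needed: its right side
consists of derivatives of `h_m` at points that stay in `[0, q]` with `q < 1`. -/
lemma eventually_abs_corrector_le (hg : IsCorrector κ S E₁ E₂ m₁ node g) (hE₁ : 0 < E₁)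
    (hκ : 1 ≤ κ) {ε : ℝ} (hε : 0 < ε) :
    ∀ᶠ m in atTop, ∀ E ∈ Icc E₁ E₂, ∀ y ∈ Icc (-1 : ℝ) 1,
      |(g m E).eval (y / width κ E)| ≤ ε := by
  obtain ⟨C, hC⟩ := hg.bound 0
  obtain ⟨q, hq0, hq1, hq⟩ := node_ratio_le hg hE₁ hκ
  -- The increments in `|C| + 1` and `S + 1` keep the denominator positive when `C` or `S` vanishes.
  set δ : ℝ := ε / ((|C| + 1) * (κ * (S + 1))) with hδ
  have hκ' : (0 : ℝ) < κ := by exact_mod_cast hκ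
  have hδ0 : 0 < δ := by positivity
  have hev : ∀ᶠ m in atTop, ∀ k ∈ Finset.Icc 1 S, ∀ z ∈ Icc (0 : ℝ) q,
      |iteratedDeriv (2 * k - 1) (smoothWell m) z| ≤ δ := by
    rw [Filter.eventually_all_finset]
    intro k hk
    have hk1 := (Finset.mem_Icc.1 hk).1
    have := eventually_abs_iteratedDeriv_smoothWell_le hq0 hq1 (2 * k - 2) hδ0
    rwa [show 2 * k - 2 + 1 = 2 * k - 1 by omega] at this
  filter_upwards [hev, hq, eventually_ge_atTop m₁] with m hm hmq hm1 E hE y hy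
  have h1 := hC m hm1 E hE y hy
  rw [Function.iterate_zero, id] at h1
  have h2 : ∑ p : Fin κ, ∑ k ∈ Finset.Icc 1 S,
      |iteratedDeriv (2 * k - 1) (smoothWell m) (node m E p / width κ E)| ≤
      ∑ p : Fin κ, ∑ k ∈ Finset.Icc 1 S, δ :=
    Finset.sum_le_sum fun p _ => Finset.sum_le_sum fun k hk => hm k hk _ (hmq E hE p)
  simp only [Finset.sum_const, Finset.card_univ, Fintype.card_fin, Nat.card_Icc,
    nsmul_eq_mul, add_tsub_cancel_right] at h2
  set T := ∑ p : Fin κ, ∑ k ∈ Finset.Icc 1 S,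
      |iteratedDeriv (2 * k - 1) (smoothWell m) (node m E p / width κ E)|
  have hT : 0 ≤ T := Finset.sum_nonneg fun p _ => Finset.sum_nonneg fun k _ => abs_nonneg _
  calc _ ≤ C * T := h1
    _ ≤ (|C| + 1) * T := by gcongr; linarith [le_abs_self C]
    _ ≤ (|C| + 1) * (κ * (S * δ)) := by gcongr
    _ ≤ (|C| + 1) * (κ * ((S + 1) * δ)) := by gcongr; linarith
    _ = ε := by rw [hδ]; field_simp

/-! ### Convergence of the potential in `L¹` -/

lemma tendsto_smoothWell_of_lt {z : ℝ} (h0 : 0 ≤ z) (hz : z < 1) :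
    Tendsto (fun m => smoothWell m z) atTop (𝓝 1) := by
  have h1 : Tendsto (fun m : ℕ => (Real.cosh z / Real.cosh 1) ^ m) atTop (𝓝 0) := by
    refine tendsto_pow_atTop_nhds_zero_of_lt_one
      (div_nonneg (Real.cosh_pos _).le (Real.cosh_pos _).le) ?_
    rw [div_lt_one (Real.cosh_pos _), Real.cosh_lt_cosh, abs_of_nonneg h0, abs_one]
    exact hz
  have := (h1.add_const 1).inv₀ (by norm_num)
  simpa [smoothWell] using this

lemma tendsto_smoothWell_of_gt {z : ℝ} (hz : 1 < z) :
    Tendsto (fun m => smoothWell m z) atTop (𝓝 0) := by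
  have h1 : Tendsto (fun m : ℕ => (Real.cosh z / Real.cosh 1) ^ m) atTop atTop := by
    refine tendsto_pow_atTop_atTop_of_one_lt ?_
    rw [one_lt_div (Real.cosh_pos _), Real.cosh_lt_cosh, abs_one, abs_of_pos (by linarith)]
    exact hz
  exact tendsto_inv_atTop_zero.comp (tendsto_atTop_add_const_right _ 1 h1)

lemma intervalIntegrable_step (c a b : ℝ) :
    IntervalIntegrable (fun y : ℝ => if y ≤ c then (1 : ℝ) else 0) volume a b := by
  have h := (intervalIntegrable_const (μ := volume) (a := a) (b := b) (c := (1 : ℝ)))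
  rw [intervalIntegrable_iff] at h ⊢
  have := h.indicator (measurableSet_Iic (a := c))
  refine this.congr (Eventually.of_forall fun y => ?_)
  simp [indicator]

/-- Dominated convergence; pointwise convergence to the step fails only at the null set `z = 1`. -/
lemma tendsto_integral_smoothWell_sub_step (b : ℝ) (hb : 0 ≤ b) :
    Tendsto (fun m => ∫ z in (0 : ℝ)..b, |smoothWell m z - if z ≤ 1 then 1 else 0|) atTop
      (𝓝 0) := by
  have h := intervalIntegral.tendsto_integral_filter_of_dominated_convergence (μ := volume)
    (a := 0) (b := b) (l := atTop)
    (F := fun (m : ℕ) z => |smoothWell m z - if z ≤ 1 then 1 else 0|) (f := fun _ => 0)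
    (fun _ => 1) (Eventually.of_forall fun m => by
      have := ((continuous_smoothWell m).intervalIntegrable 0 b).sub
        (intervalIntegrable_step 1 0 b) |>.abs
      exact this.aestronglyMeasurable_restrict_uIoc)
    (Eventually.of_forall fun m => Eventually.of_forall fun z _ => by
      rw [Real.norm_eq_abs, abs_abs, abs_le]
      have h1 := smoothWell_nonneg m z
      have h2 := smoothWell_le_one m z
      split_ifs <;> constructor <;> linarith)
    intervalIntegrable_const (by
      have hne : ∀ᵐ z : ℝ ∂volume, z ≠ 1 := by
        simp [ae_iff]
      filter_upwards [hne] with z hz hzb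
      rw [uIoc_of_le hb] at hzb
      rcases lt_or_gt_of_ne hz with h | h
      · have := (tendsto_smoothWell_of_lt hzb.1.le h).sub_const 1
        simpa [if_pos h.le] using this.abs
      · have := tendsto_smoothWell_of_gt h
        simpa [if_neg (not_le.2 h)] using this.abs)
  simpa using h

/-- Rescaling by `r ≤ 1` removes `E` from the integrand and leaves it only in the upper limit `1 / r
= E / a`. This makes the `L¹` convergence uniform in `E`. -/
lemma integral_smoothWell_sub_step_le (κ m : ℕ) {E b : ℝ} (hE : (κ + 1 / 4) * Real.pi ≤ E)
    (hb : E ≤ b) :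
    ∫ y in (0 : ℝ)..1, |smoothWell m (y / width κ E) - if y ≤ width κ E then 1 else 0| ≤
      ∫ z in (0 : ℝ)..b / ((κ + 1 / 4) * Real.pi),
        |smoothWell m z - if z ≤ 1 then 1 else 0| := by
  have ha : 0 < (κ + 1 / 4) * Real.pi := by positivity
  have hE0 : 0 < E := ha.trans_le hE
  have hw := width_pos κ hE0
  have h1 : ∀ y : ℝ, |smoothWell m (y / width κ E) - if y ≤ width κ E then 1 else 0| =
      (fun z => |smoothWell m z - if z ≤ 1 then 1 else 0|) (y / width κ E) := by
    intro y
    simp only [div_le_one hw]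
  have h3 := (intervalIntegral.integral_congr (a := 0) (b := 1) fun y _ => h1 y).trans
    (intervalIntegral.integral_comp_div (a := 0) (b := 1)
      (fun z => |smoothWell m z - if z ≤ 1 then 1 else 0|) hw.ne')
  rw [h3, zero_div, smul_eq_mul]
  have hnn : ∀ c : ℝ, 0 ≤ c → 0 ≤ ∫ z in (0 : ℝ)..c, |smoothWell m z - if z ≤ 1 then 1 else 0| :=
    fun c hc => intervalIntegral.integral_nonneg hc fun z _ => abs_nonneg _
  have hw1 : width κ E ≤ 1 := by
    unfold width
    rw [div_le_one hE0]
    exact hE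
  have h2 : 1 / width κ E ≤ b / ((κ + 1 / 4) * Real.pi) := by
    unfold width
    rw [one_div_div]
    gcongr
  calc _ ≤ ∫ z in (0 : ℝ)..1 / width κ E, |smoothWell m z - if z ≤ 1 then 1 else 0| :=
        mul_le_of_le_one_left (hnn _ (by positivity)) hw1
    _ ≤ _ := intervalIntegral.integral_mono_interval le_rfl (by positivity) h2
        (Eventually.of_forall fun t => abs_nonneg _)
        (((continuous_smoothWell m).intervalIntegrable _ _).sub (intervalIntegrable_step 1 _ _)).abs

end

/-! ### The square well -/

/-- The product `E * r` of the energy and the half-width of the well. -/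
def wellSize (κ : ℕ) : ℝ := (κ + 1 / 4) * Real.pi

lemma wellSize_pos (κ : ℕ) : 0 < wellSize κ := by unfold wellSize; positivity

lemma width_eq (κ : ℕ) (E : ℝ) : width κ E = wellSize κ / E := rfl

/-- The value at `1` of the even solution for the square well at the spectral parameter
`-E² sin² β`. -/
def limValue (a E β : ℝ) : ℝ :=
  Real.cos (a * Real.cos β) * Real.cosh ((E - a) * Real.sin β) -
    Real.cos β / Real.sin β * Real.sin (a * Real.cos β) * Real.sinh ((E - a) * Real.sin β)

/-- The slope at `1` of the even solution for the square well at the spectral parameter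
`-E² sin² β`. -/
def limSlope (a E β : ℝ) : ℝ :=
  E * (Real.sin β * Real.cos (a * Real.cos β) * Real.sinh ((E - a) * Real.sin β) -
    Real.cos β * Real.sin (a * Real.cos β) * Real.cosh ((E - a) * Real.sin β))

/-- The even solution for the square well of half-width `r`. -/
def wellSol (r E β y : ℝ) : ℝ :=
  if y ≤ r then Real.cos (E * Real.cos β * y) else
    Real.cos (E * Real.cos β * r) * Real.cosh (E * Real.sin β * (y - r)) -
      Real.cos β / Real.sin β * Real.sin (E * Real.cos β * r) *
        Real.sinh (E * Real.sin β * (y - r))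

/-- The derivative of `wellSol`. -/
def wellSolDeriv (r E β y : ℝ) : ℝ :=
  if y ≤ r then -(E * Real.cos β * Real.sin (E * Real.cos β * y)) else
    E * Real.sin β * Real.cos (E * Real.cos β * r) * Real.sinh (E * Real.sin β * (y - r)) -
      E * Real.cos β * Real.sin (E * Real.cos β * r) * Real.cosh (E * Real.sin β * (y - r))

/-- The square well, shifted by the spectral parameter `-E² sin² β`. -/
def wellPot (r E β y : ℝ) : ℝ :=
  -E ^ 2 * (if y ≤ r then 1 else 0) + (E * Real.sin β) ^ 2

lemma continuous_wellSol (r E β : ℝ) : Continuous (wellSol r E β) := by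
  unfold wellSol
  refine Continuous.if_le (by fun_prop) (by fun_prop) continuous_id continuous_const ?_
  rintro y rfl
  simp

lemma continuous_wellSolDeriv (r E β : ℝ) : Continuous (wellSolDeriv r E β) := by
  unfold wellSolDeriv
  refine Continuous.if_le (by fun_prop) (by fun_prop) continuous_id continuous_const ?_
  rintro y rfl
  simp

lemma hasDerivAt_wellSol {r E β : ℝ} (hβ : Real.sin β ≠ 0) {y : ℝ} (hy : y ≠ r) :
    HasDerivAt (wellSol r E β) (wellSolDeriv r E β y) y := by
  rcases lt_or_gt_of_ne hy with h | h
  · have h1 : HasDerivAt (fun y => Real.cos (E * Real.cos β * y)) (wellSolDeriv r E β y) y := by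
      rw [wellSolDeriv, if_pos h.le]
      convert! ((hasDerivAt_id y).const_mul (E * Real.cos β)).cos using 1
      simp only [id]; ring
    refine h1.congr_of_eventuallyEq ?_
    filter_upwards [Iio_mem_nhds h] with t ht
    exact if_pos (le_of_lt ht)
  · have h1 : HasDerivAt (fun y => Real.cos (E * Real.cos β * r) *
        Real.cosh (E * Real.sin β * (y - r)) - Real.cos β / Real.sin β *
        Real.sin (E * Real.cos β * r) * Real.sinh (E * Real.sin β * (y - r)))
        (wellSolDeriv r E β y) y := by
      rw [wellSolDeriv, if_neg (not_le.2 h)]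
      have h0 := ((hasDerivAt_id y).sub_const r).const_mul (E * Real.sin β)
      convert! (h0.cosh.const_mul (Real.cos (E * Real.cos β * r))).sub
        (h0.sinh.const_mul (Real.cos β / Real.sin β * Real.sin (E * Real.cos β * r))) using 1
      simp only [id]
      field_simp
    refine h1.congr_of_eventuallyEq ?_
    filter_upwards [Ioi_mem_nhds h] with t ht
    exact if_neg (not_le.2 ht)

lemma hasDerivAt_wellSolDeriv {r E β : ℝ} (hβ : Real.sin β ≠ 0) {y : ℝ} (hy : y ≠ r) :
    HasDerivAt (wellSolDeriv r E β) (wellPot r E β y * wellSol r E β y) y := by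
  rcases lt_or_gt_of_ne hy with h | h
  · have h1 : HasDerivAt (fun y => -(E * Real.cos β * Real.sin (E * Real.cos β * y)))
        (wellPot r E β y * wellSol r E β y) y := by
      rw [wellPot, wellSol, if_pos h.le, if_pos h.le]
      convert! (((hasDerivAt_id y).const_mul (E * Real.cos β)).sin.const_mul
        (E * Real.cos β)).neg using 1
      simp only [id]
      rw [mul_pow, Real.sin_sq β]
      ring
    refine h1.congr_of_eventuallyEq ?_
    filter_upwards [Iio_mem_nhds h] with t ht
    exact if_pos (le_of_lt ht)
  · have h1 : HasDerivAt (fun y => E * Real.sin β * Real.cos (E * Real.cos β * r) *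
        Real.sinh (E * Real.sin β * (y - r)) - E * Real.cos β * Real.sin (E * Real.cos β * r) *
        Real.cosh (E * Real.sin β * (y - r)))
        (wellPot r E β y * wellSol r E β y) y := by
      rw [wellPot, wellSol, if_neg (not_le.2 h), if_neg (not_le.2 h)]
      have h0 := ((hasDerivAt_id y).sub_const r).const_mul (E * Real.sin β)
      convert! (h0.sinh.const_mul (E * Real.sin β * Real.cos (E * Real.cos β * r))).sub
        (h0.cosh.const_mul (E * Real.cos β * Real.sin (E * Real.cos β * r))) using 1
      simp only [id]
      field_simp
      ring
    refine h1.congr_of_eventuallyEq ?_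
    filter_upwards [Ioi_mem_nhds h] with t ht
    exact if_neg (not_le.2 ht)

/-- Provides the constant `B` of the Grönwall estimate. The only unbounded factor is `cos β / sin
β`, so a lower bound on `sin β` is needed. -/
lemma abs_wellSol_le {r E b β s : ℝ} (hr : 0 ≤ r) (hE : 0 ≤ E) (hb : E ≤ b) (hs : 0 < s)
    (hβ : s ≤ Real.sin β) {y : ℝ} (hy : y ∈ Icc (0 : ℝ) 1) :
    |wellSol r E β y| ≤ 1 + Real.cosh b + 1 / s * Real.sinh b := by
  have hc := Real.cosh_pos b
  have hsh : 0 ≤ Real.sinh b := Real.sinh_nonneg_iff.2 (hE.trans hb)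
  unfold wellSol
  split_ifs with h
  · have := Real.abs_cos_le_one (E * Real.cos β * y)
    have : 0 ≤ 1 / s * Real.sinh b := by positivity
    linarith
  · have hx0 : 0 ≤ E * Real.sin β * (y - r) :=
      mul_nonneg (mul_nonneg hE (hs.le.trans hβ)) (by linarith)
    have hxb : E * Real.sin β * (y - r) ≤ b := by
      have h1 : Real.sin β * (y - r) ≤ 1 * 1 :=
        mul_le_mul (Real.sin_le_one β) (by linarith [hy.2]) (by linarith) zero_le_one
      rw [mul_assoc]
      nlinarith
    refine (abs_sub _ _).trans ?_
    rw [abs_mul, abs_mul, abs_mul, abs_div, abs_of_pos (Real.cosh_pos _), abs_of_nonneg (hs.le.trans hβ),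
      abs_of_nonneg (Real.sinh_nonneg_iff.2 hx0)]
    have h1 : Real.cosh (E * Real.sin β * (y - r)) ≤ Real.cosh b := by
      rw [Real.cosh_le_cosh, abs_of_nonneg hx0, abs_of_nonneg (hE.trans hb)]; exact hxb
    have h2 : Real.sinh (E * Real.sin β * (y - r)) ≤ Real.sinh b := Real.sinh_le_sinh.2 hxb
    have h3 := Real.abs_cos_le_one (E * Real.cos β * r)
    have h4 := Real.abs_sin_le_one (E * Real.cos β * r)
    have h5 : |Real.cos β| / Real.sin β ≤ 1 / s :=
      div_le_div₀ zero_le_one (Real.abs_cos_le_one β) hs hβ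
    have h6 : |Real.cos β| / Real.sin β * |Real.sin (E * Real.cos β * r)| *
        Real.sinh (E * Real.sin β * (y - r)) ≤ 1 / s * 1 * Real.sinh b := by
      gcongr
    have h7 : |Real.cos (E * Real.cos β * r)| * Real.cosh (E * Real.sin β * (y - r)) ≤
        1 * Real.cosh b := by
      gcongr
    linarith

/-! ### Convergence of the boundary data to those of the square well -/

/-- The potential on `[0, 1]` shifted by the spectral parameter `-E² sin² β`. -/
def shiftedPot (κ m : ℕ) (g : Polynomial ℝ) (E β : ℝ) : C(I, ℝ) :=
  potentialI κ m g E - (-(E * Real.sin β) ^ 2) • 1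

lemma shiftedPot_apply (κ m : ℕ) (g : Polynomial ℝ) (E β : ℝ) (y : I) :
    shiftedPot κ m g E β y = potential κ m g E y + (E * Real.sin β) ^ 2 := by
  simp [shiftedPot, potentialI_apply]

section

variable {κ S m₁ : ℕ} {E₁ E₂ : ℝ} {node : ℕ → ℝ → Fin κ → ℝ} {g : ℕ → ℝ → Polynomial ℝ}

/-- The boundary data converge to those of the square well, uniformly in the parameters. -/
lemma eventually_abs_endValue_sub_limValue_le (hg : IsCorrector κ S E₁ E₂ m₁ node g)
    (hE₁ : wellSize κ < E₁) (hE₁₂ : E₁ ≤ E₂) (hκ : 1 ≤ κ) {s ε : ℝ} (hs : 0 < s) (hε : 0 < ε) :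
    ∀ᶠ m in atTop, ∀ E ∈ Icc E₁ E₂, ∀ β, s ≤ Real.sin β →
      |endValue (shiftedPot κ m (g m E) E β) - limValue (wellSize κ) E β| ≤ ε ∧
      |endSlope (shiftedPot κ m (g m E) E β) - limSlope (wellSize κ) E β| ≤ ε := by
  have ha := wellSize_pos κ
  have hE₁0 : 0 < E₁ := ha.trans hE₁
  have hE₂0 : 0 < E₂ := hE₁0.trans_le hE₁₂
  set B : ℝ := 1 + Real.cosh E₂ + 1 / s * Real.sinh E₂ with hB
  have hB0 : 0 < B := by
    have := Real.cosh_pos E₂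
    have := Real.sinh_pos_iff.2 hE₂0
    positivity
  -- With corrector at most `1`, the potential is bounded by `2 E²`, and the spectral shift adds at
  -- most `E²`.
  set M : ℝ := 3 * E₂ ^ 2 with hM
  -- The step error and the corrector contribute `η` each, so the total `L¹` error is `2 η E₂²`; `η`
  -- makes its product with `B` and the Grönwall factor at most `ε`.
  set η : ℝ := min 1 (ε / (2 * (B * E₂ ^ 2 * Real.exp (M + 1)))) with hη
  have hη0 : 0 < η := by positivity
  have hL1 := (tendsto_integral_smoothWell_sub_step (E₂ / wellSize κ) (by positivity)).eventually
    (ge_mem_nhds hη0)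
  filter_upwards [hL1, eventually_abs_corrector_le hg hE₁0 hκ hη0] with m hm1 hm2 E hE β hβ
  have hE0 : 0 < E := hE₁0.trans_le hE.1
  have haE : wellSize κ < E := hE₁.trans_le hE.1
  have hEsq : E ^ 2 ≤ E₂ ^ 2 := pow_le_pow_left₀ hE0.le hE.2 2
  have hw := width_pos κ hE0
  have hw1 : width κ E < 1 := by rw [width_eq, div_lt_one hE0]; exact haE
  have hβ0 : Real.sin β ≠ 0 := (hs.trans_le hβ).ne'
  have hwE : E * width κ E = wellSize κ := by rw [width_eq]; field_simp
  have hu1 : wellSol (width κ E) E β 1 = limValue (wellSize κ) E β := by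
    rw [wellSol, if_neg (not_le.2 hw1), limValue]
    have h1 : E * Real.cos β * width κ E = wellSize κ * Real.cos β := by
      rw [mul_right_comm, hwE]
    have h2 : E * Real.sin β * (1 - width κ E) = (E - wellSize κ) * Real.sin β := by
      rw [← hwE]; ring
    rw [h1, h2]
  have hp1 : wellSolDeriv (width κ E) E β 1 = limSlope (wellSize κ) E β := by
    rw [wellSolDeriv, if_neg (not_le.2 hw1), limSlope]
    have h1 : E * Real.cos β * width κ E = wellSize κ * Real.cos β := by
      rw [mul_right_comm, hwE]
    have h2 : E * Real.sin β * (1 - width κ E) = (E - wellSize κ) * Real.sin β := by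
      rw [← hwE]; ring
    rw [h1, h2]
    ring
  have hstep : IntervalIntegrable (fun y => if y ≤ width κ E then (1 : ℝ) else 0) volume 0 1 :=
    intervalIntegrable_step _ _ _
  have hWint : IntervalIntegrable (wellPot (width κ E) E β) volume 0 1 :=
    (hstep.const_mul (-E ^ 2)).add intervalIntegrable_const
  have hcor : ∀ y ∈ Icc (0 : ℝ) 1, |(g m E).eval (y / width κ E)| ≤ η :=
    fun y hy => hm2 E hE y ⟨by linarith [hy.1], hy.2⟩
  have hVM : ‖shiftedPot κ m (g m E) E β‖ ≤ M := by
    rw [ContinuousMap.norm_le _ (by positivity)]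
    intro y
    rw [shiftedPot_apply, potential, Real.norm_eq_abs]
    have h1 := smoothWell_nonneg m ((y : ℝ) / width κ E)
    have h2 := smoothWell_le_one m ((y : ℝ) / width κ E)
    have h3 := abs_le.1 ((hcor y y.2).trans (min_le_left _ _))
    have h4 : (E * Real.sin β) ^ 2 ≤ E ^ 2 := by
      rw [mul_pow]
      have := Real.sin_sq_le_one β
      nlinarith [sq_nonneg E]
    have h5 := sq_nonneg (E * Real.sin β)
    rw [hM, abs_le]
    constructor <;> nlinarith [sq_nonneg E]
  have hdiff : ∫ y in (0 : ℝ)..1,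
      |extendI (shiftedPot κ m (g m E) E β) y - wellPot (width κ E) E β y| ≤
      E₂ ^ 2 * (2 * η) := by
    have hI : IntervalIntegrable (fun y : ℝ =>
        |smoothWell m (y / width κ E) - if y ≤ width κ E then 1 else 0|) volume 0 1 :=
      ((((continuous_smoothWell m).comp (continuous_id.div_const _)).intervalIntegrable _ _).sub
        hstep).abs
    calc _ ≤ ∫ y in (0 : ℝ)..1, E₂ ^ 2 *
          (|smoothWell m (y / width κ E) - if y ≤ width κ E then 1 else 0| + η) := by
          refine intervalIntegral.integral_mono_on zero_le_one
            (((continuous_extendI _).intervalIntegrable _ _).sub hWint).abs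
            ((hI.add intervalIntegrable_const).const_mul _) fun y hy => ?_
          rw [extendI_of_mem _ hy, shiftedPot_apply, potential, wellPot]
          have h1 : -E ^ 2 * (smoothWell m (y / width κ E) + (g m E).eval (y / width κ E)) +
              (E * Real.sin β) ^ 2 - (-E ^ 2 * (if y ≤ width κ E then 1 else 0) +
              (E * Real.sin β) ^ 2) = -E ^ 2 * ((smoothWell m (y / width κ E) -
              if y ≤ width κ E then 1 else 0) + (g m E).eval (y / width κ E)) := by ring
          simp only [h1, abs_mul, abs_neg, abs_of_nonneg (sq_nonneg E)]
          have h2 := abs_add_le (smoothWell m (y / width κ E) -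
            if y ≤ width κ E then 1 else 0) ((g m E).eval (y / width κ E))
          have h3 := hcor y hy
          gcongr
          linarith
      _ = E₂ ^ 2 * ((∫ y in (0 : ℝ)..1,
          |smoothWell m (y / width κ E) - if y ≤ width κ E then 1 else 0|) + η) := by
          rw [intervalIntegral.integral_const_mul, intervalIntegral.integral_add hI
            intervalIntegrable_const]
          simp
      _ ≤ _ := by
          have := (integral_smoothWell_sub_step_le κ m haE.le hE.2).trans hm1
          gcongr
          linarith
  have hmain := abs_endValue_sub_le (V := shiftedPot κ m (g m E) E β)
    (u := wellSol (width κ E) E β) (p := wellSolDeriv (width κ E) E β)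
    (W := wellPot (width κ E) E β) (countable_singleton (width κ E)) (continuous_wellSol _ _ _)
    (continuous_wellSolDeriv _ _ _) (fun y hy => hasDerivAt_wellSol hβ0 hy.2)
    (fun y hy => hasDerivAt_wellSolDeriv hβ0 hy.2) (by rw [wellSol, if_pos hw.le]; simp)
    (by rw [wellSolDeriv, if_pos hw.le]; simp) hWint
    (fun y hy => abs_wellSol_le hw.le hE0.le hE.2 hs hβ hy) hVM
  rw [hu1, hp1] at hmain
  have hfin : B * (∫ y in (0 : ℝ)..1,
      |extendI (shiftedPot κ m (g m E) E β) y - wellPot (width κ E) E β y|) *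
      Real.exp (M + 1) ≤ ε := by
    calc _ ≤ B * (E₂ ^ 2 * (2 * η)) * Real.exp (M + 1) := by gcongr
      _ ≤ B * (E₂ ^ 2 * (2 * (ε / (2 * (B * E₂ ^ 2 * Real.exp (M + 1)))))) * Real.exp (M + 1) := by
          gcongr
          exact min_le_right _ _
      _ = ε := by
          have := Real.exp_pos (M + 1)
          field_simp
  have h1 := hmain.trans hfin
  constructor
  · linarith [abs_nonneg (endSlope (shiftedPot κ m (g m E) E β) - limSlope (wellSize κ) E β)]
  · linarith [abs_nonneg (endValue (shiftedPot κ m (g m E) E β) - limValue (wellSize κ) E β)]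

/-! ### Signs of the boundary data of the square well -/

lemma cos_eq_neg_one_pow_mul (x : ℝ) (n : ℕ) :
    Real.cos x = (-1) ^ n * Real.cos (x - n * Real.pi) := by
  rw [Real.cos_sub_nat_mul_pi, ← mul_assoc, ← mul_pow]; simp

lemma sin_eq_neg_one_pow_mul (x : ℝ) (n : ℕ) :
    Real.sin x = (-1) ^ n * Real.sin (x - n * Real.pi) := by
  rw [Real.sin_sub_nat_mul_pi, ← mul_assoc, ← mul_pow]; simp

lemma neg_one_pow_mul_self (n : ℕ) : (-1 : ℝ) ^ n * (-1) ^ n = 1 := by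
  rw [← mul_pow]; simp

lemma neg_one_pow_mul_limValue (a E β : ℝ) (n : ℕ) :
    (-1) ^ n * limValue a E β =
      Real.cos (a * Real.cos β - n * Real.pi) * Real.cosh ((E - a) * Real.sin β) -
      Real.cos β / Real.sin β * Real.sin (a * Real.cos β - n * Real.pi) *
        Real.sinh ((E - a) * Real.sin β) := by
  rw [limValue, cos_eq_neg_one_pow_mul (a * Real.cos β) n,
    sin_eq_neg_one_pow_mul (a * Real.cos β) n]
  linear_combination (Real.cos (a * Real.cos β - n * Real.pi) * Real.cosh ((E - a) * Real.sin β) -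
      Real.cos β / Real.sin β * Real.sin (a * Real.cos β - n * Real.pi) *
        Real.sinh ((E - a) * Real.sin β)) * neg_one_pow_mul_self n

lemma neg_one_pow_mul_limSlope (a E β : ℝ) (n : ℕ) :
    (-1) ^ n * limSlope a E β =
      E * (Real.sin β * Real.cos (a * Real.cos β - n * Real.pi) *
        Real.sinh ((E - a) * Real.sin β) -
      Real.cos β * Real.sin (a * Real.cos β - n * Real.pi) *
        Real.cosh ((E - a) * Real.sin β)) := by
  rw [limSlope, cos_eq_neg_one_pow_mul (a * Real.cos β) n,
    sin_eq_neg_one_pow_mul (a * Real.cos β) n]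
  linear_combination E * (Real.sin β * Real.cos (a * Real.cos β - n * Real.pi) *
        Real.sinh ((E - a) * Real.sin β) -
      Real.cos β * Real.sin (a * Real.cos β - n * Real.pi) *
        Real.cosh ((E - a) * Real.sin β)) * neg_one_pow_mul_self n

/-- After multiplication by `sin β` the quantity is `sin β cos θ cosh x - cos β sin θ sinh x`. For
`θ ≤ 0` neither term contributes negatively and one is positive; for `0 < θ ≤ β` it equals `sin(β -
θ) cosh x + cos β sin θ (cosh x - sinh x)`. -/
lemma limValue_pos {a E β : ℝ} {n : ℕ} (hE : a < E) (hβ0 : 0 < β)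
    (hβ1 : β ≤ Real.pi / 2) (h1 : -(Real.pi / 2) ≤ a * Real.cos β - n * Real.pi)
    (h2 : a * Real.cos β - n * Real.pi ≤ β) : 0 < (-1) ^ n * limValue a E β := by
  rw [neg_one_pow_mul_limValue]
  have hpi := Real.pi_pos
  have hsβ : 0 < Real.sin β := Real.sin_pos_of_pos_of_lt_pi hβ0 (by linarith)
  have hcβ : 0 ≤ Real.cos β := Real.cos_nonneg_of_mem_Icc ⟨by linarith, hβ1⟩
  set x := (E - a) * Real.sin β with hx
  have hx0 : 0 < x := mul_pos (by linarith) hsβ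
  have hs : 0 < Real.sinh x := Real.sinh_pos_iff.2 hx0
  have hcs := Real.sinh_lt_cosh x
  have hc := Real.cosh_pos x
  set t := a * Real.cos β - n * Real.pi with ht
  have hct : 0 ≤ Real.cos t := Real.cos_nonneg_of_mem_Icc ⟨by linarith, by linarith⟩
  have hcβt : Real.cos β = 0 → t = -(n * Real.pi) := fun h => by rw [ht, h]; ring
  suffices h : 0 < Real.sin β * Real.cos t * Real.cosh x - Real.cos β * Real.sin t * Real.sinh x by
    have := div_pos h hsβ
    convert! this using 1
    field_simp
  rcases le_or_gt t 0 with h0 | h0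
  · have hst : Real.sin t ≤ 0 := Real.sin_nonpos_of_nonpos_of_neg_pi_le h0 (by linarith)
    rcases eq_or_lt_of_le hct with h3 | h3
    · have hst' : Real.sin t = -1 := by
        have := Real.sin_sq_add_cos_sq t
        rw [← h3] at this
        nlinarith
      have hcβ' : 0 < Real.cos β := by
        refine lt_of_le_of_ne hcβ fun h => ?_
        have h4 := hcβt h.symm
        rw [h4, Real.sin_neg, Real.sin_nat_mul_pi] at hst'
        norm_num at hst'
      rw [← h3, hst']
      have := mul_pos hcβ' hs
      linarith
    · have h4 := mul_pos (mul_pos hsβ h3) hc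
      have h5 : 0 ≤ Real.cos β * -Real.sin t * Real.sinh x :=
        mul_nonneg (mul_nonneg hcβ (by linarith)) hs.le
      linarith
  · have hst : 0 < Real.sin t := Real.sin_pos_of_pos_of_lt_pi h0 (by linarith)
    have hcβ' : 0 < Real.cos β := by
      refine lt_of_le_of_ne hcβ fun h => ?_
      have h4 := hcβt h.symm
      have : (0 : ℝ) ≤ n * Real.pi := by positivity
      linarith
    have h3 : 0 ≤ Real.sin (β - t) :=
      Real.sin_nonneg_of_nonneg_of_le_pi (by linarith) (by linarith)
    rw [Real.sin_sub] at h3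
    have h4 := mul_pos (mul_pos hcβ' hst) (sub_pos.2 hcs)
    have h5 := mul_nonneg h3 hc.le
    linarith

/-- Up to the factor `E`, the slope is `-sin(θ - β) sinh x - cos β sin θ (cosh x - sinh x)`. -/
lemma limSlope_neg {a E β : ℝ} {n : ℕ} (ha : 0 < a) (hE : a < E) (hβ0 : 0 < β)
    (h1 : β ≤ a * Real.cos β - n * Real.pi)
    (h2 : a * Real.cos β - n * Real.pi ≤ Real.pi / 2) : (-1) ^ n * limSlope a E β < 0 := by
  rw [neg_one_pow_mul_limSlope]
  have hpi := Real.pi_pos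
  have hsβ : 0 < Real.sin β := Real.sin_pos_of_pos_of_lt_pi hβ0 (by linarith)
  set x := (E - a) * Real.sin β with hx
  have hx0 : 0 < x := mul_pos (by linarith) hsβ
  have hs : 0 < Real.sinh x := Real.sinh_pos_iff.2 hx0
  have hcs := Real.sinh_lt_cosh x
  set t := a * Real.cos β - n * Real.pi with ht
  have hcβ : 0 < Real.cos β := by
    by_contra! h
    have : a * Real.cos β ≤ 0 := mul_nonpos_of_nonneg_of_nonpos ha.le h
    have : (0 : ℝ) ≤ n * Real.pi := by positivity
    linarith
  have hst : 0 < Real.sin t := Real.sin_pos_of_pos_of_lt_pi (by linarith) (by linarith)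
  have h3 : 0 ≤ Real.sin (t - β) :=
    Real.sin_nonneg_of_nonneg_of_le_pi (by linarith) (by linarith)
  rw [Real.sin_sub] at h3
  refine mul_neg_of_pos_of_neg (by linarith) ?_
  have h4 := mul_pos (mul_pos hcβ hst) (sub_pos.2 hcs)
  have h5 := mul_nonneg h3 hs.le
  linarith

/-- At `θ = π/2` the cosine term drops out and only the negative one remains. -/
lemma limValue_neg {a E β : ℝ} {n : ℕ} (hE : a < E) (hβ0 : 0 < β)
    (hβ1 : β < Real.pi / 2) (h : a * Real.cos β - n * Real.pi = Real.pi / 2) :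
    (-1) ^ n * limValue a E β < 0 := by
  rw [neg_one_pow_mul_limValue, h, Real.cos_pi_div_two, Real.sin_pi_div_two]
  have hsβ : 0 < Real.sin β := Real.sin_pos_of_pos_of_lt_pi hβ0 (by linarith [Real.pi_pos])
  have hcβ : 0 < Real.cos β := Real.cos_pos_of_mem_Ioo ⟨by linarith, hβ1⟩
  have hs : 0 < Real.sinh ((E - a) * Real.sin β) :=
    Real.sinh_pos_iff.2 (mul_pos (by linarith) hsβ)
  have : 0 < Real.cos β / Real.sin β * 1 * Real.sinh ((E - a) * Real.sin β) := by positivity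
  linarith

lemma continuousOn_limValue (a : ℝ) :
    ContinuousOn (fun x : ℝ × ℝ => limValue a x.1 x.2) {x | Real.sin x.2 ≠ 0} := by
  unfold limValue
  refine ContinuousOn.sub (Continuous.continuousOn (by fun_prop)) ?_
  refine ContinuousOn.mul (ContinuousOn.mul (ContinuousOn.div
    (Continuous.continuousOn (by fun_prop)) (Continuous.continuousOn (by fun_prop))
    fun x hx => hx) (Continuous.continuousOn (by fun_prop)))
    (Continuous.continuousOn (by fun_prop))

lemma continuous_limSlope (a : ℝ) : Continuous (fun x : ℝ × ℝ => limSlope a x.1 x.2) := by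
  unfold limSlope
  fun_prop

/-! ### The windows containing one eigenvalue each -/

/-- For `n < κ` one has `(n + 1/2) π < a`, so the phase takes this value at some positive angle.
There `θ = π/2` exceeds `β`, while `θ ≤ 0` at `β = π/2`, so `θ - β` vanishes in between. -/
lemma exists_window {κ n : ℕ} (hn : n < κ) : ∃ α β : ℝ, 0 < α ∧ α < β ∧ β < Real.pi / 2 ∧
    wellSize κ * Real.cos α - n * Real.pi = Real.pi / 2 ∧
    wellSize κ * Real.cos β - n * Real.pi = β := by
  have ha := wellSize_pos κ
  have hpi := Real.pi_pos
  have hn' : (n : ℝ) + 1 ≤ κ := by exact_mod_cast hn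
  have hlt : (n + 1 / 2) * Real.pi / wellSize κ < 1 := by
    rw [div_lt_one ha, wellSize]
    exact mul_lt_mul_of_pos_right (by linarith) hpi
  have hpos : 0 < (n + 1 / 2) * Real.pi / wellSize κ := by positivity
  have hα0 : 0 < Real.arccos ((n + 1 / 2) * Real.pi / wellSize κ) := Real.arccos_pos.2 hlt
  have hα1 : Real.arccos ((n + 1 / 2) * Real.pi / wellSize κ) < Real.pi / 2 :=
    Real.arccos_lt_pi_div_two.2 hpos
  have hcα : wellSize κ * Real.cos (Real.arccos ((n + 1 / 2) * Real.pi / wellSize κ)) =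
      (n + 1 / 2) * Real.pi := by
    rw [Real.cos_arccos (by linarith) hlt.le]
    field_simp
  set α := Real.arccos ((n + 1 / 2) * Real.pi / wellSize κ)
  have hcont : ContinuousOn (fun β => wellSize κ * Real.cos β - n * Real.pi - β)
      (Icc α (Real.pi / 2)) := Continuous.continuousOn (by fun_prop)
  have hmem : (0 : ℝ) ∈ Ioo (wellSize κ * Real.cos (Real.pi / 2) - n * Real.pi - Real.pi / 2)
      (wellSize κ * Real.cos α - n * Real.pi - α) := by
    rw [Real.cos_pi_div_two, hcα]
    have : (0 : ℝ) ≤ n * Real.pi := by positivity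
    constructor <;> linarith
  obtain ⟨β, hβ, hβ0⟩ := intermediate_value_Ioo' hα1.le hcont hmem
  exact ⟨α, β, hα0, hβ.1, hβ.2, by rw [hcα]; ring, by simp only at hβ0; linarith⟩

/-- The angle at which the phase `E r cos β` equals `(n + 1/2) π`. -/
def angleLo (κ n : ℕ) : ℝ := if h : n < κ then (exists_window h).choose else 0

/-- The angle at which the phase `E r cos β` equals `n π + β`. -/
def angleHi (κ n : ℕ) : ℝ := if h : n < κ then (exists_window h).choose_spec.choose else 0

lemma angle_spec {κ n : ℕ} (hn : n < κ) : 0 < angleLo κ n ∧ angleLo κ n < angleHi κ n ∧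
    angleHi κ n < Real.pi / 2 ∧
    wellSize κ * Real.cos (angleLo κ n) - n * Real.pi = Real.pi / 2 ∧
    wellSize κ * Real.cos (angleHi κ n) - n * Real.pi = angleHi κ n := by
  simp only [angleLo, angleHi, dif_pos hn]
  exact (exists_window hn).choose_spec.choose_spec

lemma strictAntiOn_phase {a : ℝ} (ha : 0 < a) :
    StrictAntiOn (fun β => a * Real.cos β) (Icc 0 Real.pi) := fun _ hx _ hy hxy =>
  mul_lt_mul_of_pos_left (Real.strictAntiOn_cos hx hy hxy) ha

lemma phase_mem_of_mem_window {κ n : ℕ} (hn : n < κ) {β : ℝ}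
    (hβ : β ∈ Icc (angleLo κ n) (angleHi κ n)) :
    β ≤ wellSize κ * Real.cos β - n * Real.pi ∧
      wellSize κ * Real.cos β - n * Real.pi ≤ Real.pi / 2 := by
  obtain ⟨h0, h1, h2, h3, h4⟩ := angle_spec hn
  have hpi := Real.pi_pos
  have hanti := (strictAntiOn_phase (wellSize_pos κ)).antitoneOn
  have h5 := hanti ⟨h0.le, by linarith⟩ ⟨by linarith [hβ.1], by linarith [hβ.2]⟩ hβ.1
  have h6 := hanti ⟨by linarith [hβ.1], by linarith [hβ.2]⟩ ⟨by linarith, by linarith⟩ hβ.2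
  simp only at h5 h6
  constructor <;> linarith [hβ.2]

lemma mem_window_of_phase {κ n : ℕ} (hn : n < κ) {β : ℝ} (hβ0 : 0 < β) (hβ1 : β ≤ Real.pi / 2)
    (h1 : β ≤ wellSize κ * Real.cos β - n * Real.pi)
    (h2 : wellSize κ * Real.cos β - n * Real.pi ≤ Real.pi / 2) :
    β ∈ Icc (angleLo κ n) (angleHi κ n) := by
  obtain ⟨h0, h3, h4, h5, h6⟩ := angle_spec hn
  have hpi := Real.pi_pos
  have hanti := strictAntiOn_phase (wellSize_pos κ)
  constructor
  · by_contra! h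
    have := hanti ⟨hβ0.le, by linarith⟩ ⟨h0.le, by linarith⟩ h
    simp only at this
    linarith
  · by_contra! h
    have := hanti ⟨by linarith, by linarith⟩ ⟨hβ0.le, by linarith⟩ h
    simp only at this
    linarith

/-- The signs of boundary data `D`, `P` that determine the position of the zeros of `D`. -/
structure SignPattern (κ : ℕ) (D P : ℝ → ℝ) : Prop where
  /-- `D` has a sign outside of the windows. -/
  value_pos : ∀ n < κ, ∀ β, angleHi κ n ≤ β → β ≤ Real.pi / 2 →
    -(Real.pi / 2) ≤ wellSize κ * Real.cos β - n * Real.pi → 0 < (-1) ^ n * D β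
  /-- `P` has a sign in each window. -/
  slope_neg : ∀ n < κ, ∀ β ∈ Icc (angleLo κ n) (angleHi κ n), (-1) ^ n * P β < 0
  /-- `D` changes sign over each window. -/
  value_neg : ∀ n < κ, (-1) ^ n * D (angleLo κ n) < 0

lemma signPattern_lim (κ : ℕ) {E : ℝ} (hE : wellSize κ < E) :
    SignPattern κ (limValue (wellSize κ) E) (limSlope (wellSize κ) E) where
  value_pos n hn β h1 h2 h3 := by
    obtain ⟨h4, h5, h6, h7, h8⟩ := angle_spec hn
    refine limValue_pos hE (by linarith) h2 h3 ?_
    have := (strictAntiOn_phase (wellSize_pos κ)).antitoneOn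
      ⟨by linarith, by linarith [Real.pi_pos]⟩ ⟨by linarith, by linarith [Real.pi_pos]⟩ h1
    linarith
  slope_neg n hn β hβ := by
    obtain ⟨h4, h5⟩ := phase_mem_of_mem_window hn hβ
    exact limSlope_neg (wellSize_pos κ) hE ((angle_spec hn).1.trans_le hβ.1) h4 h5
  value_neg n hn := by
    obtain ⟨h4, h5, h6, h7, h8⟩ := angle_spec hn
    exact limValue_neg hE h4 (by linarith) h7

/-- A positive continuous function on a compact set has a positive minimum, and uniform convergence
eventually consumes less than that margin. -/
lemma eventually_forall_pos {X : Type*} [TopologicalSpace X] {K : Set X} (hK : IsCompact K)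
    {f : X → ℝ} (hf : ContinuousOn f K) (hpos : ∀ x ∈ K, 0 < f x) {F : ℕ → X → ℝ}
    (hF : ∀ ε > 0, ∀ᶠ m in atTop, ∀ x ∈ K, |F m x - f x| ≤ ε) :
    ∀ᶠ m in atTop, ∀ x ∈ K, 0 < F m x := by
  rcases K.eq_empty_or_nonempty with rfl | hne
  · exact Eventually.of_forall fun m x hx => absurd hx (notMem_empty x)
  obtain ⟨x₀, hx₀, hmin⟩ := hK.exists_isMinOn hne hf
  filter_upwards [hF (f x₀ / 2) (by linarith [hpos x₀ hx₀])] with m hm x hx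
  have h1 := abs_le.1 (hm x hx)
  have h2 : f x₀ ≤ f x := hmin hx
  linarith [hpos x₀ hx₀]

/-- Every strict inequality in `SignPattern` is asked on a compact set of angles that depends
neither on `E` nor on `m` and lies above `angleLo κ n`, where `sin` is bounded below. Hence the
signs of the square well survive uniformly in `E`. -/
lemma eventually_signPattern (hg : IsCorrector κ S E₁ E₂ m₁ node g)
    (hE₁ : wellSize κ < E₁) (hE₁₂ : E₁ ≤ E₂) (hκ : 1 ≤ κ) :
    ∀ᶠ m in atTop, ∀ E ∈ Icc E₁ E₂,
      SignPattern κ (fun β => endValue (shiftedPot κ m (g m E) E β))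
        (fun β => endSlope (shiftedPot κ m (g m E) E β)) := by
  have hpi := Real.pi_pos
  have hsin : ∀ n < κ, 0 < Real.sin (angleLo κ n) := fun n hn =>
    Real.sin_pos_of_pos_of_lt_pi (angle_spec hn).1 (by linarith [angle_spec hn])
  have hsin' : ∀ n < κ, ∀ β, angleLo κ n ≤ β → β ≤ Real.pi / 2 →
      Real.sin (angleLo κ n) ≤ Real.sin β := fun n hn β h1 h2 =>
    Real.sin_le_sin_of_le_of_le_pi_div_two (by linarith [angle_spec hn]) h2 h1
  have hclose : ∀ n < κ, ∀ ε > 0, ∀ᶠ m in atTop, ∀ E ∈ Icc E₁ E₂, ∀ β,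
      angleLo κ n ≤ β → β ≤ Real.pi / 2 →
      |endValue (shiftedPot κ m (g m E) E β) - limValue (wellSize κ) E β| ≤ ε ∧
      |endSlope (shiftedPot κ m (g m E) E β) - limSlope (wellSize κ) E β| ≤ ε := by
    intro n hn ε hε
    filter_upwards [eventually_abs_endValue_sub_limValue_le hg hE₁ hE₁₂ hκ (hsin n hn) hε]
      with m hm E hE β h1 h2 using hm E hE β (hsin' n hn β h1 h2)
  have habs : ∀ (n : ℕ) (x y : ℝ), |(-1) ^ n * x - (-1) ^ n * y| = |x - y| := by
    intro n x y
    rw [← mul_sub, abs_mul, abs_neg_one_pow, one_mul]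
  have key : ∀ n : Fin κ, ∀ᶠ m in atTop, ∀ E ∈ Icc E₁ E₂,
      (∀ β, angleHi κ n ≤ β → β ≤ Real.pi / 2 →
        -(Real.pi / 2) ≤ wellSize κ * Real.cos β - n * Real.pi →
        0 < (-1) ^ (n : ℕ) * endValue (shiftedPot κ m (g m E) E β)) ∧
      (∀ β ∈ Icc (angleLo κ n) (angleHi κ n),
        (-1) ^ (n : ℕ) * endSlope (shiftedPot κ m (g m E) E β) < 0) ∧
      (-1) ^ (n : ℕ) * endValue (shiftedPot κ m (g m E) E (angleLo κ n)) < 0 := by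
    rintro ⟨n, hn⟩
    obtain ⟨h4, h5, h6, h7, h8⟩ := angle_spec hn
    have hpat : ∀ E ∈ Icc E₁ E₂, SignPattern κ (limValue (wellSize κ) E) (limSlope (wellSize κ) E) :=
      fun E hE => signPattern_lim κ (hE₁.trans_le hE.1)
    have e1 := eventually_forall_pos (K := Icc E₁ E₂ ×ˢ (Icc (angleHi κ n) (Real.pi / 2) ∩
        {β | -(Real.pi / 2) ≤ wellSize κ * Real.cos β - n * Real.pi}))
      (f := fun x => (-1) ^ n * limValue (wellSize κ) x.1 x.2)
      (F := fun m x => (-1) ^ n * endValue (shiftedPot κ m (g m x.1) x.1 x.2))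
      (isCompact_Icc.prod (isCompact_Icc.inter_right
        (isClosed_le continuous_const (by fun_prop))))
      (continuousOn_const.mul ((continuousOn_limValue _).mono fun x hx =>
        ((hsin n hn).trans_le (hsin' n hn _ (h5.le.trans hx.2.1.1) hx.2.1.2)).ne'))
      (fun x hx => (hpat x.1 hx.1).value_pos n hn x.2 hx.2.1.1 hx.2.1.2 hx.2.2)
      (fun ε hε => by
        filter_upwards [hclose n hn ε hε] with m hm x hx
        rw [habs]
        exact (hm x.1 hx.1 x.2 (h5.le.trans hx.2.1.1) hx.2.1.2).1)
    have e2 := eventually_forall_pos (K := Icc E₁ E₂ ×ˢ Icc (angleLo κ n) (angleHi κ n))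
      (f := fun x => -((-1) ^ n * limSlope (wellSize κ) x.1 x.2))
      (F := fun m x => -((-1) ^ n * endSlope (shiftedPot κ m (g m x.1) x.1 x.2)))
      (isCompact_Icc.prod isCompact_Icc)
      (continuous_const.mul (continuous_limSlope _)).neg.continuousOn
      (fun x hx => neg_pos.2 ((hpat x.1 hx.1).slope_neg n hn x.2 hx.2))
      (fun ε hε => by
        filter_upwards [hclose n hn ε hε] with m hm x hx
        rw [← neg_sub', abs_neg, habs]
        exact (hm x.1 hx.1 x.2 hx.2.1 (by linarith [hx.2.2])).2)
    have e3 := eventually_forall_pos (K := Icc E₁ E₂ ×ˢ {angleLo κ n})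
      (f := fun x => -((-1) ^ n * limValue (wellSize κ) x.1 x.2))
      (F := fun m x => -((-1) ^ n * endValue (shiftedPot κ m (g m x.1) x.1 x.2)))
      (isCompact_Icc.prod isCompact_singleton)
      ((continuousOn_const.mul ((continuousOn_limValue _).mono fun x hx => by
        rw [mem_prod, mem_singleton_iff] at hx
        rw [mem_ofPred_eq, hx.2]
        exact (hsin n hn).ne')).neg)
      (fun x hx => by
        rw [mem_prod, mem_singleton_iff] at hx
        rw [hx.2]
        exact neg_pos.2 ((hpat x.1 hx.1).value_neg n hn))
      (fun ε hε => by
        filter_upwards [hclose n hn ε hε] with m hm x hx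
        rw [mem_prod, mem_singleton_iff] at hx
        rw [← neg_sub', abs_neg, habs]
        exact (hm x.1 hx.1 x.2 hx.2.ge (by linarith [hx.2])).1)
    filter_upwards [e1, e2, e3] with m hm1 hm2 hm3 E hE
    refine ⟨fun β hb1 hb2 hb3 => hm1 (E, β) ⟨hE, ⟨hb1, hb2⟩, hb3⟩,
      fun β hβ => neg_pos.1 (hm2 (E, β) ⟨hE, hβ⟩), neg_pos.1 (hm3 (E, _) ⟨hE, rfl⟩)⟩
  filter_upwards [eventually_all.2 key] with m hm E hE
  exact ⟨fun n hn => (hm ⟨n, hn⟩ E hE).1, fun n hn => (hm ⟨n, hn⟩ E hE).2.1,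
    fun n hn => (hm ⟨n, hn⟩ E hE).2.2⟩

end

/-! ### Zeros depending on a parameter -/

lemma sign_of_unique_zero {f : ℝ → ℝ} {α β b : ℝ} (hf : ContinuousOn f (Icc α β))
    (hα : f α < 0) (hβ : 0 < f β) (hb : ∀ t ∈ Icc α β, f t = 0 → t = b) :
    (∀ t ∈ Icc α β, t < b → f t < 0) ∧ ∀ t ∈ Icc α β, b < t → 0 < f t := by
  constructor
  · intro t ht htb
    by_contra! h
    obtain ⟨c, hc, hc0⟩ := intermediate_value_Icc ht.1
      (hf.mono (Icc_subset_Icc_right ht.2)) (show (0 : ℝ) ∈ Icc (f α) (f t) from ⟨hα.le, h⟩)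
    have := hb c ⟨hc.1, hc.2.trans ht.2⟩ hc0
    linarith [hc.2]
  · intro t ht htb
    by_contra! h
    obtain ⟨c, hc, hc0⟩ := intermediate_value_Icc ht.2
      (hf.mono (Icc_subset_Icc_left ht.1)) (show (0 : ℝ) ∈ Icc (f t) (f β) from ⟨h, hβ.le⟩)
    have := hb c ⟨ht.1.trans hc.1, hc.2⟩ hc0
    linarith [hc.1]

/-- Used along two filters: `E → x`, giving continuity of the angles in `E`, and `m → ∞`, giving
convergence to the square well. Pointwise convergence suffices: the signs at `b₀ ± δ` trap a zero,
and uniqueness identifies it. -/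
lemma tendsto_unique_zero {ι : Type*} {l : Filter ι} {F : ι → ℝ → ℝ} {f : ℝ → ℝ} {b : ι → ℝ}
    {b₀ α β : ℝ} (hcont : ∀ᶠ i in l, ContinuousOn (F i) (Icc α β))
    (huniq : ∀ᶠ i in l, ∀ t ∈ Icc α β, F i t = 0 → t = b i)
    (hlim : ∀ t ∈ Icc α β, Tendsto (fun i => F i t) l (𝓝 (f t))) (hb₀ : b₀ ∈ Ioo α β)
    (hneg : ∀ t ∈ Icc α β, t < b₀ → f t < 0) (hpos : ∀ t ∈ Icc α β, b₀ < t → 0 < f t) :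
    Tendsto b l (𝓝 b₀) := by
  rw [Metric.tendsto_nhds]
  intro ε hε
  set δ : ℝ := min (ε / 2) (min (b₀ - α) (β - b₀)) with hδ
  have hδ0 : 0 < δ := lt_min (by linarith) (lt_min (by linarith [hb₀.1]) (by linarith [hb₀.2]))
  have hδ1 : δ ≤ ε / 2 := min_le_left _ _
  have hδ2 : δ ≤ b₀ - α := (min_le_right _ _).trans (min_le_left _ _)
  have hδ3 : δ ≤ β - b₀ := (min_le_right _ _).trans (min_le_right _ _)
  have hm1 : b₀ - δ ∈ Icc α β := ⟨by linarith, by linarith⟩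
  have hm2 : b₀ + δ ∈ Icc α β := ⟨by linarith, by linarith⟩
  filter_upwards [hcont, huniq, (hlim _ hm1).eventually (gt_mem_nhds (hneg _ hm1 (by linarith))),
    (hlim _ hm2).eventually (lt_mem_nhds (hpos _ hm2 (by linarith)))] with i h1 h2 h3 h4
  obtain ⟨c, hc, hc0⟩ := intermediate_value_Icc (show b₀ - δ ≤ b₀ + δ by linarith)
    (h1.mono (Icc_subset_Icc hm1.1 hm2.2))
    (show (0 : ℝ) ∈ Icc (F i (b₀ - δ)) (F i (b₀ + δ)) from ⟨h3.le, h4.le⟩)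
  have hcb := h2 c ⟨hm1.1.trans hc.1, hc.2.trans hm2.2⟩ hc0
  rw [← hcb, Real.dist_eq, abs_lt]
  constructor <;> linarith [hc.1, hc.2]

/-- A continuous solution of an analytic equation with nonzero partial derivative is analytic. -/
lemma analyticWithinAt_of_implicit {F : ℝ × ℝ → ℝ} {b : ℝ → ℝ} {s : Set ℝ} {x : ℝ} (hx : x ∈ s)
    (hF : AnalyticAt ℝ F (x, b x)) (hder : deriv (fun t => F (x, t)) (b x) ≠ 0)
    (hb : ContinuousWithinAt b s x) (hz : ∀ y ∈ s, F (y, b y) = 0) :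
    AnalyticWithinAt ℝ b s x := by
  have hcd : ContDiffAt ℝ ⊤ F (x, b x) := hF.contDiffAt
  have hfd : HasFDerivAt F (fderiv ℝ F (x, b x)) (x, b x) := hF.differentiableAt.hasFDerivAt
  have hc : (fderiv ℝ F (x, b x)) (0, 1) = deriv (fun t => F (x, t)) (b x) := by
    have h1 : HasDerivAt (fun t : ℝ => (x, t)) ((0 : ℝ), (1 : ℝ)) (b x) :=
      (hasDerivAt_const _ _).prodMk (hasDerivAt_id _)
    exact ((hfd.comp_hasDerivAt (b x) h1).deriv).symm
  have hinv : (fderiv ℝ F (x, b x) ∘L .inr ℝ ℝ ℝ).IsInvertible := by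
    refine ⟨ContinuousLinearEquiv.unitsEquivAut ℝ (Units.mk0 _ hder), ?_⟩
    ext
    simp [← hc]
  have hev := hcd.eventually_apply_eq_iff_implicitFunction (by simp) hinv
  have han : AnalyticAt ℝ (hcd.implicitFunction (by simp) hinv) x :=
    (hcd.contDiffAt_implicitFunction (by simp) hinv).analyticAt
  rw [analyticWithinAt_iff_exists_analyticAt]
  refine ⟨_, ?_, han⟩
  rw [insert_eq_of_mem hx]
  have ht : Tendsto (fun y => (y, b y)) (𝓝[s] x) (𝓝 (x, b x)) :=
    (tendsto_id.mono_left nhdsWithin_le_nhds).prodMk_nhds hb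
  filter_upwards [ht.eventually hev, self_mem_nhdsWithin] with y hy hys
  rw [hz y hys, hz x hx] at hy
  exact (hy.1 rfl).symm

/-! ### Eigenvalues of a potential with the sign pattern of the square well -/

lemma IsNthEigenvalue.unique {Q : ℝ → ℝ} {j : ℕ} {μ ν : ℝ} (hμ : IsNthEigenvalue Q j μ)
    (hν : IsNthEigenvalue Q j ν) : μ = ν := by
  wlog h : μ < ν generalizing μ ν
  · rcases lt_trichotomy μ ν with h1 | h1 | h1
    · exact absurd h1 h
    · exact h1
    · exact (this hν hμ h1).symm
  exfalso
  have hsub : {x | IsEigenvalue Q x ∧ x < μ} ⊂ {x | IsEigenvalue Q x ∧ x < ν} := by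
    refine (Set.ssubset_iff_of_subset ?_).2 ⟨μ, ⟨hμ.1, h⟩, fun hcon => lt_irrefl _ hcon.2⟩
    exact fun x hx => ⟨hx.1, hx.2.trans h⟩
  have hfin : {x | IsEigenvalue Q x ∧ x < μ}.Finite :=
    finite_of_encard_eq_coe hμ.2
  have := hfin.encard_lt_encard hsub
  rw [hμ.2, hν.2] at this
  exact lt_irrefl _ this

lemma IsNthEigenvalue.eigenvalue_eq {Q : ℝ → ℝ} {j : ℕ} {μ : ℝ} (hμ : IsNthEigenvalue Q j μ) :
    eigenvalue Q j = μ := by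
  have : {ν | IsNthEigenvalue Q j ν} = {μ} :=
    Set.eq_singleton_iff_unique_mem.2 ⟨hμ, fun ν hν => IsNthEigenvalue.unique hν hμ⟩
  rw [eigenvalue, this, csInf_singleton]

lemma hasDerivAt_spectral (E β : ℝ) :
    HasDerivAt (fun β => -(E * Real.sin β) ^ 2) (-(2 * E ^ 2 * Real.sin β * Real.cos β)) β := by
  convert! (((Real.hasDerivAt_sin β).const_mul E).pow 2).neg using 1
  simp
  ring

lemma analyticAt_endValue_sub (V : C(I, ℝ)) (μ : ℝ) :
    AnalyticAt ℝ (fun ν : ℝ => endValue (V - ν • 1)) μ :=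
  AnalyticAt.comp (g := endValue) (f := fun ν : ℝ => V - ν • (1 : C(I, ℝ)))
    (analyticAt_endValue _) (analyticAt_const.sub (analyticAt_id.smul analyticAt_const))

lemma analyticAt_endSlope_sub (V : C(I, ℝ)) (μ : ℝ) :
    AnalyticAt ℝ (fun ν : ℝ => endSlope (V - ν • 1)) μ :=
  AnalyticAt.comp (g := endSlope) (f := fun ν : ℝ => V - ν • (1 : C(I, ℝ)))
    (analyticAt_endSlope _) (analyticAt_const.sub (analyticAt_id.smul analyticAt_const))

/-- `D P' - D' P` in the angular spectral parameter. -/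
lemma endValue_deriv_angle (V : C(I, ℝ)) {E β : ℝ} (hE : E ≠ 0) (hβ0 : 0 < β)
    (hβ1 : β < Real.pi / 2) : ∃ d p : ℝ,
      HasDerivAt (fun β => endValue (V - (-(E * Real.sin β) ^ 2) • 1)) d β ∧
      HasDerivAt (fun β => endSlope (V - (-(E * Real.sin β) ^ 2) • 1)) p β ∧
      endSlope (V - (-(E * Real.sin β) ^ 2) • 1) * d -
        endValue (V - (-(E * Real.sin β) ^ 2) • 1) * p < 0 := by
  have hd := (analyticAt_endValue_sub V (-(E * Real.sin β) ^ 2)).differentiableAt.hasDerivAt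
  have hp := (analyticAt_endSlope_sub V (-(E * Real.sin β) ^ 2)).differentiableAt.hasDerivAt
  have hs := hasDerivAt_spectral E β
  refine ⟨_, _, HasDerivAt.comp (h₂ := fun ν : ℝ => endValue (V - ν • 1)) β hd hs,
    HasDerivAt.comp (h₂ := fun ν : ℝ => endSlope (V - ν • 1)) β hp hs, ?_⟩
  have hw := endSlope_mul_deriv_sub V _ hd hp
  have hpos := primitive_evenSol_sq_pos (V - (-(E * Real.sin β) ^ 2) • 1)
  rw [← hw] at hpos
  have hsin : 0 < Real.sin β := Real.sin_pos_of_pos_of_lt_pi hβ0 (by linarith [Real.pi_pos])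
  have hcos : 0 < Real.cos β := Real.cos_pos_of_mem_Ioo ⟨by linarith, hβ1⟩
  have hE2 : 0 < E ^ 2 := by positivity
  have : 0 < 2 * E ^ 2 * Real.sin β * Real.cos β := by positivity
  have := mul_pos hpos this
  linarith

section

variable {κ : ℕ} {V : C(I, ℝ)} {E : ℝ}

lemma continuous_endValue_angle (V : C(I, ℝ)) (E : ℝ) :
    Continuous (fun β => endValue (V - (-(E * Real.sin β) ^ 2) • 1)) := by
  have h1 : Continuous fun ν : ℝ => endValue (V - ν • 1) :=
    continuous_iff_continuousAt.2 fun ν => (analyticAt_endValue_sub V ν).continuousAt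
  exact h1.comp (by fun_prop : Continuous fun β => -(E * Real.sin β) ^ 2)

/-- Existence is the sign change over the window. For uniqueness, `P` has no zero there and `D' P -
D P' < 0` by the Wronskian, so `D / P` is strictly decreasing. -/
lemma existsUnique_zero_window (hE : E ≠ 0)
    (h : SignPattern κ (fun β => endValue (V - (-(E * Real.sin β) ^ 2) • 1))
      (fun β => endSlope (V - (-(E * Real.sin β) ^ 2) • 1))) {n : ℕ} (hn : n < κ) :
    ∃ b ∈ Ioo (angleLo κ n) (angleHi κ n), endValue (V - (-(E * Real.sin b) ^ 2) • 1) = 0 ∧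
      ∀ t ∈ Icc (angleLo κ n) (angleHi κ n),
        endValue (V - (-(E * Real.sin t) ^ 2) • 1) = 0 → t = b := by
  obtain ⟨h0, h1, h2, h3, h4⟩ := angle_spec hn
  set D : ℝ → ℝ := fun β => endValue (V - (-(E * Real.sin β) ^ 2) • 1) with hD
  set P : ℝ → ℝ := fun β => endSlope (V - (-(E * Real.sin β) ^ 2) • 1) with hP
  have hpos : 0 < (-1) ^ n * D (angleHi κ n) :=
    h.value_pos n hn _ le_rfl h2.le (by linarith)
  have hneg : (-1) ^ n * D (angleLo κ n) < 0 := h.value_neg n hn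
  have hDc : Continuous D := continuous_endValue_angle V E
  obtain ⟨b, hb, hb0⟩ := intermediate_value_Ioo h1.le
    ((continuous_const.mul hDc).continuousOn (s := Icc (angleLo κ n) (angleHi κ n)))
    (show (0 : ℝ) ∈ Ioo ((-1) ^ n * D (angleLo κ n)) ((-1) ^ n * D (angleHi κ n)) from
      ⟨hneg, hpos⟩)
  have hDb : D b = 0 := (mul_eq_zero.1 hb0).resolve_left (by simp)
  refine ⟨b, hb, hDb, ?_⟩
  have hPne : ∀ t ∈ Icc (angleLo κ n) (angleHi κ n), P t ≠ 0 := by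
    intro t ht h5
    have := h.slope_neg n hn t ht
    rw [h5, mul_zero] at this
    exact lt_irrefl _ this
  have hmono : StrictAntiOn (fun t => D t / P t) (Icc (angleLo κ n) (angleHi κ n)) := by
    have hder : ∀ t ∈ Icc (angleLo κ n) (angleHi κ n), ∃ r < 0,
        HasDerivAt (fun t => D t / P t) r t := by
      intro t ht
      obtain ⟨d, p, hd, hp, hlt⟩ := endValue_deriv_angle V hE (h0.trans_le ht.1)
        (ht.2.trans_lt h2)
      have hPt := hPne t ht
      refine ⟨_, ?_, hd.div hp hPt⟩
      refine div_neg_of_neg_of_pos ?_ (by positivity)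
      linarith
    refine strictAntiOn_of_deriv_neg (convex_Icc _ _) (fun t ht => ?_) fun t ht => ?_
    · obtain ⟨r, -, hr⟩ := hder t ht
      exact hr.continuousAt.continuousWithinAt
    · obtain ⟨r, hr0, hr⟩ := hder t (interior_subset ht)
      rw [hr.deriv]
      exact hr0
  intro t ht ht0
  refine hmono.injOn ht (Ioo_subset_Icc_self hb) ?_
  have ht0' : D t = 0 := ht0
  simp only [ht0', hDb, zero_div]

/-- Excludes eigenvalues outside the windows: by Sturm comparison none lies at or below `-E²`, and
the sign of `D` forbids zeros at angles where the phase, reduced modulo `π` to `[-π/2, π/2]`, is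
less than the angle. -/
lemma exists_window_of_zero (hE : 0 < E)
    (h : SignPattern κ (fun β => endValue (V - (-(E * Real.sin β) ^ 2) • 1))
      (fun β => endSlope (V - (-(E * Real.sin β) ^ 2) • 1)))
    (hV : ∀ y, -E ^ 2 - 1 ≤ V y) {j : ℕ} (hj : j < κ) {μ β₀ : ℝ} (hβ₀ : angleLo κ j ≤ β₀)
    (hβ₀' : β₀ ≤ Real.pi / 2)
    (hμ : μ < -(E * Real.sin β₀) ^ 2) (h0 : endValue (V - μ • 1) = 0) :
    ∃ n ≤ j, ∃ β ∈ Icc (angleLo κ n) (angleHi κ n), β₀ < β ∧ μ = -(E * Real.sin β) ^ 2 := by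
  have hpi := Real.pi_pos
  obtain ⟨hj0, hj1, hj2, hj3, hj4⟩ := angle_spec hj
  have ha := wellSize_pos κ
  have hsβ₀ : 0 < Real.sin β₀ :=
    Real.sin_pos_of_pos_of_lt_pi (hj0.trans_le hβ₀) (by linarith)
  have hμE : -E ^ 2 < μ := by
    by_contra! hcon
    refine (endValue_pos (V := V - μ • 1) fun y => ?_).ne' h0
    have := hV y
    simp only [ContinuousMap.sub_apply, ContinuousMap.smul_apply, ContinuousMap.one_apply,
      smul_eq_mul, mul_one]
    linarith
  set s : ℝ := √(-μ) / E with hs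
  have hμ0 : 0 < -μ := by
    have := sq_nonneg (E * Real.sin β₀)
    linarith
  have hs0 : 0 < s := div_pos (Real.sqrt_pos.2 hμ0) hE
  have hsq : (E * s) ^ 2 = -μ := by
    rw [hs, mul_div_cancel₀ _ hE.ne', Real.sq_sqrt hμ0.le]
  have hs1 : s < 1 := by
    rw [hs, div_lt_one hE, Real.sqrt_lt' hE]
    linarith
  have hsin : Real.sin (Real.arcsin s) = s := Real.sin_arcsin (by linarith) hs1.le
  have hβ0 : 0 < Real.arcsin s := Real.arcsin_pos.2 hs0
  have hβ1 : Real.arcsin s < Real.pi / 2 := Real.arcsin_lt_pi_div_two.2 hs1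
  have hμβ : μ = -(E * Real.sin (Real.arcsin s)) ^ 2 := by rw [hsin, hsq, neg_neg]
  set β := Real.arcsin s with hβ
  have hβ₀β : β₀ < β := by
    by_contra! hcon
    have h1 : Real.sin β ≤ Real.sin β₀ :=
      Real.sin_le_sin_of_le_of_le_pi_div_two (by linarith) hβ₀' hcon
    have h2 : (E * Real.sin β) ^ 2 ≤ (E * Real.sin β₀) ^ 2 := by
      rw [hsin] at h1 ⊢
      gcongr
    linarith
  have hphase0 : 0 ≤ wellSize κ * Real.cos β :=
    mul_nonneg ha.le (Real.cos_nonneg_of_mem_Icc ⟨by linarith, hβ1.le⟩)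
  have hphase1 : wellSize κ * Real.cos β < j * Real.pi + Real.pi / 2 := by
    have := strictAntiOn_phase ha (a := wellSize κ) ⟨hj0.le, by linarith⟩
      ⟨hβ0.le, by linarith⟩ (hβ₀.trans_lt hβ₀β)
    simp only at this
    linarith
  -- The integer nearest to `a cos β / π`, which places `θ` in `[-π/2, π/2]`. It is at most `j`
  -- because beyond the lower end of window `j` the phase stays below `(j + 1/2) π`.
  set n : ℕ := ⌊wellSize κ * Real.cos β / Real.pi + 1 / 2⌋₊ with hn
  have hn1 : (n : ℝ) ≤ wellSize κ * Real.cos β / Real.pi + 1 / 2 :=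
    Nat.floor_le (by positivity)
  have hn2 : wellSize κ * Real.cos β / Real.pi + 1 / 2 < n + 1 := Nat.lt_floor_add_one _
  have hphase : wellSize κ * Real.cos β = wellSize κ * Real.cos β / Real.pi * Real.pi := by
    field_simp
  have hn3 : -(Real.pi / 2) ≤ wellSize κ * Real.cos β - n * Real.pi := by
    rw [hphase]; nlinarith
  have hn4 : wellSize κ * Real.cos β - n * Real.pi ≤ Real.pi / 2 := by
    rw [hphase]; nlinarith
  have hnj : n ≤ j := by
    have h1 : (n : ℝ) * Real.pi < (j + 1) * Real.pi := by linarith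
    have h2 : (n : ℝ) < ((j + 1 : ℕ) : ℝ) := by
      push_cast
      exact lt_of_mul_lt_mul_right h1 hpi.le
    exact Nat.lt_succ_iff.1 (by exact_mod_cast h2)
  have hnκ : n < κ := hnj.trans_lt hj
  have hle : β ≤ wellSize κ * Real.cos β - n * Real.pi := by
    by_contra! hcon
    obtain ⟨hn0', hn1', hn2', hn3', hn4'⟩ := angle_spec hnκ
    have h1 : angleHi κ n ≤ β := by
      by_contra! h2
      have := strictAntiOn_phase ha (a := wellSize κ) ⟨hβ0.le, by linarith⟩
        ⟨by linarith, by linarith⟩ h2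
      simp only at this
      linarith
    have h2 := h.value_pos n hnκ β h1 hβ1.le hn3
    simp only [← hμβ, h0, mul_zero] at h2
    exact lt_irrefl _ h2
  exact ⟨n, hnj, β, mem_window_of_phase hnκ hβ0 hβ1.le hle hn4, hβ₀β, hμβ⟩

/-- In window `n` one has `a cos β ≤ (n + 1/2) π`, and in window `j > n` one has `a cos γ ≥ j π +
γ`. Higher windows thus lie at smaller angles, and their eigenvalues are higher. -/
lemma phase_le_of_window {n j : ℕ} (hn : n < κ) (hj : j < κ) (hnj : n < j) {β γ : ℝ}
    (hβ : β ∈ Icc (angleLo κ n) (angleHi κ n)) (hγ : γ ∈ Icc (angleLo κ j) (angleHi κ j)) :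
    γ < β := by
  obtain ⟨h0, h1, h2, h3, h4⟩ := angle_spec hn
  obtain ⟨k0, k1, k2, k3, k4⟩ := angle_spec hj
  have hpi := Real.pi_pos
  have h5 := (phase_mem_of_mem_window hn hβ).2
  have h6 := (phase_mem_of_mem_window hj hγ).1
  have h7 : (n : ℝ) + 1 ≤ j := by exact_mod_cast hnj
  by_contra! hcon
  have h8 := (strictAntiOn_phase (wellSize_pos κ)).antitoneOn ⟨by linarith [hβ.1], by linarith [hβ.2]⟩
    ⟨by linarith [hγ.1], by linarith [hγ.2]⟩ hcon
  have h9 : (n + 1 : ℝ) * Real.pi ≤ j * Real.pi := by gcongr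
  have h10 := hγ.1
  linarith

/-- The zeros of `D` in the windows are the lowest eigenvalues. -/
lemma isNthEigenvalue_of_window {Q : ℝ → ℝ} (hQ : ∀ y : I, V y = Q y) (heven : ∀ y, Q (-y) = Q y)
    (hE : 0 < E) (h : SignPattern κ (fun β => endValue (V - (-(E * Real.sin β) ^ 2) • 1))
      (fun β => endSlope (V - (-(E * Real.sin β) ^ 2) • 1)))
    (hV : ∀ y, -E ^ 2 - 1 ≤ V y) {b : ℕ → ℝ}
    (hb : ∀ n < κ, b n ∈ Ioo (angleLo κ n) (angleHi κ n))
    (hb0 : ∀ n < κ, endValue (V - (-(E * Real.sin (b n)) ^ 2) • 1) = 0)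
    (hbu : ∀ n < κ, ∀ t ∈ Icc (angleLo κ n) (angleHi κ n),
        endValue (V - (-(E * Real.sin t) ^ 2) • 1) = 0 → t = b n) {j : ℕ} (hj : j < κ) :
    IsNthEigenvalue Q j (-(E * Real.sin (b j)) ^ 2) := by
  have hpi := Real.pi_pos
  have hI : ∀ n < κ, b n ∈ Icc (angleLo κ n) (angleHi κ n) := fun n hn =>
    Ioo_subset_Icc_self (hb n hn)
  have hlt : ∀ n < j, Real.sin (b j) < Real.sin (b n) := by
    intro n hn
    have h1 := phase_le_of_window (hn.trans hj) hj hn (hI n (hn.trans hj)) (hI j hj)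
    have h2 := angle_spec hj
    have h3 := angle_spec (hn.trans hj)
    exact Real.sin_lt_sin_of_lt_of_le_pi_div_two (by linarith [(hb j hj).1])
      (by linarith [(hb n (hn.trans hj)).2]) h1
  have hsin : ∀ n < κ, 0 < Real.sin (b n) := by
    intro n hn
    have h3 := angle_spec hn
    exact Real.sin_pos_of_pos_of_lt_pi (by linarith [(hb n hn).1]) (by linarith [(hb n hn).2])
  refine ⟨isEigenvalue_of_endValue_eq_zero hQ heven (hb0 j hj), ?_⟩
  -- The eigenvalues below the `j`-th candidate are exactly those from windows `0, …, j - 1`;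
  -- counting them gives the index.
  have hset : {ν | IsEigenvalue Q ν ∧ ν < -(E * Real.sin (b j)) ^ 2} =
      (fun n => -(E * Real.sin (b n)) ^ 2) '' (Finset.range j : Set ℕ) := by
    ext ν
    constructor
    · rintro ⟨hν, hνlt⟩
      have h0 := hν.endValue_eq_zero hQ
      obtain ⟨n, hnj, β, hβ, hβlt, rfl⟩ := exists_window_of_zero hE h hV hj (hb j hj).1.le
        (by linarith [(hb j hj).2, angle_spec hj]) hνlt h0
      have hβb := hbu n (hnj.trans_lt hj) β hβ h0
      refine ⟨n, ?_, by simp only [hβb]⟩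
      rw [Finset.coe_range, mem_Iio]
      refine lt_of_le_of_ne hnj ?_
      rintro rfl
      rw [hβb] at hβlt
      exact lt_irrefl _ hβlt
    · rintro ⟨n, hn, rfl⟩
      rw [Finset.coe_range, mem_Iio] at hn
      refine ⟨isEigenvalue_of_endValue_eq_zero hQ heven (hb0 n (hn.trans hj)), ?_⟩
      have h1 := hlt n hn
      have h2 := hsin j hj
      simp only [neg_lt_neg_iff]
      gcongr
  rw [hset, InjOn.encard_image, encard_coe_eq_coe_finsetCard, Finset.card_range]
  have hanti : ∀ n < κ, ∀ k < κ, n < k → Real.sin (b k) < Real.sin (b n) := by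
    intro n hn k hk hnk
    have h1 := phase_le_of_window hn hk hnk (hI n hn) (hI k hk)
    exact Real.sin_lt_sin_of_lt_of_le_pi_div_two (by linarith [(hb k hk).1, angle_spec hk])
      (by linarith [(hb n hn).2, angle_spec hn]) h1
  intro n hn k hk hnk
  rw [Finset.coe_range, mem_Iio] at hn hk
  have h1 : E * Real.sin (b n) = E * Real.sin (b k) := by
    have h3 := hsin n (hn.trans hj)
    have h4 := hsin k (hk.trans hj)
    have h5 : (E * Real.sin (b n)) ^ 2 = (E * Real.sin (b k)) ^ 2 := neg_injective hnk
    exact (pow_left_inj₀ (by positivity) (by positivity) two_ne_zero).1 h5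
  have h2 := mul_left_cancel₀ hE.ne' h1
  rcases lt_trichotomy n k with h3 | h3 | h3
  · exact absurd h2 (hanti n (hn.trans hj) k (hk.trans hj) h3).ne'
  · exact h3
  · exact absurd h2 (hanti k (hk.trans hj) n (hn.trans hj) h3).ne

end

/-! ### The eigenvalues of the square well -/

/-- The secular function of the square well, `cos β tan θ - sin β coth ((E - a) sin β)`. -/
def secular (a E : ℝ) (n : ℕ) (β : ℝ) : ℝ :=
  Real.cos β * (Real.sin (a * Real.cos β - n * Real.pi) /
    Real.cos (a * Real.cos β - n * Real.pi)) -
  Real.sin β * (Real.cosh ((E - a) * Real.sin β) / Real.sinh ((E - a) * Real.sin β))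

/-- The first product is decreasing because both `cos β` and the phase decrease. The derivative of
`sin β coth x` is `cos β (cosh x sinh x - x) / sinh² x`, nonnegative since `sinh x ≥ x` and `cosh x
≥ 1`. -/
lemma hasDerivAt_secular {a E β : ℝ} {n : ℕ} (ha : 0 < a) (hE : a < E) (hβ0 : 0 < β)
    (hβ1 : β < Real.pi / 2) (h1 : 0 ≤ a * Real.cos β - n * Real.pi)
    (h2 : a * Real.cos β - n * Real.pi < Real.pi / 2) :
    ∃ d < 0, HasDerivAt (secular a E n) d β := by
  have hpi := Real.pi_pos
  have hsβ : 0 < Real.sin β := Real.sin_pos_of_pos_of_lt_pi hβ0 (by linarith)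
  have hcβ : 0 < Real.cos β := Real.cos_pos_of_mem_Ioo ⟨by linarith, hβ1⟩
  have hx0 : 0 < (E - a) * Real.sin β := mul_pos (by linarith) hsβ
  have hs : 0 < Real.sinh ((E - a) * Real.sin β) := Real.sinh_pos_iff.2 hx0
  have hct : 0 < Real.cos (a * Real.cos β - n * Real.pi) :=
    Real.cos_pos_of_mem_Ioo ⟨by linarith, h2⟩
  have hst : 0 ≤ Real.sin (a * Real.cos β - n * Real.pi) :=
    Real.sin_nonneg_of_nonneg_of_le_pi h1 (by linarith)
  have hθ : HasDerivAt (fun β => a * Real.cos β - n * Real.pi) (a * -Real.sin β) β :=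
    ((Real.hasDerivAt_cos β).const_mul a).sub_const _
  have hx : HasDerivAt (fun β => (E - a) * Real.sin β) ((E - a) * Real.cos β) β :=
    (Real.hasDerivAt_sin β).const_mul _
  have hd := ((Real.hasDerivAt_cos β).mul (hθ.sin.div hθ.cos hct.ne')).sub
    ((Real.hasDerivAt_sin β).mul (hx.cosh.div hx.sinh hs.ne'))
  refine ⟨_, ?_, hd⟩
  set t := a * Real.cos β - n * Real.pi
  set x := (E - a) * Real.sin β with hxdef
  have hA : Real.cos t * (a * -Real.sin β) * Real.cos t -
      Real.sin t * (-Real.sin t * (a * -Real.sin β)) = -(a * Real.sin β) := by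
    linear_combination (-(a * Real.sin β)) * Real.sin_sq_add_cos_sq t
  have hB : Real.sinh x * ((E - a) * Real.cos β) * Real.sinh x -
      Real.cosh x * (Real.cosh x * ((E - a) * Real.cos β)) = -((E - a) * Real.cos β) := by
    linear_combination (-((E - a) * Real.cos β)) * Real.cosh_sq_sub_sinh_sq x
  change -Real.sin β * (Real.sin t / Real.cos t) + _ -
    (Real.cos β * (Real.cosh x / Real.sinh x) + _) < 0
  rw [hA, hB]
  have h3 : 0 ≤ Real.sin β * (Real.sin t / Real.cos t) := by positivity
  have h4 : 0 < Real.cos β * (a * Real.sin β / Real.cos t ^ 2) := by positivity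
  have h5 : 0 ≤ Real.cos β * (Real.cosh x / Real.sinh x) +
      Real.sin β * (-((E - a) * Real.cos β) / Real.sinh x ^ 2) := by
    have h6 : Real.cos β * (Real.cosh x / Real.sinh x) +
      Real.sin β * (-((E - a) * Real.cos β) / Real.sinh x ^ 2) =
      Real.cos β * (Real.cosh x * Real.sinh x - x) / Real.sinh x ^ 2 := by
      rw [hxdef]
      field_simp
      ring
    rw [h6]
    have h7 : x ≤ Real.sinh x := Real.self_le_sinh_iff.2 hx0.le
    have h8 := Real.one_le_cosh x
    have h9 : 0 ≤ Real.cosh x * Real.sinh x - x := by nlinarith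
    positivity
  rw [neg_div, mul_neg, neg_mul]
  linarith

lemma limValue_eq_secular {a E β : ℝ} {n : ℕ} (hs : Real.sin β ≠ 0)
    (hx : Real.sinh ((E - a) * Real.sin β) ≠ 0)
    (hc : Real.cos (a * Real.cos β - n * Real.pi) ≠ 0) :
    (-1) ^ n * limValue a E β = -(Real.cos (a * Real.cos β - n * Real.pi) *
      Real.sinh ((E - a) * Real.sin β) / Real.sin β) * secular a E n β := by
  rw [neg_one_pow_mul_limValue, secular]
  field_simp
  ring

section

variable {κ : ℕ} {E : ℝ}

lemma phase_lt_of_angleLo_lt {n : ℕ} (hn : n < κ) {β : ℝ} (h : angleLo κ n < β)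
    (h' : β ≤ angleHi κ n) : wellSize κ * Real.cos β - n * Real.pi < Real.pi / 2 := by
  obtain ⟨h0, h1, h2, h3, h4⟩ := angle_spec hn
  have := strictAntiOn_phase (wellSize_pos κ) ⟨h0.le, by linarith [Real.pi_pos]⟩
    ⟨by linarith, by linarith [Real.pi_pos]⟩ h
  simp only at this
  linarith

lemma secular_factor_ne {n : ℕ} (hn : n < κ) (hE : wellSize κ < E) {β : ℝ}
    (h : angleLo κ n < β) (h' : β ≤ angleHi κ n) :
    Real.sin β ≠ 0 ∧ Real.sinh ((E - wellSize κ) * Real.sin β) ≠ 0 ∧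
      Real.cos (wellSize κ * Real.cos β - n * Real.pi) ≠ 0 := by
  obtain ⟨h0, h1, h2, h3, h4⟩ := angle_spec hn
  have hpi := Real.pi_pos
  have hs : 0 < Real.sin β := Real.sin_pos_of_pos_of_lt_pi (by linarith) (by linarith)
  have h5 := phase_lt_of_angleLo_lt hn h h'
  have h6 := (phase_mem_of_mem_window hn ⟨h.le, h'⟩).1
  exact ⟨hs.ne', (Real.sinh_pos_iff.2 (mul_pos (by linarith) hs)).ne',
    (Real.cos_pos_of_mem_Ioo ⟨by linarith, h5⟩).ne'⟩

/-- The square well is discontinuous, so the Wronskian argument stated for continuous potentials is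
replaced by monotonicity of the explicit secular function. -/
lemma existsUnique_limValue_zero {n : ℕ} (hn : n < κ) (hE : wellSize κ < E) :
    ∃ b ∈ Ioo (angleLo κ n) (angleHi κ n), limValue (wellSize κ) E b = 0 ∧
      ∀ t ∈ Icc (angleLo κ n) (angleHi κ n), limValue (wellSize κ) E t = 0 → t = b := by
  obtain ⟨h0, h1, h2, h3, h4⟩ := angle_spec hn
  have hpi := Real.pi_pos
  have hpat := signPattern_lim κ hE
  have hpos : 0 < (-1) ^ n * limValue (wellSize κ) E (angleHi κ n) :=
    hpat.value_pos n hn _ le_rfl h2.le (by linarith)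
  have hneg := hpat.value_neg n hn
  have hcont : ContinuousOn (limValue (wellSize κ) E) (Icc (angleLo κ n) (angleHi κ n)) := by
    have := (continuousOn_limValue (wellSize κ)).comp
      (f := fun β : ℝ => (E, β)) (s := Icc (angleLo κ n) (angleHi κ n))
      (Continuous.continuousOn (by fun_prop)) (fun β hβ =>
        (Real.sin_pos_of_pos_of_lt_pi (by linarith [hβ.1]) (by linarith [hβ.2])).ne')
    exact this
  obtain ⟨b, hb, hb0⟩ := intermediate_value_Ioo h1.le
    (continuousOn_const.mul hcont (f := fun _ => (-1 : ℝ) ^ n))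
    (show (0 : ℝ) ∈ Ioo ((-1) ^ n * limValue (wellSize κ) E (angleLo κ n))
      ((-1) ^ n * limValue (wellSize κ) E (angleHi κ n)) from ⟨hneg, hpos⟩)
  have hDb : limValue (wellSize κ) E b = 0 := (mul_eq_zero.1 hb0).resolve_left (by simp)
  refine ⟨b, hb, hDb, ?_⟩
  -- The left end is omitted because `cos θ = 0` there; it is not a zero of `limValue` by the sign
  -- pattern.
  have hanti : StrictAntiOn (secular (wellSize κ) E n) (Ioc (angleLo κ n) (angleHi κ n)) := by
    have hder : ∀ t ∈ Ioc (angleLo κ n) (angleHi κ n), ∃ r < 0,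
        HasDerivAt (secular (wellSize κ) E n) r t := by
      intro t ht
      have h6 := (phase_mem_of_mem_window hn ⟨ht.1.le, ht.2⟩).1
      exact hasDerivAt_secular (wellSize_pos κ) hE (by linarith [ht.1]) (by linarith [ht.2])
        (by linarith [ht.1]) (phase_lt_of_angleLo_lt hn ht.1 ht.2)
    refine strictAntiOn_of_deriv_neg (convex_Ioc _ _) (fun t ht => ?_) fun t ht => ?_
    · obtain ⟨r, -, hr⟩ := hder t ht
      exact hr.continuousAt.continuousWithinAt
    · obtain ⟨r, hr0, hr⟩ := hder t (interior_subset ht)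
      rw [hr.deriv]
      exact hr0
  have hsec : ∀ t ∈ Ioc (angleLo κ n) (angleHi κ n), limValue (wellSize κ) E t = 0 →
      secular (wellSize κ) E n t = 0 := by
    intro t ht ht0
    obtain ⟨k1, k2, k3⟩ := secular_factor_ne hn hE ht.1 ht.2
    have h5 := limValue_eq_secular k1 k2 k3
    rw [ht0, mul_zero] at h5
    refine (mul_eq_zero.1 h5.symm).resolve_left ?_
    exact neg_ne_zero.2 (div_ne_zero (mul_ne_zero k3 k2) k1)
  intro t ht ht0
  have ht' : t ∈ Ioc (angleLo κ n) (angleHi κ n) := by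
    refine ⟨lt_of_le_of_ne ht.1 ?_, ht.2⟩
    rintro rfl
    rw [ht0, mul_zero] at hneg
    exact lt_irrefl _ hneg
  refine hanti.injOn ht' ⟨hb.1, hb.2.le⟩ ?_
  rw [hsec t ht' ht0, hsec b ⟨hb.1, hb.2.le⟩ hDb]

/-- Near the zero, `limValue` is a nonvanishing factor times `secular`, whose derivative is
negative. -/
lemma deriv_limValue_ne_zero {n : ℕ} (hn : n < κ) (hE : wellSize κ < E) {b : ℝ}
    (hb : b ∈ Ioo (angleLo κ n) (angleHi κ n)) (hb0 : limValue (wellSize κ) E b = 0) :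
    deriv (limValue (wellSize κ) E) b ≠ 0 := by
  obtain ⟨h0, h1, h2, h3, h4⟩ := angle_spec hn
  have h6 := (phase_mem_of_mem_window hn (Ioo_subset_Icc_self hb)).1
  obtain ⟨d, hd0, hd⟩ := hasDerivAt_secular (wellSize_pos κ) hE (h0.trans hb.1)
    (hb.2.trans h2) (by linarith [hb.1]) (phase_lt_of_angleLo_lt hn hb.1 hb.2.le)
  obtain ⟨k1, k2, k3⟩ := secular_factor_ne hn hE hb.1 hb.2.le
  have hfac : DifferentiableAt ℝ (fun β => -(Real.cos (wellSize κ * Real.cos β - n * Real.pi) *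
      Real.sinh ((E - wellSize κ) * Real.sin β) / Real.sin β)) b := by
    refine DifferentiableAt.neg (DifferentiableAt.div ?_ ?_ k1) <;> fun_prop
  have hprod := hfac.hasDerivAt.mul hd
  have hsec : secular (wellSize κ) E n b = 0 := by
    have h5 := limValue_eq_secular k1 k2 k3
    rw [hb0, mul_zero] at h5
    exact (mul_eq_zero.1 h5.symm).resolve_left
      (neg_ne_zero.2 (div_ne_zero (mul_ne_zero k3 k2) k1))
  rw [hsec, mul_zero, zero_add] at hprod
  have heq : (fun β => (-1) ^ n * limValue (wellSize κ) E β) =ᶠ[𝓝 b]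
      (fun β => -(Real.cos (wellSize κ * Real.cos β - n * Real.pi) *
      Real.sinh ((E - wellSize κ) * Real.sin β) / Real.sin β) * secular (wellSize κ) E n β) := by
    filter_upwards [isOpen_Ioo.mem_nhds hb] with t ht
    obtain ⟨l1, l2, l3⟩ := secular_factor_ne hn hE ht.1 ht.2.le
    exact limValue_eq_secular l1 l2 l3
  have hD := (hprod.congr_of_eventuallyEq heq).const_mul ((-1 : ℝ) ^ n)
  have hD' : HasDerivAt (limValue (wellSize κ) E) ((-1) ^ n *
      (-(Real.cos (wellSize κ * Real.cos b - n * Real.pi) *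
      Real.sinh ((E - wellSize κ) * Real.sin b) / Real.sin b) * d)) b := by
    refine hD.congr_of_eventuallyEq (Eventually.of_forall fun t => ?_)
    simp only
    rw [← mul_assoc, neg_one_pow_mul_self, one_mul]
  rw [hD'.deriv]
  exact mul_ne_zero (by simp) (mul_ne_zero
    (neg_ne_zero.2 (div_ne_zero (mul_ne_zero k3 k2) k1)) hd0.ne)

/-- The angle of the `n`-th even bound state of the square well. -/
def wellAngle (κ n : ℕ) (E : ℝ) : ℝ :=
  if h : n < κ ∧ wellSize κ < E then (existsUnique_limValue_zero h.1 h.2).choose else 0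

lemma wellAngle_spec {n : ℕ} (hn : n < κ) (hE : wellSize κ < E) :
    wellAngle κ n E ∈ Ioo (angleLo κ n) (angleHi κ n) ∧
    limValue (wellSize κ) E (wellAngle κ n E) = 0 ∧
    ∀ t ∈ Icc (angleLo κ n) (angleHi κ n), limValue (wellSize κ) E t = 0 →
      t = wellAngle κ n E := by
  rw [wellAngle, dif_pos ⟨hn, hE⟩]
  exact (existsUnique_limValue_zero hn hE).choose_spec

lemma analyticAt_limValue (a : ℝ) {x : ℝ × ℝ} (hx : Real.sin x.2 ≠ 0) :
    AnalyticAt ℝ (fun x : ℝ × ℝ => limValue a x.1 x.2) x := by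
  have hsin : ∀ {f : ℝ × ℝ → ℝ}, AnalyticAt ℝ f x → AnalyticAt ℝ (fun x => Real.sin (f x)) x :=
    fun h => AnalyticAt.comp (g := Real.sin) Real.analyticAt_sin h
  have hcos : ∀ {f : ℝ × ℝ → ℝ}, AnalyticAt ℝ f x → AnalyticAt ℝ (fun x => Real.cos (f x)) x :=
    fun h => AnalyticAt.comp (g := Real.cos) Real.analyticAt_cos h
  have hsinh : ∀ {f : ℝ × ℝ → ℝ}, AnalyticAt ℝ f x → AnalyticAt ℝ (fun x => Real.sinh (f x)) x :=
    fun h => AnalyticAt.comp (g := Real.sinh) Real.analyticAt_sinh h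
  have hcosh : ∀ {f : ℝ × ℝ → ℝ}, AnalyticAt ℝ f x → AnalyticAt ℝ (fun x => Real.cosh (f x)) x :=
    fun h => AnalyticAt.comp (g := Real.cosh) Real.analyticAt_cosh h
  have h1 : AnalyticAt ℝ (fun x : ℝ × ℝ => x.1) x := analyticAt_fst
  have h2 : AnalyticAt ℝ (fun x : ℝ × ℝ => x.2) x := analyticAt_snd
  have h3 := (h1.sub (analyticAt_const (v := a))).mul (hsin h2)
  have h4 := (analyticAt_const (v := a)).mul (hcos h2)
  exact ((hcos h4).mul (hcosh h3)).sub ((((hcos h2).div (hsin h2) hx).mul (hsin h4)).mul (hsinh h3))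

lemma analyticOnNhd_wellAngle {n : ℕ} (hn : n < κ) :
    AnalyticOnNhd ℝ (wellAngle κ n) (Ioi (wellSize κ)) := by
  rw [← isOpen_Ioi.analyticOn_iff_analyticOnNhd]
  intro x hx
  obtain ⟨h0, h1, h2, h3, h4⟩ := angle_spec hn
  have hpi := Real.pi_pos
  obtain ⟨hb, hb0, hbu⟩ := wellAngle_spec hn hx
  have hsin : ∀ t ∈ Icc (angleLo κ n) (angleHi κ n), Real.sin t ≠ 0 := fun t ht =>
    (Real.sin_pos_of_pos_of_lt_pi (by linarith [ht.1]) (by linarith [ht.2])).ne'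
  have hcont : ∀ E, ContinuousOn (fun t => (-1) ^ n * limValue (wellSize κ) E t)
      (Icc (angleLo κ n) (angleHi κ n)) := by
    intro E
    have := (continuousOn_limValue (wellSize κ)).comp
      (f := fun β : ℝ => (E, β)) (s := Icc (angleLo κ n) (angleHi κ n))
      (Continuous.continuousOn (by fun_prop)) (fun β hβ => hsin β hβ)
    exact continuousOn_const.mul this
  have hzero : ∀ E t, (-1) ^ n * limValue (wellSize κ) E t = 0 → limValue (wellSize κ) E t = 0 :=
    fun E t h => (mul_eq_zero.1 h).resolve_left (by simp)
  have hpat := signPattern_lim κ hx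
  obtain ⟨hs1, hs2⟩ := sign_of_unique_zero (hcont x) (hpat.value_neg n hn)
    (hpat.value_pos n hn _ le_rfl h2.le (by linarith))
    (fun t ht ht0 => hbu t ht (hzero x t ht0))
  refine analyticWithinAt_of_implicit (F := fun x => limValue (wellSize κ) x.1 x.2) hx
    (analyticAt_limValue _ (hsin _ (Ioo_subset_Icc_self hb)))
    (deriv_limValue_ne_zero hn hx hb hb0) ?_ fun y hy => (wellAngle_spec hn hy).2.1
  refine tendsto_unique_zero (F := fun E t => (-1) ^ n * limValue (wellSize κ) E t)
    (f := fun t => (-1) ^ n * limValue (wellSize κ) x t) (Eventually.of_forall hcont) ?_ ?_ hb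
    hs1 hs2
  · filter_upwards [self_mem_nhdsWithin] with y hy t ht ht0
    exact (wellAngle_spec hn hy).2.2 t ht (hzero y t ht0)
  · intro t ht
    have h5 : ContinuousAt (fun E => limValue (wellSize κ) E t) x := by
      have := (analyticAt_limValue (wellSize κ) (x := (x, t)) (hsin t ht)).continuousAt
      exact ContinuousAt.comp (f := fun E : ℝ => (E, t)) this
        (Continuous.continuousAt (by fun_prop))
    exact (h5.tendsto.mono_left nhdsWithin_le_nhds).const_mul _

/-! ### Linear independence of the frequencies of the square well -/

/-- The secular equation with the hyperbolic functions split into exponentials. It displays the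
exponentially small distance of the angle from the limit `θ = β`. -/
lemma sin_phase_sub_eq {n : ℕ} (hn : n < κ) (hE : wellSize κ < E) :
    Real.sin (wellSize κ * Real.cos (wellAngle κ n E) - n * Real.pi - wellAngle κ n E) =
      Real.exp (-(2 * (E - wellSize κ) * Real.sin (wellAngle κ n E))) *
      Real.sin (wellSize κ * Real.cos (wellAngle κ n E) - n * Real.pi + wellAngle κ n E) := by
  obtain ⟨hb, hb0, -⟩ := wellAngle_spec hn hE
  set b := wellAngle κ n E
  obtain ⟨k1, k2, k3⟩ := secular_factor_ne hn hE hb.1 hb.2.le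
  have h1 := neg_one_pow_mul_limValue (wellSize κ) E b n
  rw [hb0, mul_zero, Real.cosh_eq, Real.sinh_eq] at h1
  set t := wellSize κ * Real.cos b - n * Real.pi
  set x := (E - wellSize κ) * Real.sin b with hx
  have hexp : Real.exp (-(2 * (E - wellSize κ) * Real.sin b)) =
      Real.exp (-x) * Real.exp (-x) := by
    rw [← Real.exp_add, hx]; ring_nf
  have hone : Real.exp x * Real.exp (-x) = 1 := by rw [← Real.exp_add]; simp
  rw [hexp, Real.sin_sub, Real.sin_add]
  field_simp at h1
  linear_combination (Real.exp (-x)) * h1 +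
    (Real.sin t * Real.cos b - Real.cos t * Real.sin b) * (-hone)

end

section

variable {κ : ℕ}

/-- With `b` the angle and `H` the upper end of the window, `u = θ - b` equals `a (cos b - cos H) +
(H - b)`, so it is comparable to `H - b`, hence to `sin H - sin b`. The identity `sin u = e^{-2 (E -
a) sin b} sin(θ + b)`, where `sin(θ + b)` is bounded below on the window, gives both estimates. -/
lemma sub_sin_wellAngle_bounds {n : ℕ} (hn : n < κ) : ∃ c > 0, ∀ E, wellSize κ < E →
    c * Real.exp (-(2 * (E - wellSize κ) * Real.sin (angleHi κ n))) ≤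
      Real.sin (angleHi κ n) - Real.sin (wellAngle κ n E) ∧
    Real.sin (angleHi κ n) - Real.sin (wellAngle κ n E) ≤
      Real.pi / 2 * Real.exp (-(2 * (E - wellSize κ) * Real.sin (wellAngle κ n E))) := by
  obtain ⟨h0, h1, h2, h3, h4⟩ := angle_spec hn
  have hpi := Real.pi_pos
  have ha := wellSize_pos κ
  have hcH : 0 < Real.cos (angleHi κ n) := Real.cos_pos_of_mem_Ioo ⟨by linarith, h2⟩
  have hsL : 0 < Real.sin (angleLo κ n) := Real.sin_pos_of_pos_of_lt_pi h0 (by linarith)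
  set s : ℝ := min (Real.sin (angleLo κ n)) (Real.cos (angleHi κ n)) with hs
  have hs0 : 0 < s := lt_min hsL hcH
  refine ⟨Real.cos (angleHi κ n) * s / (1 + wellSize κ), by positivity, fun E hE => ?_⟩
  obtain ⟨hb, -, -⟩ := wellAngle_spec hn hE
  have hu := sin_phase_sub_eq hn hE
  obtain ⟨p1, p2⟩ := phase_mem_of_mem_window hn (Ioo_subset_Icc_self hb)
  set b := wellAngle κ n E
  set u := wellSize κ * Real.cos b - n * Real.pi - b with hudef
  set v := wellSize κ * Real.cos b - n * Real.pi + b with hvdef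
  have hu0 : 0 ≤ u := by linarith
  have hu1 : u ≤ Real.pi / 2 := by linarith [hb.1]
  have hbH : 0 < angleHi κ n - b := by linarith [hb.2]
  have hcos : Real.cos (angleHi κ n) ≤ Real.cos b :=
    Real.cos_le_cos_of_nonneg_of_le_pi (by linarith [hb.1]) (by linarith) hb.2.le
  have hcos' : Real.cos b - Real.cos (angleHi κ n) ≤ angleHi κ n - b := by
    have := Real.abs_cos_sub_cos_le b (angleHi κ n)
    rw [abs_sub_comm b, abs_of_pos hbH] at this
    exact (le_abs_self _).trans this
  have hulow : angleHi κ n - b ≤ u := by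
    have := mul_le_mul_of_nonneg_left hcos ha.le
    linarith
  have huup : u ≤ (1 + wellSize κ) * (angleHi κ n - b) := by
    have := mul_le_mul_of_nonneg_left hcos' ha.le
    linarith
  have hsinv : s ≤ Real.sin v := by
    rcases le_total v (Real.pi / 2) with h | h
    · exact (min_le_left _ _).trans (Real.sin_le_sin_of_le_of_le_pi_div_two (by linarith) h
        (by linarith [hb.1]))
    · refine (min_le_right _ _).trans ?_
      rw [← Real.cos_sub_pi_div_two v]
      exact Real.cos_le_cos_of_nonneg_of_le_pi (by linarith) (by linarith) (by linarith [hb.2])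
  have hsinmono : Real.sin b ≤ Real.sin (angleHi κ n) :=
    Real.sin_le_sin_of_le_of_le_pi_div_two (by linarith [hb.1]) h2.le hb.2.le
  constructor
  · have hMVT : Real.cos (angleHi κ n) * (angleHi κ n - b) ≤
        Real.sin (angleHi κ n) - Real.sin b := by
      obtain ⟨c, hc, hc'⟩ := exists_hasDerivAt_eq_slope Real.sin Real.cos hb.2
        Real.continuous_sin.continuousOn fun x _ => Real.hasDerivAt_sin x
      rw [eq_div_iff hbH.ne'] at hc'
      rw [← hc']
      gcongr
      exact Real.cos_le_cos_of_nonneg_of_le_pi (by linarith [hb.1, hc.1]) (by linarith) hc.2.le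
    have hexp : Real.exp (-(2 * (E - wellSize κ) * Real.sin (angleHi κ n))) ≤
        Real.exp (-(2 * (E - wellSize κ) * Real.sin b)) := by
      rw [Real.exp_le_exp, neg_le_neg_iff]
      have : 0 ≤ 2 * (E - wellSize κ) := by linarith
      gcongr
    have h5 : Real.exp (-(2 * (E - wellSize κ) * Real.sin (angleHi κ n))) * s ≤ u := by
      calc _ ≤ Real.exp (-(2 * (E - wellSize κ) * Real.sin b)) * Real.sin v := by gcongr
        _ = Real.sin u := hu.symm
        _ ≤ u := Real.sin_le hu0
    calc _ = Real.cos (angleHi κ n) / (1 + wellSize κ) *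
          (Real.exp (-(2 * (E - wellSize κ) * Real.sin (angleHi κ n))) * s) := by ring
      _ ≤ Real.cos (angleHi κ n) / (1 + wellSize κ) *
          ((1 + wellSize κ) * (angleHi κ n - b)) :=
          mul_le_mul_of_nonneg_left (h5.trans huup) (by positivity)
      _ = Real.cos (angleHi κ n) * (angleHi κ n - b) := by field_simp
      _ ≤ _ := hMVT
  · have h5 : Real.sin (angleHi κ n) - Real.sin b ≤ angleHi κ n - b := by
      have := Real.abs_sin_sub_sin_le (angleHi κ n) b
      rw [abs_of_pos hbH] at this
      exact (le_abs_self _).trans this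
    have h6 : u ≤ Real.pi / 2 * Real.sin u := by
      have := Real.mul_le_sin hu0 hu1
      calc u = Real.pi / 2 * (2 / Real.pi * u) := by field_simp
        _ ≤ _ := by gcongr
    have h7 : Real.sin u ≤ Real.exp (-(2 * (E - wellSize κ) * Real.sin b)) := by
      rw [hu]
      exact mul_le_of_le_one_right (Real.exp_pos _).le (Real.sin_le_one _)
    calc _ ≤ u := h5.trans hulow
      _ ≤ Real.pi / 2 * Real.sin u := h6
      _ ≤ _ := by gcongr

lemma tendsto_exp_neg_mul_sub (a : ℝ) {δ : ℝ} (hδ : 0 < δ) :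
    Tendsto (fun E : ℝ => Real.exp (-(2 * (E - a) * δ))) atTop (𝓝 0) := by
  refine Real.tendsto_exp_neg_atTop_nhds_zero.comp ?_
  refine Tendsto.atTop_mul_const hδ (Tendsto.const_mul_atTop two_pos ?_)
  exact tendsto_atTop_add_const_right _ _ tendsto_id

lemma tendsto_sin_wellAngle {n : ℕ} (hn : n < κ) :
    Tendsto (fun E => Real.sin (wellAngle κ n E)) atTop (𝓝 (Real.sin (angleHi κ n))) := by
  obtain ⟨h0, h1, h2, h3, h4⟩ := angle_spec hn
  obtain ⟨c, hc, hbd⟩ := sub_sin_wellAngle_bounds hn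
  have hpi := Real.pi_pos
  have hsL : 0 < Real.sin (angleLo κ n) := Real.sin_pos_of_pos_of_lt_pi h0 (by linarith)
  have h5 : Tendsto (fun E => Real.sin (angleHi κ n) - Real.sin (wellAngle κ n E)) atTop (𝓝 0) := by
    have h6 := (tendsto_exp_neg_mul_sub (wellSize κ) hsL).const_mul (Real.pi / 2)
    rw [mul_zero] at h6
    refine squeeze_zero' ?_ ?_ h6
    · filter_upwards [eventually_gt_atTop (wellSize κ)] with E hE
      refine le_trans ?_ (hbd E hE).1
      positivity
    · filter_upwards [eventually_gt_atTop (wellSize κ)] with E hE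
      refine (hbd E hE).2.trans ?_
      have hb := (wellAngle_spec hn hE).1
      have h7 : Real.sin (angleLo κ n) ≤ Real.sin (wellAngle κ n E) :=
        Real.sin_le_sin_of_le_of_le_pi_div_two (by linarith) (by linarith [hb.2]) hb.1.le
      have : 0 ≤ 2 * (E - wellSize κ) := by linarith
      gcongr
  have := h5.const_sub (Real.sin (angleHi κ n))
  simpa using this

lemma sin_angleHi_lt {n k : ℕ} (hk : k < κ) (hnk : n < k) :
    Real.sin (angleHi κ k) < Real.sin (angleHi κ n) := by
  have hn := hnk.trans hk
  have h1 := angle_spec hn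
  have h2 := angle_spec hk
  exact Real.sin_lt_sin_of_lt_of_le_pi_div_two (by linarith) (by linarith)
    (phase_le_of_window hn hk hnk ⟨by linarith, le_rfl⟩ ⟨by linarith, le_rfl⟩)

/-- The frequencies `E sin (wellAngle)` of the square well are linearly independent on every
interval. -/
lemma wellAngle_linearIndependent {E₁ E₂ : ℝ} (hE₁ : wellSize κ < E₁) (hE₁₂ : E₁ < E₂)
    {c : Fin κ → ℝ} (hc : ∀ E ∈ Icc E₁ E₂, ∑ j : Fin κ, c j * Real.sin (wellAngle κ j E) = 0) :
    c = 0 := by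
  set f : ℝ → ℝ := fun E => ∑ j : Fin κ, c j * Real.sin (wellAngle κ j E) with hf
  have hfa : AnalyticOnNhd ℝ f (Ioi (wellSize κ)) := by
    intro x hx
    refine Finset.analyticAt_fun_sum _ fun j _ => analyticAt_const.mul ?_
    exact AnalyticAt.comp (g := Real.sin) Real.analyticAt_sin (analyticOnNhd_wellAngle j.2 x hx)
  have hf0 : ∀ E, wellSize κ < E → f E = 0 := by
    have hmid : (E₁ + E₂) / 2 ∈ Ioo E₁ E₂ := ⟨by linarith, by linarith⟩
    have hz : f =ᶠ[𝓝 ((E₁ + E₂) / 2)] 0 := by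
      filter_upwards [isOpen_Ioo.mem_nhds hmid] with E hE using hc E (Ioo_subset_Icc_self hE)
    exact fun E hE => hfa.eqOn_zero_of_preconnected_of_eventuallyEq_zero
      (convex_Ioi _).isPreconnected (hE₁.trans hmid.1) hz hE
  -- The limit as `E → ∞` of the relation, once analyticity has extended it to all `E > a`.
  have hlim : ∑ j : Fin κ, c j * Real.sin (angleHi κ j) = 0 := by
    have h1 : Tendsto f atTop (𝓝 (∑ j : Fin κ, c j * Real.sin (angleHi κ j))) :=
      tendsto_finsetSum _ fun j _ => (tendsto_sin_wellAngle j.2).const_mul (c j)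
    refine tendsto_nhds_unique h1 (tendsto_const_nhds.congr' ?_)
    filter_upwards [eventually_gt_atTop (wellSize κ)] with E hE using (hf0 E hE).symm
  have hdiff : ∀ E, wellSize κ < E →
      ∑ j : Fin κ, c j * (Real.sin (angleHi κ j) - Real.sin (wellAngle κ j E)) = 0 := by
    intro E hE
    have := hf0 E hE
    simp only [hf] at this
    simp only [mul_sub, Finset.sum_sub_distrib, hlim, this, sub_zero]
  by_contra hne
  have hsupp : (Finset.univ.filter fun j => c j ≠ 0).Nonempty := by
    obtain ⟨j, hj⟩ := Function.ne_iff.1 hne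
    exact ⟨j, by simpa using hj⟩
  -- Since `sin (angleHi κ n)` decreases in `n`, the largest index in the support has the slowest
  -- exponential decay; after scaling by its rate, all other terms tend to `0`.
  obtain ⟨N, hN, hmax⟩ := Finset.exists_max_image _ (fun j : Fin κ => j) hsupp
  have hcN : c N ≠ 0 := by simpa using hN
  have hgt : ∀ j, N < j → c j = 0 := by
    intro j hj
    by_contra h
    exact absurd (hmax j (by simpa using h)) (not_le.2 hj)
  set w : ℝ → ℝ := fun E => Real.exp (2 * (E - wellSize κ) * Real.sin (angleHi κ N)) with hw
  have hterm : ∀ j ∈ Finset.univ.erase N, Tendsto (fun E =>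
      c j * (Real.sin (angleHi κ j) - Real.sin (wellAngle κ j E)) * w E) atTop (𝓝 0) := by
    intro j hj
    have hjN := (Finset.mem_erase.1 hj).1
    rcases lt_or_gt_of_ne hjN with h | h
    · obtain ⟨c', hc', hbd⟩ := sub_sin_wellAngle_bounds j.2
      have hlt : Real.sin (angleHi κ N) < Real.sin (angleHi κ j) := sin_angleHi_lt N.2 h
      -- The upper bound decays at the rate given by the angle at `E`, not by its limit. That
      -- angle's sine eventually exceeds `sin (angleHi κ N)` by half the gap.
      set δ := (Real.sin (angleHi κ j) - Real.sin (angleHi κ N)) / 2 with hδ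
      have hδ0 : 0 < δ := by rw [hδ]; linarith
      have h0 : Tendsto (fun E => (Real.sin (angleHi κ j) - Real.sin (wellAngle κ j E)) * w E)
          atTop (𝓝 0) := by
        have h6 := (tendsto_exp_neg_mul_sub (wellSize κ) hδ0).const_mul (Real.pi / 2)
        rw [mul_zero] at h6
        refine squeeze_zero' ?_ ?_ h6
        · filter_upwards [eventually_gt_atTop (wellSize κ)] with E hE
          have := (hbd E hE).1
          have h7 : 0 ≤ Real.sin (angleHi κ j) - Real.sin (wellAngle κ j E) :=
            le_trans (by positivity) this
          exact mul_nonneg h7 (Real.exp_pos _).le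
        · have hev := (tendsto_sin_wellAngle j.2).eventually
            (lt_mem_nhds (show Real.sin (angleHi κ N) + δ < Real.sin (angleHi κ j) by
              rw [hδ]; linarith))
          filter_upwards [eventually_gt_atTop (wellSize κ), hev] with E hE hEv
          calc _ ≤ Real.pi / 2 * Real.exp (-(2 * (E - wellSize κ) *
                Real.sin (wellAngle κ j E))) * w E := by
                have := (hbd E hE).2
                have := Real.exp_pos (2 * (E - wellSize κ) * Real.sin (angleHi κ N))
                gcongr
            _ = Real.pi / 2 * Real.exp (-(2 * (E - wellSize κ) *
                (Real.sin (wellAngle κ j E) - Real.sin (angleHi κ N)))) := by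
                rw [hw, mul_assoc, ← Real.exp_add]
                ring_nf
            _ ≤ _ := by
                have h8 : 0 ≤ 2 * (E - wellSize κ) := by linarith
                have h9 : δ ≤ Real.sin (wellAngle κ j E) - Real.sin (angleHi κ N) := by linarith
                have hpi := Real.pi_pos
                gcongr
      have := h0.const_mul (c j)
      rw [mul_zero] at this
      exact this.congr fun E => by ring
    · simp [hgt j h]
  have hsum := (tendsto_finsetSum _ hterm).abs
  rw [Finset.sum_const_zero, abs_zero] at hsum
  obtain ⟨c', hc', hbd⟩ := sub_sin_wellAngle_bounds N.2
  have hle : |c N| * c' ≤ 0 := by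
    refine ge_of_tendsto hsum ?_
    filter_upwards [eventually_gt_atTop (wellSize κ)] with E hE
    have h1 := hdiff E hE
    rw [← Finset.sum_erase_add _ _ (Finset.mem_univ N)] at h1
    rw [← Finset.sum_mul, eq_neg_of_add_eq_zero_left h1, abs_mul, abs_neg, abs_mul,
      abs_of_pos (Real.exp_pos _), mul_assoc]
    gcongr
    have h2 := (hbd E hE).1
    calc c' = c' * Real.exp (-(2 * (E - wellSize κ) * Real.sin (angleHi κ N))) * w E := by
          rw [hw, mul_assoc, ← Real.exp_add]; simp
      _ ≤ (Real.sin (angleHi κ N) - Real.sin (wellAngle κ N E)) * w E := by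
          have := Real.exp_pos (2 * (E - wellSize κ) * Real.sin (angleHi κ N))
          gcongr
      _ ≤ _ := by
          gcongr
          exact le_abs_self _
  have : 0 < |c N| * c' := mul_pos (abs_pos.2 hcN) hc'
  linarith

end

/-! ### Transversality of nondegenerate analytic curves -/

/-- The scalar product with a fixed vector as a continuous linear map. -/
def dotL {κ : ℕ} (c : Fin κ → ℝ) : (Fin κ → ℝ) →L[ℝ] ℝ :=
  ∑ j, c j • ContinuousLinearMap.proj (R := ℝ) (φ := fun _ : Fin κ => ℝ) j

lemma dotL_apply {κ : ℕ} (c v : Fin κ → ℝ) : dotL c v = v ⬝ᵥ c := by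
  simp [dotL, dotProduct, mul_comm]

section

variable {κ : ℕ} {ω : ℝ → Fin κ → ℝ} {E₁ E₂ : ℝ}

lemma iteratedDerivWithin_dotL (hE : E₁ < E₂) {f : ℝ → Fin κ → ℝ} {x : ℝ} (hx : x ∈ Icc E₁ E₂)
    (hf : ContDiffWithinAt ℝ ⊤ f (Icc E₁ E₂) x) (c : Fin κ → ℝ) (n : ℕ) :
    iteratedDerivWithin n (dotL c ∘ f) (Icc E₁ E₂) x =
      iteratedDerivWithin n f (Icc E₁ E₂) x ⬝ᵥ c := by
  rw [iteratedDerivWithin, (dotL c).iteratedFDerivWithin_comp_left hf (uniqueDiffOn_Icc hE) hx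
    le_top, ← dotL_apply]
  rfl

/-- If all derivatives vanished at `x`, a local analytic extension would vanish near `x`. Even when
`x` is an endpoint, this reaches interior points of the interval, and the identity theorem makes the
scalar product vanish everywhere. -/
lemma exists_iteratedDerivWithin_dot_ne_zero (hE : E₁ < E₂) (hω : AnalyticOn ℝ ω (Icc E₁ E₂))
    {c : Fin κ → ℝ} (hc : ∃ x ∈ Icc E₁ E₂, ω x ⬝ᵥ c ≠ 0) {x : ℝ} (hx : x ∈ Icc E₁ E₂) :
    ∃ n, iteratedDerivWithin n ω (Icc E₁ E₂) x ⬝ᵥ c ≠ 0 := by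
  by_contra! hzero
  have hU := uniqueDiffOn_Icc hE
  obtain ⟨F, hF1, hF2, hF3⟩ := (hω x hx).exists_analyticAt
  rw [insert_eq_of_mem hx] at hF2
  have hfa : AnalyticAt ℝ (dotL c ∘ F) x :=
    AnalyticAt.comp (g := dotL c) (ContinuousLinearMap.analyticAt _ _) hF3
  have hder : ∀ n, iteratedDeriv n (dotL c ∘ F) x = 0 := by
    intro n
    have h1 : iteratedDerivWithin n (dotL c ∘ F) (Icc E₁ E₂) x = iteratedDeriv n (dotL c ∘ F) x :=
      iteratedDerivWithin_eq_iteratedDeriv hU hfa.contDiffAt hx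
    rw [← h1, ← hzero n, ← iteratedDerivWithin_dotL hE hx (hω x hx).contDiffWithinAt]
    refine (iteratedDerivWithin_congr (fun y hy => ?_) hx).symm
    simp only [Function.comp_apply, hF2 hy]
  have hev : ∀ᶠ z in 𝓝 x, (dotL c ∘ F) z = 0 := by
    rw [← analyticOrderAt_eq_top, ENat.eq_top_iff_forall_ge]
    exact fun n => (natCast_le_analyticOrderAt_iff_iteratedDeriv_eq_zero hfa).2 fun i _ => hder i
  obtain ⟨U, hUsub, hUo, hxU⟩ := eventually_nhds_iff.1 hev
  have hxcl : x ∈ closure (Ioo E₁ E₂) := by rwa [closure_Ioo hE.ne]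
  obtain ⟨y, hyU, hy⟩ := mem_closure_iff.1 hxcl U hUo hxU
  have hfω : AnalyticOn ℝ (dotL c ∘ ω) (Icc E₁ E₂) :=
    (ContinuousLinearMap.analyticOnNhd (dotL c) univ).analyticOn.comp hω fun _ _ => mem_univ _
  have hfo : AnalyticOnNhd ℝ (dotL c ∘ ω) (Ioo E₁ E₂) :=
    isOpen_Ioo.analyticOn_iff_analyticOnNhd.1 (hfω.mono Ioo_subset_Icc_self)
  have hz : EqOn (dotL c ∘ ω) 0 (Ioo E₁ E₂) := by
    refine hfo.eqOn_zero_of_preconnected_of_eventuallyEq_zero isPreconnected_Ioo hy ?_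
    filter_upwards [hUo.mem_nhds hyU, isOpen_Ioo.mem_nhds hy] with z hzU hz
    have := hUsub z hzU
    simp only [Function.comp_apply] at this
    simp only [Function.comp_apply, hF2 (Ioo_subset_Icc_self hz), this, Pi.zero_apply]
  have hz' : EqOn (dotL c ∘ ω) 0 (Icc E₁ E₂) :=
    hz.of_subset_closure hfω.continuousOn continuousOn_const Ioo_subset_Icc_self
      (closure_Ioo hE.ne).ge
  obtain ⟨t, ht, htne⟩ := hc
  apply htne
  rw [← dotL_apply]
  exact hz' ht

lemma isCompact_sphere_pi (κ : ℕ) : IsCompact {c : Fin κ → ℝ | ∑ j, c j ^ 2 = 1} := by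
  refine Metric.isCompact_of_isClosed_isBounded (isClosed_eq (by fun_prop) continuous_const) ?_
  refine (Metric.isBounded_closedBall (x := (0 : Fin κ → ℝ)) (r := 1)).subset fun c hc => ?_
  rw [mem_closedBall_zero_iff, pi_norm_le_iff_of_nonneg zero_le_one]
  intro j
  have h1 : c j ^ 2 ≤ 1 := by
    rw [← show ∑ j, c j ^ 2 = 1 from hc]
    exact Finset.single_le_sum (f := fun j => c j ^ 2) (fun i _ => sq_nonneg _) (Finset.mem_univ j)
  rw [Real.norm_eq_abs]
  exact (sq_le_one_iff_abs_le_one _).1 h1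

/-- A nondegenerate analytic curve on a compact interval is transversal. -/
lemma exists_transversality (hE : E₁ < E₂) (hω : AnalyticOn ℝ ω (Icc E₁ E₂))
    (hli : ∀ c : Fin κ → ℝ, c ≠ 0 → ∃ x ∈ Icc E₁ E₂, ω x ⬝ᵥ c ≠ 0) :
    ∃ (m₀ : ℕ) (ρ₀ : ℝ), 0 < ρ₀ ∧ ∀ E ∈ Icc E₁ E₂, ∀ l : Fin κ → ℤ, l ≠ 0 →
      ρ₀ * bracket l ≤ (Finset.range (m₀ + 1)).sup' Finset.nonempty_range_add_one
        (fun n => |iteratedDerivWithin n ω (Icc E₁ E₂) E ⬝ᵥ (fun j => (l j : ℝ))|) := by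
  have hK : IsCompact (Icc E₁ E₂ ×ˢ {c : Fin κ → ℝ | ∑ j, c j ^ 2 = 1}) :=
    isCompact_Icc.prod (isCompact_sphere_pi κ)
  obtain ⟨m₀, ρ₀, hρ, hmain⟩ : ∃ (m₀ : ℕ) (ρ₀ : ℝ), 0 < ρ₀ ∧
      ∀ x ∈ Icc E₁ E₂ ×ˢ {c : Fin κ → ℝ | ∑ j, c j ^ 2 = 1}, ∃ n ≤ m₀,
        ρ₀ ≤ |iteratedDerivWithin n ω (Icc E₁ E₂) x.1 ⬝ᵥ x.2| := by
    -- A bound with some order and some constant passes to subsets and to finite unions, so it is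
    -- enough to find it near each point. There a single nonvanishing derivative persists by
    -- continuity.
    refine hK.induction_on (p := fun t => ∃ (m₀ : ℕ) (ρ₀ : ℝ), 0 < ρ₀ ∧ ∀ x ∈ t, ∃ n ≤ m₀,
        ρ₀ ≤ |iteratedDerivWithin n ω (Icc E₁ E₂) x.1 ⬝ᵥ x.2|) ⟨0, 1, one_pos, by simp⟩
      ?_ ?_ ?_
    · rintro s t hst ⟨m, ρ, hρ, h⟩
      exact ⟨m, ρ, hρ, fun x hx => h x (hst hx)⟩
    · rintro s t ⟨m, ρ, hρ, h⟩ ⟨m', ρ', hρ', h'⟩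
      refine ⟨max m m', min ρ ρ', lt_min hρ hρ', ?_⟩
      rintro x (hx | hx)
      · obtain ⟨n, hn, hle⟩ := h x hx
        exact ⟨n, hn.trans (le_max_left _ _), (min_le_left _ _).trans hle⟩
      · obtain ⟨n, hn, hle⟩ := h' x hx
        exact ⟨n, hn.trans (le_max_right _ _), (min_le_right _ _).trans hle⟩
    · rintro ⟨E, c⟩ ⟨hEx, hcx⟩
      have hc0 : c ≠ 0 := by
        rintro rfl
        simp at hcx
      obtain ⟨n, hn⟩ := exists_iteratedDerivWithin_dot_ne_zero hE hω (hli c hc0) hEx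
      have hcont : ContinuousOn (fun x : ℝ × (Fin κ → ℝ) =>
          |iteratedDerivWithin n ω (Icc E₁ E₂) x.1 ⬝ᵥ x.2|)
          (Icc E₁ E₂ ×ˢ {c : Fin κ → ℝ | ∑ j, c j ^ 2 = 1}) := by
        have h1 : ContinuousOn (iteratedDerivWithin n ω (Icc E₁ E₂)) (Icc E₁ E₂) :=
          (hω.contDiffOn (n := ⊤) (uniqueDiffOn_Icc hE)).continuousOn_iteratedDerivWithin le_top
            (uniqueDiffOn_Icc hE)
        have h2 : ContinuousOn (fun x : ℝ × (Fin κ → ℝ) =>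
            iteratedDerivWithin n ω (Icc E₁ E₂) x.1)
            (Icc E₁ E₂ ×ˢ {c : Fin κ → ℝ | ∑ j, c j ^ 2 = 1}) :=
          h1.comp continuousOn_fst fun x hx => hx.1
        have h3 : Continuous fun y : (Fin κ → ℝ) × (Fin κ → ℝ) => y.1 ⬝ᵥ y.2 := by
          unfold dotProduct
          fun_prop
        exact (h3.comp_continuousOn (h2.prodMk continuousOn_snd)).abs
      have hpos : 0 < |iteratedDerivWithin n ω (Icc E₁ E₂) E ⬝ᵥ c| := abs_pos.2 hn
      have hev := (hcont (E, c) ⟨hEx, hcx⟩).eventually (lt_mem_nhds (half_lt_self hpos))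
      exact ⟨_, hev, n, _, half_pos hpos, fun x hx => ⟨n, le_rfl, le_of_lt hx⟩⟩
  refine ⟨m₀, ρ₀, hρ, fun E hEx l hl => ?_⟩
  -- A nonzero integer vector has length at least `1`, so `bracket l` is its length; dividing by it
  -- reduces to the unit sphere.
  set r : ℝ := √(∑ j, (l j : ℝ) ^ 2) with hr
  have hone : (1 : ℝ) ≤ ∑ j, (l j : ℝ) ^ 2 := by
    obtain ⟨j, hj⟩ := Function.ne_iff.1 hl
    have h1 : (1 : ℝ) ≤ (l j : ℝ) ^ 2 := by
      have : (1 : ℤ) ≤ l j ^ 2 := by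
        have : 0 < l j ^ 2 := by
          have : l j ≠ 0 := hj
          positivity
        omega
      exact_mod_cast this
    exact h1.trans (Finset.single_le_sum (f := fun j => (l j : ℝ) ^ 2)
      (fun i _ => sq_nonneg _) (Finset.mem_univ j))
  have hr1 : 1 ≤ r := by rw [hr, Real.le_sqrt' one_pos]; simpa using hone
  have hr0 : 0 < r := by linarith
  have hrsq : r ^ 2 = ∑ j, (l j : ℝ) ^ 2 := Real.sq_sqrt (by linarith)
  have hb : bracket l = r := max_eq_right hr1
  obtain ⟨n, hn, hle⟩ := hmain (E, fun j => (l j : ℝ) / r) ⟨hEx, by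
    rw [mem_ofPred_eq]
    simp only [div_pow]
    rw [← Finset.sum_div, ← hrsq, div_self (by positivity)]⟩
  have hdot : iteratedDerivWithin n ω (Icc E₁ E₂) E ⬝ᵥ (fun j => (l j : ℝ)) =
      r * (iteratedDerivWithin n ω (Icc E₁ E₂) E ⬝ᵥ fun j => (l j : ℝ) / r) := by
    simp only [dotProduct, Finset.mul_sum]
    refine Finset.sum_congr rfl fun j _ => ?_
    field_simp
  refine le_trans ?_ (Finset.le_sup' (fun n => |iteratedDerivWithin n ω (Icc E₁ E₂) E ⬝ᵥ
    (fun j => (l j : ℝ))|) (Finset.mem_range.2 (Nat.lt_succ_of_le hn)))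
  rw [hb, hdot, abs_mul, abs_of_pos hr0, mul_comm]
  gcongr

end

/-- Otherwise, for infinitely many `m`, some unit vector would annihilate `ω m` on `s`. A limit
point of these vectors would be a unit vector annihilating the limit curve, and pointwise
convergence is enough for that. -/
lemma eventually_nondegenerate {κ : ℕ} {ω : ℕ → ℝ → Fin κ → ℝ} {ω' : ℝ → Fin κ → ℝ} {s : Set ℝ}
    (hlim : ∀ x ∈ s, Tendsto (fun m => ω m x) atTop (𝓝 (ω' x)))
    (hli : ∀ c : Fin κ → ℝ, (∀ x ∈ s, ω' x ⬝ᵥ c = 0) → c = 0) :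
    ∀ᶠ m in atTop, ∀ c : Fin κ → ℝ, c ≠ 0 → ∃ x ∈ s, ω m x ⬝ᵥ c ≠ 0 := by
  by_contra hcon
  have hfr : ∃ᶠ m in atTop, ∃ c ∈ {c : Fin κ → ℝ | ∑ j, c j ^ 2 = 1},
      ∀ x ∈ s, ω m x ⬝ᵥ c = 0 := by
    refine (not_eventually.1 hcon).mono fun m hm => ?_
    push Not at hm
    obtain ⟨c, hc, hz⟩ := hm
    have hpos : 0 < ∑ j, c j ^ 2 := by
      obtain ⟨j, hj⟩ := Function.ne_iff.1 hc
      have hj' : 0 < c j ^ 2 := by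
        have : c j ≠ 0 := hj
        positivity
      exact hj'.trans_le (Finset.single_le_sum (f := fun j => c j ^ 2)
        (fun i _ => sq_nonneg _) (Finset.mem_univ j))
    refine ⟨(√(∑ j, c j ^ 2))⁻¹ • c, ?_, fun x hx => ?_⟩
    · rw [mem_ofPred_eq]
      simp only [Pi.smul_apply, smul_eq_mul, mul_pow]
      rw [← Finset.mul_sum, inv_pow, Real.sq_sqrt hpos.le, inv_mul_cancel₀ hpos.ne']
    · rw [dotProduct_smul, hz x hx, smul_zero]
  obtain ⟨φ, hφ, hP⟩ := extraction_of_frequently_atTop hfr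
  choose c hc hz using hP
  obtain ⟨c', hc', ψ, hψ, hconv⟩ := (isCompact_sphere_pi κ).tendsto_subseq hc
  have hc0 : c' = 0 := by
    refine hli c' fun x hx => ?_
    have h1 : Tendsto (fun k => ω (φ (ψ k)) x) atTop (𝓝 (ω' x)) :=
      (hlim x hx).comp (hφ.comp hψ).tendsto_atTop
    have h3 : Continuous fun y : (Fin κ → ℝ) × (Fin κ → ℝ) => y.1 ⬝ᵥ y.2 := by
      unfold dotProduct
      fun_prop
    have h2 : Tendsto (fun k => ω (φ (ψ k)) x ⬝ᵥ c (ψ k)) atTop (𝓝 (ω' x ⬝ᵥ c')) :=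
      (h3.tendsto (ω' x, c')).comp (h1.prodMk_nhds hconv)
    refine tendsto_nhds_unique h2 ?_
    simp only [hz (ψ _) x hx]
    exact tendsto_const_nhds
  rw [hc0] at hc'
  simp at hc'

/-! ### Analyticity and convergence of the perturbed frequencies -/

/-- The angle `β` in the `n`-th window such that `-E² sin² β` is an eigenvalue of the potential. -/
def potAngle (κ m : ℕ) (g : ℝ → Polynomial ℝ) (n : ℕ) (E : ℝ) : ℝ :=
  Classical.epsilon fun b => b ∈ Ioo (angleLo κ n) (angleHi κ n) ∧
    endValue (shiftedPot κ m (g E) E b) = 0 ∧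
    ∀ t ∈ Icc (angleLo κ n) (angleHi κ n), endValue (shiftedPot κ m (g E) E t) = 0 → t = b

lemma potAngle_spec {κ m : ℕ} {g : ℝ → Polynomial ℝ} {E : ℝ} (hE : 0 < E)
    (h : SignPattern κ (fun β => endValue (shiftedPot κ m (g E) E β))
      (fun β => endSlope (shiftedPot κ m (g E) E β))) {n : ℕ} (hn : n < κ) :
    potAngle κ m g n E ∈ Ioo (angleLo κ n) (angleHi κ n) ∧
    endValue (shiftedPot κ m (g E) E (potAngle κ m g n E)) = 0 ∧
    ∀ t ∈ Icc (angleLo κ n) (angleHi κ n), endValue (shiftedPot κ m (g E) E t) = 0 →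
      t = potAngle κ m g n E := by
  obtain ⟨b, hb⟩ := existsUnique_zero_window hE.ne' h hn
  exact Classical.epsilon_spec (p := fun b => b ∈ Ioo (angleLo κ n) (angleHi κ n) ∧
    endValue (shiftedPot κ m (g E) E b) = 0 ∧
    ∀ t ∈ Icc (angleLo κ n) (angleHi κ n), endValue (shiftedPot κ m (g E) E t) = 0 → t = b) ⟨b, hb⟩

lemma isNthEigenvalue_potential {κ m : ℕ} {g : ℝ → Polynomial ℝ} {E : ℝ} (hE : 0 < E)
    (heven : ∀ z, (g E).eval (-z) = (g E).eval z)
    (h : SignPattern κ (fun β => endValue (shiftedPot κ m (g E) E β))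
      (fun β => endSlope (shiftedPot κ m (g E) E β)))
    (hV : ∀ y, -E ^ 2 - 1 ≤ potentialI κ m (g E) E y) {n : ℕ} (hn : n < κ) :
    IsNthEigenvalue (potential κ m (g E) E) n (-(E * Real.sin (potAngle κ m g n E)) ^ 2) :=
  isNthEigenvalue_of_window (V := potentialI κ m (g E) E) (potentialI_apply κ m (g E) E)
    (potential_neg κ m heven E) hE h hV (b := fun n => potAngle κ m g n E)
    (fun _ hn => (potAngle_spec hE h hn).1) (fun _ hn => (potAngle_spec hE h hn).2.1)
    (fun _ hn => (potAngle_spec hE h hn).2.2) hn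

lemma sin_potAngle_pos {κ m : ℕ} {g : ℝ → Polynomial ℝ} {E : ℝ} (hE : 0 < E)
    (h : SignPattern κ (fun β => endValue (shiftedPot κ m (g E) E β))
      (fun β => endSlope (shiftedPot κ m (g E) E β))) {n : ℕ} (hn : n < κ) :
    0 < Real.sin (potAngle κ m g n E) := by
  have h1 := (potAngle_spec hE h hn).1
  have h2 := angle_spec hn
  exact Real.sin_pos_of_pos_of_lt_pi (by linarith [h1.1]) (by linarith [h1.2, Real.pi_pos])

lemma frequency_eq {κ m : ℕ} {g : ℝ → Polynomial ℝ} {E : ℝ} (hE : 0 < E)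
    (heven : ∀ z, (g E).eval (-z) = (g E).eval z)
    (h : SignPattern κ (fun β => endValue (shiftedPot κ m (g E) E β))
      (fun β => endSlope (shiftedPot κ m (g E) E β)))
    (hV : ∀ y, -E ^ 2 - 1 ≤ potentialI κ m (g E) E y) (j : Fin κ) :
    frequency κ m g E j = E * Real.sin (potAngle κ m g j E) := by
  rw [frequency, (isNthEigenvalue_potential hE heven h hV j.2).eigenvalue_eq, neg_neg,
    Real.sqrt_sq (mul_pos hE (sin_potAngle_pos hE h j.2)).le]

/-- At a zero of `D` the Wronskian inequality reduces to `P D' < 0`, so the implicit function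
theorem applies; the continuity it requires follows from uniqueness of the zero in the window. -/
lemma analyticOn_potAngle {κ m d : ℕ} {g : ℝ → Polynomial ℝ} {s : Set ℝ} (hs : ∀ E ∈ s, 0 < E)
    (hd : ∀ E ∈ s, (g E).natDegree ≤ d) (hg : ∀ k, AnalyticOn ℝ (fun E => (g E).coeff k) s)
    (h : ∀ E ∈ s, SignPattern κ (fun β => endValue (shiftedPot κ m (g E) E β))
      (fun β => endSlope (shiftedPot κ m (g E) E β))) {n : ℕ} (hn : n < κ) :
    AnalyticOn ℝ (potAngle κ m g n) s := by
  intro x hx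
  obtain ⟨h0, h1, h2, h3, h4⟩ := angle_spec hn
  obtain ⟨U, hUa, hU⟩ := exists_analyticAt_potentialI κ m hd hg hx
  obtain ⟨hb, hb0, hbu⟩ := potAngle_spec (hs x hx) (h x hx) hn
  have hUs : ∀ E ∈ s, ∀ t, U E - (-(E * Real.sin t) ^ 2) • 1 = shiftedPot κ m (g E) E t := by
    intro E hE t
    rw [hU E hE]; rfl
  have hFa : ∀ t, AnalyticAt ℝ
      (fun y : ℝ × ℝ => endValue (U y.1 - (-(y.1 * Real.sin y.2) ^ 2) • 1)) (x, t) := by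
    intro t
    have h5 : AnalyticAt ℝ (fun y : ℝ × ℝ => y.1) (x, t) := analyticAt_fst
    have h6 : AnalyticAt ℝ (fun y : ℝ × ℝ => Real.sin y.2) (x, t) :=
      AnalyticAt.comp (g := Real.sin) Real.analyticAt_sin analyticAt_snd
    have h7 : AnalyticAt ℝ (fun y : ℝ × ℝ => U y.1) (x, t) :=
      AnalyticAt.comp (g := U) (f := fun y : ℝ × ℝ => y.1) hUa h5
    exact AnalyticAt.comp (g := endValue) (analyticAt_endValue _)
      (h7.sub (((h5.mul h6).pow 2).neg.smul analyticAt_const))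
  have hcont : ∀ E, ContinuousOn (fun t => (-1) ^ n * endValue (shiftedPot κ m (g E) E t))
      (Icc (angleLo κ n) (angleHi κ n)) := fun E =>
    (continuous_const.mul (continuous_endValue_angle (potentialI κ m (g E) E) E)).continuousOn
  have hzero : ∀ E t, (-1) ^ n * endValue (shiftedPot κ m (g E) E t) = 0 →
      endValue (shiftedPot κ m (g E) E t) = 0 :=
    fun E t h => (mul_eq_zero.1 h).resolve_left (by simp)
  obtain ⟨hs1, hs2⟩ := sign_of_unique_zero (hcont x) ((h x hx).value_neg n hn)
    ((h x hx).value_pos n hn _ le_rfl h2.le (by linarith [Real.pi_pos]))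
    (fun t ht ht0 => hbu t ht (hzero x t ht0))
  refine analyticWithinAt_of_implicit
    (F := fun y : ℝ × ℝ => endValue (U y.1 - (-(y.1 * Real.sin y.2) ^ 2) • 1)) hx (hFa _) ?_ ?_ ?_
  · obtain ⟨e, p, he, -, hlt⟩ := endValue_deriv_angle (U x) (hs x hx).ne' (h0.trans hb.1)
      (hb.2.trans h2)
    rw [he.deriv]
    rintro rfl
    rw [hUs x hx, hb0] at hlt
    simp at hlt
  · refine tendsto_unique_zero (F := fun E t => (-1) ^ n * endValue (shiftedPot κ m (g E) E t))
      (f := fun t => (-1) ^ n * endValue (shiftedPot κ m (g x) x t)) (Eventually.of_forall hcont)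
      ?_ ?_ hb hs1 hs2
    · filter_upwards [self_mem_nhdsWithin] with y hy t ht ht0
      exact (potAngle_spec (hs y hy) (h y hy) hn).2.2 t ht (hzero y t ht0)
    · intro t ht
      have h5 : ContinuousAt (fun E => endValue (U E - (-(E * Real.sin t) ^ 2) • 1)) x :=
        ContinuousAt.comp (f := fun E : ℝ => (E, t)) (hFa t).continuousAt
          (Continuous.continuousAt (by fun_prop))
      have h6 := (h5.tendsto.mono_left (nhdsWithin_le_nhds (s := s))).const_mul ((-1 : ℝ) ^ n)
      rw [hUs x hx] at h6
      refine h6.congr' ?_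
      filter_upwards [self_mem_nhdsWithin] with y hy
      rw [hUs y hy]
  · intro y hy
    simp only [hUs y hy]
    exact (potAngle_spec (hs y hy) (h y hy) hn).2.1

section

variable {κ S m₁ : ℕ} {E₁ E₂ : ℝ} {node : ℕ → ℝ → Fin κ → ℝ} {g : ℕ → ℝ → Polynomial ℝ}

lemma tendsto_potAngle (hg : IsCorrector κ S E₁ E₂ m₁ node g)
    (hE₁ : wellSize κ < E₁) (hκ : 1 ≤ κ) {E : ℝ} (hE : E ∈ Icc E₁ E₂) {n : ℕ} (hn : n < κ) :
    Tendsto (fun m => potAngle κ m (g m) n E) atTop (𝓝 (wellAngle κ n E)) := by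
  have hpi := Real.pi_pos
  have hE₁₂ : E₁ ≤ E₂ := hE.1.trans hE.2
  have haE : wellSize κ < E := hE₁.trans_le hE.1
  have hE0 : 0 < E := (wellSize_pos κ).trans haE
  obtain ⟨h0, h1, h2, h3, h4⟩ := angle_spec hn
  obtain ⟨hb, hb0, hbu⟩ := wellAngle_spec hn haE
  have hsin : ∀ t ∈ Icc (angleLo κ n) (angleHi κ n), 0 < Real.sin t := fun t ht =>
    Real.sin_pos_of_pos_of_lt_pi (by linarith [ht.1]) (by linarith [ht.2])
  have hzero : ∀ x : ℝ, (-1) ^ n * x = 0 → x = 0 :=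
    fun x h => (mul_eq_zero.1 h).resolve_left (by simp)
  have hpat := signPattern_lim κ haE
  have hcont : ContinuousOn (fun t => (-1) ^ n * limValue (wellSize κ) E t)
      (Icc (angleLo κ n) (angleHi κ n)) := by
    have := (continuousOn_limValue (wellSize κ)).comp
      (f := fun β : ℝ => (E, β)) (s := Icc (angleLo κ n) (angleHi κ n))
      (Continuous.continuousOn (by fun_prop)) (fun β hβ => (hsin β hβ).ne')
    exact continuousOn_const.mul this
  obtain ⟨hs1, hs2⟩ := sign_of_unique_zero hcont (hpat.value_neg n hn)
    (hpat.value_pos n hn _ le_rfl h2.le (by linarith))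
    (fun t ht ht0 => hbu t ht (hzero _ ht0))
  refine tendsto_unique_zero
    (F := fun m t => (-1) ^ n * endValue (shiftedPot κ m (g m E) E t))
    (f := fun t => (-1) ^ n * limValue (wellSize κ) E t)
    (Eventually.of_forall fun m => (continuous_const.mul
      (continuous_endValue_angle (potentialI κ m (g m E) E) E)).continuousOn) ?_ ?_ hb hs1 hs2
  · filter_upwards [eventually_signPattern hg hE₁ hE₁₂ hκ] with m hm t ht ht0
    exact (potAngle_spec hE0 (hm E hE) hn).2.2 t ht (hzero _ ht0)
  · intro t ht
    refine Tendsto.const_mul _ ?_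
    rw [Metric.tendsto_nhds]
    intro ε hε
    filter_upwards [eventually_abs_endValue_sub_limValue_le hg hE₁ hE₁₂ hκ (hsin t ht)
      (half_pos hε)] with m hm
    exact (hm E hE t le_rfl).1.trans_lt (half_lt_self hε)

/-- Supplies the hypothesis of the Sturm comparison: the slack `1` below `-E²` absorbs the corrector
and is still small enough for the cosine to be positive on `[0, 1]`. -/
lemma eventually_potentialI_ge (hg : IsCorrector κ S E₁ E₂ m₁ node g)
    (hE₁ : 0 < E₁) (hE₁₂ : E₁ ≤ E₂) (hκ : 1 ≤ κ) :
    ∀ᶠ m in atTop, ∀ E ∈ Icc E₁ E₂, ∀ y, -E ^ 2 - 1 ≤ potentialI κ m (g m E) E y := by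
  have hE₂ : 0 < E₂ := hE₁.trans_le hE₁₂
  filter_upwards [eventually_abs_corrector_le hg hE₁ hκ
    (show (0 : ℝ) < 1 / E₂ ^ 2 by positivity)] with m hm E hE y
  have h1 := (abs_le.1 (hm E hE y ⟨by linarith [y.2.1], y.2.2⟩)).2
  have h2 := smoothWell_le_one m ((y : ℝ) / width κ E)
  have hE0 : 0 < E := hE₁.trans_le hE.1
  rw [potentialI_apply, potential]
  have h3 : E ^ 2 * (1 / E₂ ^ 2) ≤ 1 := by
    rw [mul_one_div, div_le_one (by positivity)]
    exact pow_le_pow_left₀ hE0.le hE.2 2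
  have h4 : E ^ 2 * (smoothWell m (y / width κ E) + (g m E).eval (y / width κ E)) ≤
      E ^ 2 * (1 + 1 / E₂ ^ 2) := by
    gcongr
  linarith

end

end ShearFlow

end

/-! ### Conclusion -/

theorem proposition5p6 (κ : ℕ) (hκ : 1 ≤ κ) :
    ∃ E₀ : ℝ, (κ + 1 / 4) * Real.pi < E₀ ∧
      ∀ E₁ E₂ : ℝ, E₀ ≤ E₁ → E₁ < E₂ →
      ∀ (S m₁ : ℕ) (node : ℕ → ℝ → Fin κ → ℝ) (g : ℕ → ℝ → Polynomial ℝ),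
        ShearFlow.IsCorrector κ S E₁ E₂ m₁ node g →
        ∃ mbar : ℕ, ∀ m, mbar ≤ m →
          -- the frequencies are well defined, positive and analytic in `E`
          (∀ E ∈ Set.Icc E₁ E₂, ∀ j : Fin κ,
            0 < ShearFlow.frequency κ m (g m) E j ∧
            ShearFlow.IsNthEigenvalue (ShearFlow.potential κ m (g m E) E) j
              (-(ShearFlow.frequency κ m (g m) E j) ^ 2)) ∧
          AnalyticOn ℝ (ShearFlow.frequency κ m (g m)) (Set.Icc E₁ E₂) ∧
          -- transversality
          ∃ (m₀ : ℕ) (ρ₀ : ℝ), 0 < ρ₀ ∧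
            ∀ E ∈ Set.Icc E₁ E₂, ∀ l : Fin κ → ℤ, l ≠ 0 →
              ρ₀ * ShearFlow.bracket l ≤
                (Finset.range (m₀ + 1)).sup' Finset.nonempty_range_add_one (fun n =>
                  |iteratedDerivWithin n (ShearFlow.frequency κ m (g m)) (Set.Icc E₁ E₂) E
                    ⬝ᵥ (fun j => (l j : ℝ))|) := by
  -- Nothing is asked of the threshold beyond exceeding `(κ + 1/4) π`: the large-`E` asymptotics
  -- enter only through analytic continuation.
  refine ⟨ShearFlow.wellSize κ + 1, lt_add_one _, fun E₁ E₂ hE₀ hE₁₂ S m₁ node g hg => ?_⟩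
  have hE₁ : ShearFlow.wellSize κ < E₁ := by linarith
  have hpos : ∀ E ∈ Set.Icc E₁ E₂, 0 < E := fun E hE =>
    (ShearFlow.wellSize_pos κ).trans (hE₁.trans_le hE.1)
  obtain ⟨d, hd⟩ := hg.degree
  have hli := ShearFlow.eventually_nondegenerate (s := Set.Icc E₁ E₂)
    (ω := fun m E j => E * Real.sin (ShearFlow.potAngle κ m (g m) (j : Fin κ) E))
    (ω' := fun E j => E * Real.sin (ShearFlow.wellAngle κ j E))
    (fun x hx => tendsto_pi_nhds.2 fun j => ((Real.continuous_sin.tendsto _).comp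
      (ShearFlow.tendsto_potAngle hg hE₁ hκ hx j.2)).const_mul x)
    (fun c hc => ShearFlow.wellAngle_linearIndependent hE₁ hE₁₂ fun E hE => by
      have h1 := hc E hE
      have h2 : E * ∑ j : Fin κ, c j * Real.sin (ShearFlow.wellAngle κ j E) = 0 := by
        rw [← h1, dotProduct, Finset.mul_sum]
        exact Finset.sum_congr rfl fun j _ => by ring
      exact (mul_eq_zero.1 h2).resolve_left (hpos E hE).ne')
  -- The sign pattern, the lower bound and nondegeneracy hold from one common index on; `m ≥ m₁` is
  -- added because the correctors are constrained only from there.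
  have hev := (ShearFlow.eventually_signPattern hg hE₁ hE₁₂.le hκ).and
    ((ShearFlow.eventually_potentialI_ge hg (hpos E₁ ⟨le_rfl, hE₁₂.le⟩) hE₁₂.le hκ).and
      (hli.and (Filter.eventually_ge_atTop m₁)))
  obtain ⟨mbar, hmbar⟩ := Filter.eventually_atTop.1 hev
  refine ⟨mbar, fun m hm => ?_⟩
  obtain ⟨hsp, hV, hnd, hm₁⟩ := hmbar m hm
  have hfreq : ∀ E ∈ Set.Icc E₁ E₂, ShearFlow.frequency κ m (g m) E =
      fun j : Fin κ => E * Real.sin (ShearFlow.potAngle κ m (g m) j E) := fun E hE =>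
    funext fun j => ShearFlow.frequency_eq (hpos E hE) (hg.even m hm₁ E hE) (hsp E hE) (hV E hE) j
  have han : AnalyticOn ℝ (ShearFlow.frequency κ m (g m)) (Set.Icc E₁ E₂) := by
    have h1 : AnalyticOn ℝ (fun (E : ℝ) (j : Fin κ) =>
        E * Real.sin (ShearFlow.potAngle κ m (g m) j E)) (Set.Icc E₁ E₂) := by
      refine AnalyticOn.pi fun j => ?_
      have h2 := ShearFlow.analyticOn_potAngle hpos (hd m hm₁) (hg.analytic m hm₁) hsp j.2
      exact analyticOn_id.mul (Real.analyticOnNhd_sin.analyticOn.comp h2 fun _ _ => Set.mem_univ _)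
    exact h1.congr hfreq
  refine ⟨fun E hE j => ?_, han, ?_⟩
  · rw [congrFun (hfreq E hE) j]
    exact ⟨mul_pos (hpos E hE) (ShearFlow.sin_potAngle_pos (hpos E hE) (hsp E hE) j.2),
      ShearFlow.isNthEigenvalue_potential (hpos E hE) (hg.even m hm₁ E hE) (hsp E hE) (hV E hE) j.2⟩
  · refine ShearFlow.exists_transversality hE₁₂ han fun c hc => ?_
    obtain ⟨x, hx, hne⟩ := hnd c hc
    exact ⟨x, hx, by rwa [hfreq x hx]⟩
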